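/- Let $d\ge 1$ and $g\ge 0$ be integers. Let $\Sigma_{g,d}$ be the connected, closed, orientable surface of genus $g$ with $d$ open discs (with pairwise disjoint closures, each the interior of an embedded closed disc) removed, and let $S^2_d$ be the $2$-sphere with $d$ such open discs removed. There is a $d$-fold unbranched covering $\Sigma_{g,d}\rightarrow S^2_d$ (that is, a covering map all of whose fibres have exactly $d$ points) if and only if \[ g=\frac{(d-1)(d-2)}{2}. \] -/

import Mathlib

noncomputable section

namespace GenusSurface

/-- Centre of the `j`-th hole: the `g` centres are equally spaced on the real axis inside
`(-1/2, 1/2)`, consecutive ones at distance `1 / g`. -/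
def holeCentre (g : ℕ) (j : Fin g) : ℂ :=
  (((2 * (j : ℝ) + 1) / g - 1) / 2 : ℝ)

/-- Common radius of the `g` holes.  The closed holes are pairwise disjoint and lie in the open
disc of radius `1/2` about the origin. -/
def holeRadius (g : ℕ) : ℝ := 1 / (4 * g)

/-- The closed unit disc with `g` disjoint open round discs removed. -/
def holedDisc (g : ℕ) : Set ℂ :=
  {z | ‖z‖ ≤ 1 ∧ ∀ j : Fin g, holeRadius g ≤ ‖z - holeCentre g j‖}

/-- A function which on `holedDisc g` is nonnegative and vanishes exactly on the `g + 1` boundary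
circles. -/
def profile (g : ℕ) (z : ℂ) : ℝ :=
  (1 - ‖z‖ ^ 2) * ∏ j : Fin g, (‖z - holeCentre g j‖ ^ 2 - holeRadius g ^ 2)

/-- The connected, closed, orientable surface of genus `g`, standardly embedded in
`ℝ³ = ℂ × ℝ` as the boundary of a planar handlebody with `g` handles: over each interior point of
the disc with `g` holes it has one point above and one point below the plane, and these two sheets
are joined along the `g + 1` boundary circles.  For `g = 0` it is the round unit sphere. -/
def closedSurface (g : ℕ) : Set (ℂ × ℝ) :=
  {p | p.1 ∈ holedDisc g ∧ p.2 ^ 2 = profile g p.1}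

/-- Centres of the `d` removed discs: equally spaced points of the open upper half of the unit
circle. -/
def discCentre (d : ℕ) (k : Fin d) : ℂ :=
  Complex.exp (((2 * (k : ℝ) + 1) * Real.pi / (2 * d) : ℝ) * Complex.I)

/-- The part of space in front of the vertical plane which cuts off the arc of half-width
`π / (4 d)` about `discCentre d k` from the unit circle.  It meets `closedSurface g` in an open
disc about the point `(discCentre d k, 0)`, namely two copies of a circular segment joined along
the circular arc; it meets the unit sphere in a round open spherical cap.  The closures of these
`d` discs are pairwise disjoint (angles between neighbouring centres are `π / d`), and for `d ≥ 1`
they stay away from the holes since `cos (π / (4 d)) > 1 / 2`. -/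
def discRegion (d : ℕ) (k : Fin d) : Set (ℂ × ℝ) :=
  {p | Real.cos (Real.pi / (4 * d)) < (p.1 * (starRingEnd ℂ) (discCentre d k)).re}

/-- `Σ_{g,d}`: the connected, closed, orientable surface of genus `g` with `d` open discs
removed (with the subspace topology). -/
def surface (g d : ℕ) : Set (ℂ × ℝ) :=
  closedSurface g \ ⋃ k : Fin d, discRegion d k

/-- The round unit 2-sphere in `ℝ³ = ℂ × ℝ`. -/
def sphere : Set (ℂ × ℝ) :=
  {p | ‖p.1‖ ^ 2 + p.2 ^ 2 = 1}

/-- `S²_d`: the 2-sphere with `d` open discs removed (with the subspace topology). -/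
def holedSphere (d : ℕ) : Set (ℂ × ℝ) :=
  sphere \ ⋃ k : Fin d, discRegion d k

/-- `f` is a `d`-fold (unbranched) covering: a covering map all of whose fibres have exactly `d`
points. -/
def IsFoldCovering {X Y : Type*} [TopologicalSpace X] [TopologicalSpace Y]
    (d : ℕ) (f : X → Y) : Prop :=
  IsCoveringMap f ∧ ∀ y : Y, (f ⁻¹' {y}).encard = d

/-- The genus zero surface is the round sphere. -/
theorem closedSurface_zero : closedSurface 0 = sphere := by
  ext ⟨z, t⟩
  simp only [closedSurface, holedDisc, profile, sphere, Set.mem_ofPred_eq, Finset.univ_eq_empty,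
    Finset.prod_empty, mul_one, IsEmpty.forall_iff, and_true]
  constructor
  · rintro ⟨_, h⟩
    linarith
  · intro h
    refine ⟨?_, by linarith⟩
    nlinarith [sq_nonneg t, norm_nonneg z]

end GenusSurface

end

/-! Write `d = n + 1`. Euler characteristics decide the matter: `χ(Σ_{g,d}) = 2 - 2g - d` and
`χ(S²_d) = 2 - d`, so a `d`-fold covering forces `2 - 2g - d = d(2 - d)`, that is `2g = (d - 1)(d -
2)`. Conversely, take a covering with group `ℤ/d` for which the loop around each of the `d` boundary
circles acts by a generator. Each circle then has a connected preimage, so the covering surface has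
`d` boundary circles, and its genus is the required one.

Both directions need a combinatorial model of the concretely embedded surface. `surface_equiv_std`
shows that `surface g (n + 1)` is a disc with `2 * g + n` disjoint ribbons: a polygon whose boundary
word is a product of `g` commutators and `n` trivial pairs `c c⁻¹`, with an unlabelled edge behind
every letter. The surface is cut along the horizontal plane and the vertical plane over the real
axis into four discs (`surface_homeomorph`), which are then merged, and the word is normalised by
cutting and pasting as in the classification of surfaces.

For necessity the Euler characteristic is read off from the group of maps to the circle modulo
doubles, which is `H¹(X; ℤ)/2` and has order `2 ^ (1 - χ)`. For a connected space made of finitely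
many discs with ribbons this order is counted directly (`Ribbons.card_circQuot`). A covering of a
disc with ribbons is again made of discs with ribbons, one disc for each point of a fibre
(`exists_ribbons_of_covering`). Comparing two counts gives `genus_of_covering`.

For sufficiency the sheets of the covering are copies of the base polygon with shifted labels. Going
once around each of the first `n` circles shifts the sheet by `1` or `-1`, and the signs are
balanced so that the last circle shifts by `1` (up to sign) when `d` is even and by `2` when `d` is
odd; either generates `ℤ/d`. The same moves on words bring the glued sheets to the standard word of
the right genus (`sheets_equiv`). -/

noncomputable section
namespace Ribbon
open Set Topology

/-! ### Polar coordinates and radial maps of the disc -/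

/-- The closed unit disc. -/
abbrev Disc := ↥(Metric.closedBall (0 : ℂ) 1)

instance : CompactSpace Disc := isCompact_iff_compactSpace.mp (isCompact_closedBall 0 1)

theorem Disc.norm_le (z : Disc) : ‖(z : ℂ)‖ ≤ 1 := mem_closedBall_zero_iff.1 z.2

/-- The point at angle `2πu` of the unit circle. -/
def circ (u : ℝ) : ℂ := Complex.exp (2 * Real.pi * u * Complex.I)

theorem norm_circ (u : ℝ) : ‖circ u‖ = 1 := by
  rw [circ, show (2 * Real.pi * u * Complex.I : ℂ) = ((2 * Real.pi * u : ℝ) : ℂ) * Complex.I by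
    push_cast; ring]
  exact Complex.norm_exp_ofReal_mul_I _

theorem continuous_circ : Continuous circ := by unfold circ; fun_prop

theorem circ_add (u v : ℝ) : circ (u + v) = circ u * circ v := by
  rw [circ, circ, circ, ← Complex.exp_add]; congr 1; push_cast; ring

theorem circ_eq_iff (u v : ℝ) : circ u = circ v ↔ ∃ n : ℤ, u = v + n := by
  rw [circ, circ, Complex.exp_eq_exp_iff_exists_int]
  refine exists_congr fun n => ?_
  have h : (2 * Real.pi * Complex.I : ℂ) ≠ 0 := Complex.two_pi_I_ne_zero
  rw [show (2 * Real.pi * u * Complex.I : ℂ) = (2 * Real.pi * Complex.I) * u by ring,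
    show (2 * Real.pi * v * Complex.I + n * (2 * Real.pi * Complex.I) : ℂ)
      = (2 * Real.pi * Complex.I) * (v + n) by ring, mul_right_inj' h]
  exact_mod_cast Iff.rfl

theorem circ_re (u : ℝ) : (circ u).re = Real.cos (2 * Real.pi * u) := by
  rw [circ, show (2 * Real.pi * u * Complex.I : ℂ) = ((2 * Real.pi * u : ℝ) : ℂ) * Complex.I by
    push_cast; ring, Complex.exp_ofReal_mul_I_re]

theorem circ_im (u : ℝ) : (circ u).im = Real.sin (2 * Real.pi * u) := by
  rw [circ, show (2 * Real.pi * u * Complex.I : ℂ) = ((2 * Real.pi * u : ℝ) : ℂ) * Complex.I by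
    push_cast; ring, Complex.exp_ofReal_mul_I_im]

theorem exists_circ (z : ℂ) : ∃ θ ∈ Icc (0 : ℝ) 1, z = ‖z‖ * circ θ := by
  refine ⟨Int.fract (z.arg / (2 * Real.pi)), ⟨Int.fract_nonneg _, (Int.fract_lt_one _).le⟩, ?_⟩
  have : circ (Int.fract (z.arg / (2 * Real.pi))) = circ (z.arg / (2 * Real.pi)) :=
    (circ_eq_iff _ _).2 ⟨-⌊z.arg / (2 * Real.pi)⌋, by rw [Int.fract]; push_cast; ring⟩
  rw [this, circ]
  conv_lhs => rw [← Complex.norm_mul_exp_arg_mul_I z]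
  congr 2
  have : (Real.pi : ℂ) ≠ 0 := by exact_mod_cast Real.pi_ne_zero
  push_cast; field_simp

/-- The point at angle `2πu` of the boundary circle of the disc. -/
def rim (u : ℝ) : Disc := ⟨circ u, by simp [norm_circ]⟩

theorem continuous_rim : Continuous rim := continuous_circ.subtype_mk _

theorem rim_eq_iff (u v : ℝ) : rim u = rim v ↔ ∃ n : ℤ, u = v + n := by
  rw [← circ_eq_iff, Subtype.ext_iff]; rfl

/-- Polar coordinates on the disc. -/
def polar (p : unitInterval × unitInterval) : Disc :=
  ⟨(p.1 : ℝ) * circ p.2, by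
    simpa [norm_circ, abs_of_nonneg p.1.2.1] using p.1.2.2⟩

theorem continuous_polar : Continuous polar := by
  refine Continuous.subtype_mk ?_ _
  have := continuous_circ
  fun_prop

theorem polar_surjective : Function.Surjective polar := by
  intro z
  obtain ⟨θ, hθ, h⟩ := exists_circ z
  exact ⟨(⟨‖(z : ℂ)‖, norm_nonneg _, z.norm_le⟩, ⟨θ, hθ⟩), Subtype.ext h.symm⟩

/-- Polar coordinates as a bundled map. -/
def polarMap : C(unitInterval × unitInterval, Disc) := ⟨polar, continuous_polar⟩

theorem isQuotientMap_polar : IsQuotientMap polarMap :=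
  continuous_polar.isClosedMap.isQuotientMap continuous_polar polar_surjective

theorem polar_one (θ : unitInterval) : polar (1, θ) = rim θ := Subtype.ext (by simp [polar, rim])

/-- A self-map of the unit interval fixing the endpoints induces a radial self-map of the disc. -/
theorem exists_radial (f : ℝ → ℝ) (hf : Continuous f) (h0 : f 0 = 0) (h1 : f 1 = 1) :
    ∃ F : C(Disc, Disc), ∀ (r : unitInterval) (θ : unitInterval),
      (F (polar (r, θ)) : ℂ) = r * circ (f θ) := by
  let G : C(unitInterval × unitInterval, Disc) := ⟨fun p => ⟨(p.1 : ℝ) * circ (f p.2), by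
    simpa [norm_circ, abs_of_nonneg p.1.2.1] using p.1.2.2⟩, by
      refine Continuous.subtype_mk ?_ _
      have := continuous_circ
      fun_prop⟩
  -- Polar coordinates are ambiguous only at the origin, where the image is `0` for every angle, and
  -- between the angles `0` and `1`, both fixed by `f`.
  have hG : Function.FactorsThrough G polarMap := by
    rintro ⟨r, θ⟩ ⟨r', θ'⟩ h
    have h' : (r : ℂ) * circ θ = (r' : ℂ) * circ θ' := Subtype.ext_iff.1 h
    have hr : (r : ℝ) = r' := by
      have := congrArg norm h'
      simpa [norm_circ, abs_of_nonneg r.2.1, abs_of_nonneg r'.2.1] using this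
    have hr' : r = r' := Subtype.ext hr
    subst hr'
    apply Subtype.ext
    change (r : ℂ) * circ (f θ) = (r : ℂ) * circ (f θ')
    rcases eq_or_ne (r : ℂ) 0 with h0' | h0'
    · simp [h0']
    · have hc := mul_left_cancel₀ h0' h'
      obtain ⟨n, hn⟩ := (circ_eq_iff _ _).1 hc
      have a1 := θ.2.1; have a2 := θ.2.2; have b1 := θ'.2.1; have b2 := θ'.2.2
      have hn1 : (n : ℝ) ≤ 1 := by linarith
      have hn2 : (-1 : ℝ) ≤ n := by linarith
      have hn1' : n ≤ 1 := by exact_mod_cast hn1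
      have hn2' : -1 ≤ n := by exact_mod_cast hn2
      congr 1
      interval_cases n
      · have e1 : (θ : ℝ) = 0 := by push_cast at hn; linarith
        have e2 : (θ' : ℝ) = 1 := by push_cast at hn; linarith
        rw [e1, e2, h0, h1, circ_eq_iff]; exact ⟨-1, by simp⟩
      · have e1 : (θ : ℝ) = θ' := by push_cast at hn; linarith
        rw [e1]
      · have e1 : (θ : ℝ) = 1 := by push_cast at hn; linarith
        have e2 : (θ' : ℝ) = 0 := by push_cast at hn; linarith
        rw [e1, e2, h0, h1, circ_eq_iff]; exact ⟨1, by simp⟩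
  refine ⟨isQuotientMap_polar.lift G hG, fun r θ => ?_⟩
  have : isQuotientMap_polar.lift G hG (polar (r, θ)) = G (r, θ) :=
    congrArg (fun k => k (r, θ)) (isQuotientMap_polar.lift_comp G hG)
  rw [this]; rfl

/-- Mutually inverse self-maps of the unit interval fixing the endpoints induce a homeomorphism of
the disc. -/
theorem exists_radial_homeomorph (f g : ℝ → ℝ) (hf : Continuous f) (hg : Continuous g)
    (h0 : f 0 = 0) (h1 : f 1 = 1) (hfI : ∀ u ∈ Icc (0 : ℝ) 1, f u ∈ Icc (0 : ℝ) 1)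
    (hgI : ∀ u ∈ Icc (0 : ℝ) 1, g u ∈ Icc (0 : ℝ) 1)
    (hgf : ∀ u ∈ Icc (0 : ℝ) 1, g (f u) = u) (hfg : ∀ u ∈ Icc (0 : ℝ) 1, f (g u) = u) :
    ∃ F : Disc ≃ₜ Disc, ∀ u ∈ Icc (0 : ℝ) 1, F (rim u) = rim (f u) := by
  have g0 : g 0 = 0 := by simpa [h0] using hgf 0 (by simp)
  have g1 : g 1 = 1 := by simpa [h1] using hgf 1 (by simp)
  obtain ⟨F, hF⟩ := exists_radial f hf h0 h1
  obtain ⟨G, hG⟩ := exists_radial g hg g0 g1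
  have hF' (r θ : unitInterval) : F (polar (r, θ)) = polar (r, ⟨f θ, hfI _ θ.2⟩) :=
    Subtype.ext (hF r θ)
  have hG' (r θ : unitInterval) : G (polar (r, θ)) = polar (r, ⟨g θ, hgI _ θ.2⟩) :=
    Subtype.ext (hG r θ)
  refine ⟨⟨⟨F, G, fun z => ?_, fun z => ?_⟩, F.continuous, G.continuous⟩, fun u hu => ?_⟩
  · obtain ⟨⟨r, θ⟩, rfl⟩ := polar_surjective z
    rw [hF', hG']; simp [hgf _ θ.2]
  · obtain ⟨⟨r, θ⟩, rfl⟩ := polar_surjective z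
    rw [hG', hF']; simp [hfg _ θ.2]
  · have := hF' 1 ⟨u, hu⟩
    rw [polar_one, polar_one] at this
    exact this

/-! ### Gluing along labelled edges -/

/-- A scheme: a space together with labelled edges in it, each edge being parametrised by
`t ∈ [0, 1]`; `edge a t x` says that `x` is a point at parameter `t` of an edge labelled `a`. -/
structure Scheme (α : Type) where
  carrier : Type
  [top : TopologicalSpace carrier]
  edge : α → ℝ → carrier → Prop

attribute [instance] Scheme.top

namespace Scheme
variable {α β : Type}

/-- Two points are glued when they are points with the same parameter of edges with the same
label. -/
def rel (S : Scheme α) (x y : S.carrier) : Prop := ∃ a t, S.edge a t x ∧ S.edge a t y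

/-- The space obtained by gluing edges with equal labels. -/
def space (S : Scheme α) : Type := Quot S.rel

instance (S : Scheme α) : TopologicalSpace S.space := inferInstanceAs (TopologicalSpace (Quot S.rel))

def mk' (S : Scheme α) (x : S.carrier) : S.space := Quot.mk _ x

theorem isQuotientMap_mk' (S : Scheme α) : IsQuotientMap S.mk' := isQuotientMap_quot_mk

theorem continuous_mk' (S : Scheme α) : Continuous S.mk' := S.isQuotientMap_mk'.continuous

theorem glue {S : Scheme α} {a : α} {t : ℝ} {x y : S.carrier} (hx : S.edge a t x)
    (hy : S.edge a t y) : S.mk' x = S.mk' y := Quot.sound ⟨a, t, hx, hy⟩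

instance (S : Scheme α) [CompactSpace S.carrier] : CompactSpace S.space :=
  inferInstanceAs (CompactSpace (Quot S.rel))

/-- Descend a map to the glued space. -/
def desc (S : Scheme α) {X : Type} [TopologicalSpace X] (f : S.carrier → X)
    (h : ∀ a t x y, S.edge a t x → S.edge a t y → f x = f y) : S.space → X :=
  Quot.lift f fun x y ⟨a, t, hx, hy⟩ => h a t x y hx hy

theorem continuous_desc (S : Scheme α) {X : Type} [TopologicalSpace X] {f : S.carrier → X}
    (hf : Continuous f) (h) : Continuous (S.desc f h) := continuous_quot_lift _ hf

@[simp] theorem desc_mk' (S : Scheme α) {X : Type} [TopologicalSpace X] (f : S.carrier → X) (h)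
    (x : S.carrier) : S.desc f h (S.mk' x) = f x := rfl

/-- Schemes with homeomorphic glued spaces. -/
def Equiv (S : Scheme α) (T : Scheme β) : Prop := Nonempty (S.space ≃ₜ T.space)

theorem Equiv.refl (S : Scheme α) : S.Equiv S := ⟨Homeomorph.refl _⟩
theorem Equiv.symm {S : Scheme α} {T : Scheme β} : S.Equiv T → T.Equiv S := fun ⟨h⟩ => ⟨h.symm⟩
theorem Equiv.trans {γ : Type} {S : Scheme α} {T : Scheme β} {U : Scheme γ} :
    S.Equiv T → T.Equiv U → S.Equiv U := fun ⟨h⟩ ⟨k⟩ => ⟨h.trans k⟩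

/-- Isomorphism of schemes. -/
def Iso (S T : Scheme α) : Prop :=
  ∃ e : S.carrier ≃ₜ T.carrier, ∀ a t x, S.edge a t x ↔ T.edge a t (e x)

theorem Iso.refl (S : Scheme α) : S.Iso S := ⟨Homeomorph.refl _, fun _ _ _ => Iff.rfl⟩
theorem Iso.symm {S T : Scheme α} : S.Iso T → T.Iso S :=
  fun ⟨e, h⟩ => ⟨e.symm, fun a t x => by simpa using (h a t (e.symm x)).symm⟩
theorem Iso.trans {S T U : Scheme α} : S.Iso T → T.Iso U → S.Iso U :=
  fun ⟨e, h⟩ ⟨f, k⟩ => ⟨e.trans f, fun a t x => (h a t x).trans (k a t (e x))⟩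

/-- A homeomorphism of carriers identifying the gluing relations identifies the glued spaces. -/
theorem equiv_of_rel {S : Scheme α} {T : Scheme β} (e : S.carrier ≃ₜ T.carrier)
    (h : ∀ x y, S.rel x y → T.mk' (e x) = T.mk' (e y))
    (h' : ∀ x y, T.rel x y → S.mk' (e.symm x) = S.mk' (e.symm y)) : S.Equiv T :=
  ⟨{ toFun := Quot.lift (fun x => T.mk' (e x)) h
     invFun := Quot.lift (fun x => S.mk' (e.symm x)) h'
     left_inv := by rintro ⟨x⟩; change S.mk' (e.symm (e x)) = _; rw [e.symm_apply_apply]; rfl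
     right_inv := by rintro ⟨x⟩; change T.mk' (e (e.symm x)) = _; rw [e.apply_symm_apply]; rfl
     continuous_toFun := continuous_quot_lift _ (T.continuous_mk'.comp e.continuous)
     continuous_invFun := continuous_quot_lift _ (S.continuous_mk'.comp e.symm.continuous) }⟩

theorem Iso.equiv {S T : Scheme α} : S.Iso T → S.Equiv T := fun ⟨e, h⟩ =>
  equiv_of_rel e (fun x y ⟨a, t, hx, hy⟩ => glue ((h a t x).1 hx) ((h a t y).1 hy))
    (fun x y ⟨a, t, hx, hy⟩ => glue ((h a t _).2 (by simpa using hx)) ((h a t _).2 (by simpa using hy)))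

/-- Disjoint union. -/
@[reducible] def sum (S T : Scheme α) : Scheme α :=
  ⟨S.carrier ⊕ T.carrier, fun a t => Sum.elim (S.edge a t) (T.edge a t)⟩

/-- The empty scheme. -/
@[reducible] def empty : Scheme α := ⟨Empty, fun _ _ _ => False⟩

instance : IsEmpty (empty : Scheme α).carrier := inferInstanceAs (IsEmpty Empty)

theorem Iso.sum {S S' T T' : Scheme α} : S.Iso S' → T.Iso T' → (S.sum T).Iso (S'.sum T') :=
  fun ⟨e, h⟩ ⟨f, k⟩ => ⟨e.sumCongr f, fun a t => by rintro (x | x); exacts [h a t x, k a t x]⟩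

theorem sum_comm (S T : Scheme α) : (S.sum T).Iso (T.sum S) :=
  ⟨Homeomorph.sumComm _ _, fun a t => by rintro (x | x) <;> exact Iff.rfl⟩

theorem sum_assoc (S T U : Scheme α) : ((S.sum T).sum U).Iso (S.sum (T.sum U)) :=
  ⟨Homeomorph.sumAssoc _ _ _, fun a t => by rintro ((x | x) | x) <;> exact Iff.rfl⟩

theorem sum_empty (S : Scheme α) : (S.sum empty).Iso S :=
  ⟨Homeomorph.sumEmpty _ _, fun a t => by rintro (x | x); exacts [Iff.rfl, x.elim]⟩

theorem sum_left_comm (S T U : Scheme α) : (S.sum (T.sum U)).Iso (T.sum (S.sum U)) :=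
  ((sum_assoc S T U).symm.trans ((sum_comm S T).sum (Iso.refl U))).trans (sum_assoc T S U)

/-- The label `a` does not occur in `S`. -/
def Free (S : Scheme α) (a : α) : Prop := ∀ t x, ¬ S.edge a t x

theorem free_sum {S T : Scheme α} {a : α} (h : S.Free a) (h' : T.Free a) : (S.sum T).Free a := by
  rintro t (x | x); exacts [h t x, h' t x]

theorem free_empty (a : α) : (empty : Scheme α).Free a := fun _ x => x.elim

end Scheme
end Ribbon
end

noncomputable section
namespace Ribbon
open Set Topology
variable {α β : Type}

/-! ### Boundary words and their polygons -/

/-- Boundary words; `some (a, ε)` is an edge labelled `a`, traversed backwards if `ε = false`, and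
`none` is an unlabelled edge. -/
abbrev Word (α : Type) := List (Option (α × Bool))

/-- Boundary words whose edges have prescribed lengths. -/
abbrev WWord (α : Type) := List (Option (α × Bool) × ℝ)

/-- Total length. -/
def len (w : WWord α) : ℝ := (w.map Prod.snd).sum

@[simp] theorem len_nil : len ([] : WWord α) = 0 := rfl
@[simp] theorem len_cons (p : Option (α × Bool) × ℝ) (w : WWord α) : len (p :: w) = p.2 + len w := by
  simp [len]
@[simp] theorem len_append (v w : WWord α) : len (v ++ w) = len v + len w := by simp [len]

/-- The parameter of an edge traversed forwards or backwards. -/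
def dir (ε : Bool) (t : ℝ) : ℝ := if ε then t else 1 - t

theorem dir_mem {ε : Bool} {t : ℝ} (ht : t ∈ Icc (0 : ℝ) 1) : dir ε t ∈ Icc (0 : ℝ) 1 := by
  obtain ⟨h0, h1⟩ := ht
  cases ε <;> simp [dir] <;> grind

/-- `At w a t u`: position `u` along the word `w` is at parameter `t` of an edge labelled `a`. -/
def At : WWord α → α → ℝ → ℝ → Prop
  | [], _, _, _ => False
  | p :: w, a, t, u => (∃ ε, p.1 = some (a, ε) ∧ u = p.2 * dir ε t) ∨ At w a t (u - p.2)

theorem at_append (v w : WWord α) (a : α) (t u : ℝ) :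
    At (v ++ w) a t u ↔ At v a t u ∨ At w a t (u - len v) := by
  induction v generalizing u with
  | nil => simp [At]
  | cons p v ih => simp only [List.cons_append, At, ih, len_cons, or_assoc, sub_sub]

/-- All edges have positive length. -/
def Pos (w : WWord α) : Prop := ∀ p ∈ w, 0 < p.2

theorem pos_cons {p : Option (α × Bool) × ℝ} {w : WWord α} : Pos (p :: w) ↔ 0 < p.2 ∧ Pos w := by
  simp [Pos]

theorem pos_append {v w : WWord α} : Pos (v ++ w) ↔ Pos v ∧ Pos w := by
  simp [Pos, or_imp, forall_and]

theorem len_nonneg {w : WWord α} (h : Pos w) : 0 ≤ len w := by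
  induction w with
  | nil => simp
  | cons p w ih => have := pos_cons.1 h; have := ih this.2; simp; linarith

theorem len_pos {w : WWord α} (h : Pos w) (hw : w ≠ []) : 0 < len w := by
  cases w with
  | nil => exact absurd rfl hw
  | cons p w => have := pos_cons.1 h; have := len_nonneg this.2; simp; linarith

theorem At.mem {w : WWord α} (h : Pos w) {a : α} {t u : ℝ} (ht : t ∈ Icc (0 : ℝ) 1)
    (hu : At w a t u) : u ∈ Icc 0 (len w) := by
  induction w generalizing u with
  | nil => exact hu.elim
  | cons p w ih =>
    obtain ⟨hp, hw⟩ := pos_cons.1 h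
    have hl := len_nonneg hw
    rcases hu with ⟨ε, -, rfl⟩ | hu
    · have := dir_mem (ε := ε) ht
      constructor
      · exact mul_nonneg hp.le this.1
      · have : p.2 * dir ε t ≤ p.2 * 1 := mul_le_mul_of_nonneg_left this.2 hp.le
        simp; linarith
    · have := ih hw hu
      simp at this ⊢
      constructor <;> linarith

theorem At.ne_nil {w : WWord α} {a : α} {t u : ℝ} (hu : At w a t u) : w ≠ [] := by
  rintro rfl; exact hu

/-- The polygon with boundary word `w`. -/
@[reducible] def poly (w : WWord α) : Scheme α :=
  -- Division by the total length turns positions along the word into angles measured in turns.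
  -- Restricting `t` keeps an edge from running on into its neighbours.
  ⟨Disc, fun a t z => t ∈ Icc (0 : ℝ) 1 ∧ ∃ u, At w a t u ∧ z = rim (u / len w)⟩

instance (w : WWord α) : CompactSpace (poly w).carrier := inferInstanceAs (CompactSpace Disc)

/-! ### Reparametrisation -/

/-- Same labels, positive lengths. -/
def Same (w w' : WWord α) : Prop := List.Forall₂ (fun p q => p.1 = q.1 ∧ 0 < p.2 ∧ 0 < q.2) w w'

theorem Same.symm {w w' : WWord α} (h : Same w w') : Same w' w := by
  unfold Same at *
  induction h with
  | nil => exact .nil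
  | cons h _ ih => exact .cons ⟨h.1.symm, h.2.2, h.2.1⟩ ih

theorem Same.pos {w w' : WWord α} (h : Same w w') : Pos w := by
  unfold Same at h
  induction h with
  | nil => simp [Pos]
  | cons h _ ih => exact pos_cons.2 ⟨h.2.1, ih⟩

/-- The piecewise linear map matching the edges of two words. -/
def rp : WWord α → WWord α → ℝ → ℝ
  | p :: w, p' :: w', u => if u ≤ p.2 then u * (p'.2 / p.2) else p'.2 + rp w w' (u - p.2)
  | _, _, u => u

theorem rp_pos {w w' : WWord α} (h : Same w w') : ∀ {u : ℝ}, 0 < u → 0 < rp w w' u := by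
  unfold Same at h
  induction h with
  | nil => intro u hu; exact hu
  | cons h _ ih =>
    intro u hu
    simp only [rp]
    split_ifs with hl
    · exact mul_pos hu (div_pos h.2.2 h.2.1)
    · exact add_pos h.2.2 (ih (sub_pos.2 (not_le.1 hl)))

theorem rp_zero {w w' : WWord α} (h : Same w w') : rp w w' 0 = 0 := by
  unfold Same at h
  cases h with
  | nil => rfl
  | cons h _ => simp [rp, h.2.1.le]

theorem rp_nonneg {w w' : WWord α} (h : Same w w') {u : ℝ} (hu : 0 ≤ u) : 0 ≤ rp w w' u := by
  rcases hu.eq_or_lt with rfl | hu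
  · exact (rp_zero h).ge
  · exact (rp_pos h hu).le

theorem continuous_rp {w w' : WWord α} (h : Same w w') : Continuous (rp w w') := by
  unfold Same at h
  induction h with
  | nil => exact continuous_id
  | cons h hw ih =>
    rename_i p q v v'
    refine Continuous.if_le (by fun_prop) (by fun_prop) continuous_id continuous_const ?_
    rintro u hu
    have hu : u = p.2 := hu
    have := h.2.1.ne'
    rw [hu, sub_self, rp_zero hw]
    field_simp; ring

/-- The identity holds on the whole line, since `rp` keeps the slope of the first edge to the left
of it and has slope one past the last edge. -/
theorem rp_inv {w w' : WWord α} (h : Same w w') : ∀ u, rp w' w (rp w w' u) = u := by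
  unfold Same at h
  induction h with
  | nil => exact fun _ => rfl
  | cons h hw ih =>
    rename_i p q v v'
    intro u
    have h1 := h.2.1; have h2 := h.2.2
    by_cases hl : u ≤ p.2
    · have : u * (q.2 / p.2) ≤ q.2 := by
        calc u * (q.2 / p.2) ≤ p.2 * (q.2 / p.2) := by gcongr
          _ = q.2 := by field_simp
      simp only [rp, if_pos hl, if_pos this]
      field_simp
    · have h3 := rp_pos hw (u := u - p.2) (by linarith)
      have : ¬ (q.2 + rp v v' (u - p.2) ≤ q.2) := by linarith
      simp only [rp, if_neg hl, if_neg this, add_sub_cancel_left, ih]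
      ring

theorem rp_le {w w' : WWord α} (h : Same w w') : ∀ u ≤ len w, rp w w' u ≤ len w' := by
  unfold Same at h
  induction h with
  | nil => exact fun _ h => h
  | cons h hw ih =>
    rename_i p q v v'
    intro u hu
    have h1 := h.2.1; have h2 := h.2.2
    simp only [rp, len_cons] at hu ⊢
    split_ifs with hl
    · have : u * (q.2 / p.2) ≤ q.2 := by
        calc u * (q.2 / p.2) ≤ p.2 * (q.2 / p.2) := by gcongr
          _ = q.2 := by field_simp
      have := len_nonneg (Same.pos (Same.symm hw)); linarith
    · have := ih (u - p.2) (by linarith); linarith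

/-- By continuity and injectivity `rp w w'` is strictly monotone, and it increases because `0` goes
to `0` and `1` to something positive. Applying it to `rp w' w (len w') ≤ len w` gives the inequality
missing from `rp_le`. -/
theorem rp_len {w w' : WWord α} (h : Same w w') : rp w w' (len w) = len w' := by
  refine le_antisymm (rp_le h _ le_rfl) ?_
  by_contra! hlt
  have h1 := rp_le h.symm _ le_rfl
  have h2 := rp_inv h.symm (len w')
  have h0 := rp_nonneg h.symm (len_nonneg h.symm.pos)
  have mono : StrictMono (rp w w') := (continuous_rp h).strictMono_of_inj
      (Function.LeftInverse.injective (rp_inv h)) |>.resolve_right fun hanti => by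
        have := hanti (show (0 : ℝ) < 1 by norm_num)
        rw [rp_zero h] at this
        linarith [rp_pos h (show (0 : ℝ) < 1 by norm_num)]
  have := mono.monotone h1
  linarith

theorem At.rp {w w' : WWord α} (h : Same w w') {a : α} {t : ℝ} (ht : t ∈ Icc (0 : ℝ) 1) :
    ∀ {u : ℝ}, At w a t u → At w' a t (rp w w' u) := by
  unfold Same at h
  induction h with
  | nil => exact fun h => h
  | cons h hw ih =>
    rename_i p q v v'
    have h1 := h.2.1; have h2 := h.2.2
    rintro u (⟨ε, he, rfl⟩ | hu)
    · left
      refine ⟨ε, h.1 ▸ he, ?_⟩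
      have : p.2 * dir ε t ≤ p.2 := by nlinarith [(dir_mem (ε := ε) ht).2]
      simp only [Ribbon.rp, if_pos this]
      field_simp
    · right
      have h0 := (hu.mem (Same.pos hw) ht).1
      have := ih hu
      simp only [Ribbon.rp]
      split_ifs with hl
      -- The junction belongs to both neighbouring edges, and `rp` uses the formula of the first one
      -- there; the two formulas agree.
      · have : u = p.2 := by linarith
        subst this
        rw [sub_self, rp_zero hw] at this
        convert! this using 1
        field_simp; ring
      · simpa using this

/-- Only the sequence of letters matters, not the lengths: the piecewise linear change of parameter
on the boundary circle extends radially over the disc. -/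
theorem Same.iso {w w' : WWord α} (h : Same w w') : (poly w).Iso (poly w') := by
  rcases eq_or_ne w [] with rfl | hw
  · unfold Same at h; rw [List.forall₂_nil_left_iff] at h; subst h; exact Scheme.Iso.refl _
  have hw' : w' ≠ [] := by
    rintro rfl; unfold Same at h; rw [List.forall₂_nil_right_iff] at h; exact hw h
  have L := len_pos h.pos hw
  have L' := len_pos h.symm.pos hw'
  have key (v v' : WWord α) (h : Same v v') (L : 0 < len v) (L' : 0 < len v') :
      ∀ u ∈ Icc (0 : ℝ) 1, rp v v' (u * len v) / len v' ∈ Icc (0 : ℝ) 1 := fun u hu =>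
    ⟨div_nonneg (rp_nonneg h (mul_nonneg hu.1 L.le)) L'.le,
      (div_le_one L').2 (rp_le h _ (by nlinarith [hu.2]))⟩
  obtain ⟨F, hF⟩ := exists_radial_homeomorph (fun u => rp w w' (u * len w) / len w')
    (fun u => rp w' w (u * len w') / len w) (by have := continuous_rp h; fun_prop)
    (by have := continuous_rp h.symm; fun_prop) (by simp [rp_zero h])
    (by simp [rp_len h, L'.ne']) (key w w' h L L') (key w' w h.symm L' L)
    (fun u _ => by simp [L'.ne', L.ne', rp_inv h]) (fun u _ => by simp [L'.ne', L.ne', rp_inv h.symm])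
  refine ⟨F, fun a t x => and_congr_right fun ht => ?_⟩
  have mem {v : WWord α} (hv : Pos v) (L : 0 < len v) {u : ℝ} (hu : At v a t u) :
      u / len v ∈ Icc (0 : ℝ) 1 := by
    have := hu.mem hv ht
    exact ⟨div_nonneg this.1 L.le, (div_le_one L).2 this.2⟩
  constructor
  · rintro ⟨u, hu, rfl⟩
    refine ⟨rp w w' u, hu.rp h ht, ?_⟩
    rw [hF _ (mem h.pos L hu), div_mul_cancel₀ _ L.ne']
  · rintro ⟨u, hu, hx⟩
    refine ⟨rp w' w u, hu.rp h.symm ht, ?_⟩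
    apply F.injective
    rw [hx, hF _ (mem h.pos L (hu.rp h.symm ht)), div_mul_cancel₀ _ L.ne', rp_inv h.symm]

/-! ### Rotation and reflection -/

/-- Rotation of the disc. -/
def rot (v : ℝ) : Disc ≃ₜ Disc where
  toFun z := ⟨z * circ v, by simpa [norm_circ] using z.norm_le⟩
  invFun z := ⟨z * circ (-v), by simpa [norm_circ] using z.norm_le⟩
  left_inv z := Subtype.ext (by simp [mul_assoc, ← circ_add]; simp [circ])
  right_inv z := Subtype.ext (by simp [mul_assoc, ← circ_add]; simp [circ])
  continuous_toFun := by fun_prop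
  continuous_invFun := by fun_prop

theorem rot_rim (u v : ℝ) : rot v (rim u) = rim (u + v) := Subtype.ext (circ_add u v).symm

/-- The disc is turned by the fraction of the circle occupied by `A`. Positions in `A` come out a
full turn apart, which accounts for the integer `-1`. -/
theorem poly_rotate (A B : WWord α) (hA : Pos A) (hB : Pos B) :
    (poly (A ++ B)).Iso (poly (B ++ A)) := by
  have key (A B : WWord α) (hA : Pos A) (hB : Pos B) (a t x) (h : (poly (A ++ B)).edge a t x) :
      (poly (B ++ A)).edge a t (rot (-(len A / len (A ++ B))) x) := by
    obtain ⟨ht, u, hu, rfl⟩ := h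
    have hL := len_pos (pos_append.2 ⟨hA, hB⟩) hu.ne_nil
    refine ⟨ht, ?_⟩
    rw [len_append] at hL
    have hL' := hL.ne'
    have hL'' : len B + len A ≠ 0 := by linarith
    rcases (at_append _ _ _ _ _).1 hu with hu | hu
    · refine ⟨u + len B, (at_append _ _ _ _ _).2 (Or.inr (by simpa using hu)), ?_⟩
      rw [rot_rim, rim_eq_iff, len_append, len_append]
      exact ⟨-1, by rw [add_comm (len B)]; push_cast; field_simp; ring⟩
    · refine ⟨u - len A, (at_append _ _ _ _ _).2 (Or.inl hu), ?_⟩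
      rw [rot_rim, rim_eq_iff, len_append, len_append]
      exact ⟨0, by rw [add_comm (len B)]; push_cast; field_simp; ring⟩
  refine ⟨rot (-(len A / len (A ++ B))), fun a t x => ⟨key A B hA hB a t x, fun h => ?_⟩⟩
  rcases eq_or_ne (len (A ++ B)) 0 with h0 | h0
  · obtain ⟨-, u, hu, -⟩ := h
    have := len_pos (pos_append.2 ⟨hB, hA⟩) hu.ne_nil
    simp at h0 this; linarith
  have := key B A hB hA a t _ h
  have e : x = rot (-(len B / len (B ++ A))) (rot (-(len A / len (A ++ B))) x) := ?_
  · rw [e]; exact this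
  apply Subtype.ext
  change (x : ℂ) = x * circ _ * circ _
  rw [mul_assoc, ← circ_add]
  have : circ (-(len A / len (A ++ B)) + -(len B / len (B ++ A))) = circ 0 := by
    rw [circ_eq_iff]
    refine ⟨-1, ?_⟩
    simp only [len_append] at h0 ⊢
    rw [add_comm (len B) (len A)]; push_cast; field_simp; ring
  rw [this]; simp [circ]

/-- The inverse of a letter. -/
def flip (x : Option (α × Bool)) : Option (α × Bool) := x.map fun p => (p.1, !p.2)

@[simp] theorem flip_flip (x : Option (α × Bool)) : flip (flip x) = x := by
  rcases x with - | ⟨a, ε⟩ <;> simp [flip]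

@[simp] theorem flip_none : flip (none : Option (α × Bool)) = none := rfl
@[simp] theorem flip_some (a : α) (ε : Bool) : flip (some (a, ε)) = some (a, !ε) := rfl

/-- The reversed weighted word. -/
def wrev (w : WWord α) : WWord α := (w.map fun p => (flip p.1, p.2)).reverse

theorem len_wrev (w : WWord α) : len (wrev w) = len w := by
  induction w with
  | nil => rfl
  | cons p w ih => simp only [wrev, List.map_cons, List.reverse_cons, len_append, len_cons,
      len_nil] at ih ⊢; rw [ih]; ring

theorem at_wrev (w : WWord α) (a : α) (t u : ℝ) : At w a t u → At (wrev w) a t (len w - u) := by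
  induction w generalizing u with
  | nil => exact id
  | cons p w ih =>
    have e : wrev (p :: w) = wrev w ++ [(flip p.1, p.2)] := by simp [wrev]
    rw [e, at_append, len_wrev]
    rintro (⟨ε, h, rfl⟩ | h)
    · right; left
      refine ⟨!ε, by simp [h], ?_⟩
      cases ε <;> simp [dir] <;> ring
    · left
      convert! ih _ h using 1
      simp; ring

theorem wrev_wrev (w : WWord α) : wrev (wrev w) = w := by
  simp [wrev, Function.comp_def]

/-- Reflection of the disc. -/
def refl : Disc ≃ₜ Disc where
  toFun z := ⟨(starRingEnd ℂ) z, by simpa using z.norm_le⟩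
  invFun z := ⟨(starRingEnd ℂ) z, by simpa using z.norm_le⟩
  left_inv z := Subtype.ext (by simp)
  right_inv z := Subtype.ext (by simp)
  continuous_toFun := by fun_prop
  continuous_invFun := by fun_prop

theorem refl_rim (u : ℝ) : refl (rim u) = rim (-u) := by
  apply Subtype.ext
  change (starRingEnd ℂ) (circ u) = circ (-u)
  rw [circ, circ, ← Complex.exp_conj]
  simp [show (starRingEnd ℂ) 2 = 2 from Complex.conj_ofReal 2]

/-- Complex conjugation runs through the boundary backwards, so the letters appear in reverse order
and with the opposite direction. -/
theorem poly_reverse (w : WWord α) (hw : Pos w) : (poly w).Iso (poly (wrev w)) := by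
  have key (w : WWord α) (hw : Pos w) (a t x) (h : (poly w).edge a t x) :
      (poly (wrev w)).edge a t (refl x) := by
    obtain ⟨ht, u, hu, rfl⟩ := h
    have := len_pos hw hu.ne_nil
    refine ⟨ht, _, at_wrev _ _ _ _ hu, ?_⟩
    rw [refl_rim, rim_eq_iff, len_wrev]
    exact ⟨-1, by push_cast; field_simp; ring⟩
  have hw' : Pos (wrev w) := by
    intro p hp
    simp only [wrev, List.mem_reverse, List.mem_map] at hp
    obtain ⟨q, hq, rfl⟩ := hp
    exact hw q hq
  refine ⟨refl, fun a t x => ⟨key w hw a t x, fun h => ?_⟩⟩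
  have := key _ hw' a t _ h
  rw [wrev_wrev] at this
  exact (refl.symm_apply_apply x) ▸ this

end Ribbon
end

noncomputable section
namespace Ribbon
open Set Topology
variable {α β : Type}

/-! ### Merging two polygons along an edge -/

/-- Height of the disc above a point. -/
def hgt (z : Disc) : ℝ := Real.sqrt (1 - (z : ℂ).re ^ 2)

theorem Disc.sq_le (z : Disc) : (z : ℂ).re ^ 2 + (z : ℂ).im ^ 2 ≤ 1 := by
  have h := z.norm_le
  have := Complex.sq_norm (z : ℂ)
  rw [Complex.normSq_apply] at this
  nlinarith [norm_nonneg (z : ℂ)]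

theorem Disc.abs_im_le (z : Disc) : |(z : ℂ).im| ≤ hgt z :=
  Real.abs_le_sqrt (by linarith [z.sq_le])

theorem continuous_hgt : Continuous hgt := by unfold hgt; fun_prop

/-- Fibrewise change of the height. -/
def vmap (k : ℝ → ℝ → ℝ) (hk : ∀ y s, |y| ≤ s → |k y s| ≤ s) (z : Disc) : Disc :=
  ⟨⟨(z : ℂ).re, k (z : ℂ).im (hgt z)⟩, by
    have h1 := hk _ _ z.abs_im_le
    have h2 : hgt z ^ 2 = 1 - (z : ℂ).re ^ 2 := Real.sq_sqrt (by nlinarith [z.sq_le])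
    rw [mem_closedBall_zero_iff, ← sq_le_one_iff₀ (norm_nonneg _), Complex.sq_norm,
      Complex.normSq_apply]
    have := sq_le_sq' (abs_le.1 h1).1 (abs_le.1 h1).2
    nlinarith⟩

theorem continuous_vmap {k : ℝ → ℝ → ℝ} {hk} (h : Continuous fun p : ℝ × ℝ => k p.1 p.2) :
    Continuous (vmap k hk) := by
  refine Continuous.subtype_mk ?_ _
  have h1 : Continuous fun z : Disc => k (z : ℂ).im (hgt z) :=
    h.comp ((Complex.continuous_im.comp continuous_subtype_val).prodMk continuous_hgt)
  have h2 : Continuous fun z : Disc => (z : ℂ).re := by fun_prop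
  have h3 : (fun z : Disc => (⟨(z : ℂ).re, k (z : ℂ).im (hgt z)⟩ : ℂ)) =
      fun z : Disc => (((z : ℂ).re : ℂ) + (k (z : ℂ).im (hgt z) : ℂ) * Complex.I) := by
    funext z; apply Complex.ext <;> simp
  rw [h3]
  exact (Complex.continuous_ofReal.comp h2).add
    ((Complex.continuous_ofReal.comp h1).mul continuous_const)

theorem Disc.ext' {z w : Disc} (h : (z : ℂ).re = (w : ℂ).re) (h' : (z : ℂ).im = (w : ℂ).im) : z = w :=
  Subtype.ext (Complex.ext h h')

theorem hgt_vmap (k hk) (z : Disc) : hgt (vmap k hk z) = hgt z := rfl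
theorem vmap_im (k hk) (z : Disc) : (vmap k hk z : ℂ).im = k (z : ℂ).im (hgt z) := rfl

/-- Squeeze the disc to its upper half. -/
def squeezeUp : Disc → Disc := vmap (fun y s => (y + s) / 2) fun y s h => by
  obtain ⟨h1, h2⟩ := abs_le.1 h; exact abs_le.2 ⟨by linarith, by linarith⟩
/-- Squeeze the disc to its lower half. -/
def squeezeDown : Disc → Disc := vmap (fun y s => (y - s) / 2) fun y s h => by
  obtain ⟨h1, h2⟩ := abs_le.1 h; exact abs_le.2 ⟨by linarith, by linarith⟩
/-- Stretch the upper half to the disc. -/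
def stretchUp : Disc → Disc := vmap (fun y s => 2 * max y 0 - s) fun y s h => by
  obtain ⟨h1, h2⟩ := abs_le.1 h
  have : max y 0 ≤ s := max_le h2 (by linarith)
  have := le_max_right y 0
  exact abs_le.2 ⟨by linarith, by linarith⟩
/-- Stretch the lower half to the disc. -/
def stretchDown : Disc → Disc := vmap (fun y s => 2 * min y 0 + s) fun y s h => by
  obtain ⟨h1, h2⟩ := abs_le.1 h
  have : -s ≤ min y 0 := le_min h1 (by linarith)
  have := min_le_right y 0
  exact abs_le.2 ⟨by linarith, by linarith⟩

theorem hgt_rim (u : ℝ) : hgt (rim u) = |(rim u : ℂ).im| := by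
  have h1 := Complex.sq_norm (rim u : ℂ)
  have h2 : ‖(rim u : ℂ)‖ = 1 := norm_circ u
  rw [h2, Complex.normSq_apply] at h1
  rw [hgt, ← Real.sqrt_sq_eq_abs]
  congr 1; linarith

theorem rim_im_nonneg {u : ℝ} (h0 : 0 ≤ u) (h1 : u ≤ 1) : 0 ≤ (rim (u / 2) : ℂ).im := by
  change 0 ≤ (circ (u / 2)).im
  rw [circ_im]
  have hpi := Real.pi_pos
  exact Real.sin_nonneg_of_nonneg_of_le_pi (by positivity) (by nlinarith)

theorem rim_im_nonpos {u : ℝ} (h0 : 1 ≤ u) (h1 : u ≤ 2) : (rim (u / 2) : ℂ).im ≤ 0 := by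
  change (circ (u / 2)).im ≤ 0
  rw [circ_im, ← neg_nonneg, ← Real.sin_sub_pi]
  have hpi := Real.pi_pos
  exact Real.sin_nonneg_of_nonneg_of_le_pi (by nlinarith) (by nlinarith)

theorem stretchUp_squeezeUp (z : Disc) : stretchUp (squeezeUp z) = z := by
  refine Disc.ext' rfl ?_
  simp only [stretchUp, squeezeUp, vmap_im, hgt_vmap]
  have := abs_le.1 z.abs_im_le
  rw [max_eq_left (by linarith)]; ring

theorem stretchDown_squeezeDown (z : Disc) : stretchDown (squeezeDown z) = z := by
  refine Disc.ext' rfl ?_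
  simp only [stretchDown, squeezeDown, vmap_im, hgt_vmap]
  have := abs_le.1 z.abs_im_le
  rw [min_eq_left (by linarith)]; ring

theorem squeezeUp_im (z : Disc) : 0 ≤ (squeezeUp z : ℂ).im := by
  simp only [squeezeUp, vmap_im]; linarith [(abs_le.1 z.abs_im_le).1]

theorem squeezeDown_im (z : Disc) : (squeezeDown z : ℂ).im ≤ 0 := by
  simp only [squeezeDown, vmap_im]; linarith [(abs_le.1 z.abs_im_le).2]

theorem squeezeUp_stretchUp {z : Disc} (h : 0 ≤ (z : ℂ).im) : squeezeUp (stretchUp z) = z := by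
  refine Disc.ext' rfl ?_
  simp only [stretchUp, squeezeUp, vmap_im, hgt_vmap, max_eq_left h]; ring

theorem squeezeDown_stretchDown {z : Disc} (h : (z : ℂ).im ≤ 0) :
    squeezeDown (stretchDown z) = z := by
  refine Disc.ext' rfl ?_
  simp only [stretchDown, squeezeDown, vmap_im, hgt_vmap, min_eq_left h]; ring

theorem stretchUp_rim {u : ℝ} (h : 0 ≤ (rim u : ℂ).im) : stretchUp (rim u) = rim u := by
  refine Disc.ext' rfl ?_
  simp only [stretchUp, vmap_im, hgt_rim, max_eq_left h, abs_of_nonneg h]; ring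

theorem stretchDown_rim {u : ℝ} (h : (rim u : ℂ).im ≤ 0) : stretchDown (rim u) = rim u := by
  refine Disc.ext' rfl ?_
  simp only [stretchDown, vmap_im, hgt_rim, min_eq_left h, abs_of_nonpos h]; ring

theorem rim_reflect (t : ℝ) : (rim ((1 + t) / 2) : ℂ).re = (rim ((1 - t) / 2) : ℂ).re ∧
    (rim ((1 + t) / 2) : ℂ).im = -(rim ((1 - t) / 2) : ℂ).im := by
  change (circ _).re = (circ _).re ∧ (circ _).im = -(circ _).im
  simp only [circ_re, circ_im]
  rw [show 2 * Real.pi * ((1 + t) / 2) = 2 * Real.pi - 2 * Real.pi * ((1 - t) / 2) by ring,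
    Real.cos_two_pi_sub, Real.sin_two_pi_sub]
  exact ⟨rfl, rfl⟩

/-- The lower half circle of the upper disc and the upper half circle of the lower disc are both
flattened onto the diameter, in opposite directions. This is how a letter meets its inverse. -/
theorem squeeze_rim (t : ℝ) (ht : t ∈ Icc (0 : ℝ) 1) :
    squeezeUp (rim ((1 + t) / 2)) = squeezeDown (rim ((1 - t) / 2)) := by
  obtain ⟨h1, h2⟩ := rim_reflect t
  refine Disc.ext' (by exact h1) ?_
  have h3 := rim_im_nonneg (u := 1 - t) (by linarith [ht.2]) (by linarith [ht.1])
  simp only [squeezeUp, squeezeDown, vmap_im, hgt_rim, h2, abs_neg, abs_of_nonneg h3]; ring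

/-- Points of the diameter are stretched to points of the circle. -/
theorem exists_stretch {z : Disc} (hz : (z : ℂ).im = 0) : ∃ t ∈ Icc (0 : ℝ) 1,
    stretchUp z = rim ((1 + t) / 2) ∧ stretchDown z = rim ((1 - t) / 2) := by
  have hpi := Real.pi_pos
  have hre := abs_le.1 (sq_le_one_iff_abs_le_one _ |>.1
    (by nlinarith [z.sq_le] : (z : ℂ).re ^ 2 ≤ 1))
  have h0 := Real.arccos_nonneg (z : ℂ).re
  have h1 := Real.arccos_le_pi (z : ℂ).re
  set t := 1 - Real.arccos (z : ℂ).re / Real.pi with ht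
  have e : 2 * Real.pi * ((1 - t) / 2) = Real.arccos (z : ℂ).re := by
    rw [ht]; field_simp; ring
  have hd : stretchDown z = rim ((1 - t) / 2) := by
    refine Disc.ext' ?_ ?_
    · change _ = (circ _).re
      rw [circ_re, e, Real.cos_arccos hre.1 hre.2]; rfl
    · change _ = (circ _).im
      rw [circ_im, e, Real.sin_arccos]
      simp [stretchDown, vmap_im, hz, hgt]
  refine ⟨t, ⟨?_, ?_⟩, ?_, hd⟩
  · rw [ht, sub_nonneg, div_le_one hpi]; exact h1
  · rw [ht, sub_le_self_iff]; positivity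
  · obtain ⟨h2, h3⟩ := rim_reflect t
    refine Disc.ext' (h2 ▸ hd ▸ rfl) ?_
    rw [h3, ← hd]
    simp [stretchUp, stretchDown, vmap_im, hz]

theorem continuous_squeezeUp : Continuous squeezeUp := continuous_vmap (by fun_prop)
theorem continuous_squeezeDown : Continuous squeezeDown := continuous_vmap (by fun_prop)
theorem continuous_stretchUp : Continuous stretchUp := continuous_vmap (by fun_prop)
theorem continuous_stretchDown : Continuous stretchDown := continuous_vmap (by fun_prop)

/-- Two polygons with a common edge, which occurs nowhere else, can be merged. -/
theorem poly_merge_of_len (A B : WWord α) (a : α) (S : Scheme α) (hA : Pos A) (hB : Pos B)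
    (hlA : len A = 1) (hlB : len B = 1) (hAa : ∀ t u, ¬ At A a t u) (hBa : ∀ t u, ¬ At B a t u)
    (hS : S.Free a) :
    ((poly (A ++ [(some (a, true), 1)])).sum ((poly ((some (a, false), 1) :: B)).sum S)).Equiv
      ((poly (A ++ B)).sum S) := by
  classical
  set T1 := (poly (A ++ [(some (a, true), 1)])).sum ((poly ((some (a, false), 1) :: B)).sum S) with hT1
  set T2 := (poly (A ++ B)).sum S with hT2
  -- With all three lengths equal to two, `A` fills the upper half circle and `B` the lower one,
  -- before and after the merging; the common edge fills the other half of each of the two discs.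
  have l1 : len (A ++ [(some (a, true), 1)]) = 2 := by simp [hlA]; norm_num
  have l2 : len ((some (a, false), 1) :: B) = 2 := by simp [hlB]; norm_num
  have l3 : len (A ++ B) = 2 := by simp [hlA, hlB]; norm_num
  let i1 : Disc → T1.carrier := Sum.inl
  let i2 : Disc → T1.carrier := fun z => Sum.inr (Sum.inl z)
  let i3 : S.carrier → T1.carrier := fun z => Sum.inr (Sum.inr z)
  let j1 : Disc → T2.carrier := Sum.inl
  let j2 : S.carrier → T2.carrier := Sum.inr
  have ci1 : Continuous i1 := continuous_inl
  have ci2 : Continuous i2 := continuous_inr.comp continuous_inl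
  have ci3 : Continuous i3 := continuous_inr.comp continuous_inr
  -- The first disc becomes the upper half and the second the lower half of the merged disc. The
  -- inverse `gD` stretches the halves back.
  let f : T1.carrier → T2.carrier := Sum.elim (j1 ∘ squeezeUp) (Sum.elim (j1 ∘ squeezeDown) j2)
  have cf : Continuous f := (continuous_inl.comp continuous_squeezeUp).sumElim
    ((continuous_inl.comp continuous_squeezeDown).sumElim continuous_inr)
  have fa (t x) (h : T1.edge a t x) : f x = j1 (squeezeUp (rim ((1 + t) / 2))) := by
    rcases x with x | x | x
    · obtain ⟨ht, u, hu, rfl⟩ := h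
      rw [at_append] at hu
      rcases hu with hu | ⟨ε, he, hu⟩ | hu
      · exact (hAa _ _ hu).elim
      · have : ε = true := by simpa using he.symm
        subst this
        simp only [dir, if_true, hlA] at hu
        rw [l1, show u = 1 + t by linarith]; rfl
      · exact hu.elim
    · obtain ⟨ht, u, hu, rfl⟩ := h
      rcases hu with ⟨ε, he, hu⟩ | hu
      · have : ε = false := by simpa using he.symm
        subst this
        simp only [dir] at hu
        rw [l2, show u = 1 - t by simpa using hu, squeeze_rim t ht]; rfl
      · exact (hBa _ _ hu).elim
    · exact (hS _ _ h).elim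
  have fb (b t x) (hb : b ≠ a) (h : T1.edge b t x) : T2.edge b t (f x) := by
    rcases x with x | x | x
    · obtain ⟨ht, u, hu, rfl⟩ := h
      rw [at_append] at hu
      rcases hu with hu | ⟨ε, he, hu⟩ | hu
      · have hm := hu.mem hA ht
        rw [hlA] at hm
        refine ⟨ht, u, (at_append _ _ _ _ _).2 (Or.inl hu), ?_⟩
        rw [l1, l3]
        have := rim_im_nonneg hm.1 hm.2
        conv_lhs => rw [← stretchUp_rim this, squeezeUp_stretchUp this]
      · simp at he; exact absurd he.1.symm hb
      · exact hu.elim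
    · obtain ⟨ht, u, hu, rfl⟩ := h
      rcases hu with ⟨ε, he, hu⟩ | hu
      · simp at he; exact absurd he.1.symm hb
      · have hm := hu.mem hB ht
        rw [hlB] at hm
        refine ⟨ht, u, (at_append _ _ _ _ _).2 (Or.inr (by rw [hlA]; exact hu)), ?_⟩
        rw [l2, l3]
        have := rim_im_nonpos (u := u) (by linarith [hm.1]) (by linarith [hm.2])
        conv_lhs => rw [← stretchDown_rim this, squeezeDown_stretchDown this]
    · exact h
  have hf (b t x y) (hx : T1.edge b t x) (hy : T1.edge b t y) : T2.mk' (f x) = T2.mk' (f y) := by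
    by_cases hb : b = a
    · subst hb; rw [fa _ _ hx, fa _ _ hy]
    · exact Scheme.glue (fb _ _ _ hb hx) (fb _ _ _ hb hy)
  let gD : Disc → T1.space := fun z =>
    if 0 ≤ (z : ℂ).im then T1.mk' (i1 (stretchUp z)) else T1.mk' (i2 (stretchDown z))
  -- On the diameter the two stretched points lie on the two copies of the edge `a` at the same
  -- parameter, so they are glued and `gD` is continuous.
  have agree (z : Disc) (hz : (z : ℂ).im = 0) :
      T1.mk' (i1 (stretchUp z)) = T1.mk' (i2 (stretchDown z)) := by
    obtain ⟨t, ht, h1, h2⟩ := exists_stretch hz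
    rw [h1, h2]
    refine Scheme.glue (a := a) (t := t) ⟨ht, 1 + t, ?_, by rw [l1]⟩ ⟨ht, 1 - t, ?_, by rw [l2]⟩
    · exact (at_append _ _ _ _ _).2 (Or.inr (Or.inl ⟨true, rfl, by simp [hlA, dir]⟩))
    · exact Or.inl ⟨false, rfl, by simp [dir]⟩
  have cgD : Continuous gD := by
    refine Continuous.if_le (T1.continuous_mk'.comp (ci1.comp continuous_stretchUp))
      (T1.continuous_mk'.comp (ci2.comp continuous_stretchDown)) continuous_const
      (Complex.continuous_im.comp continuous_subtype_val) fun z hz => agree z hz.symm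
  have gup (z : Disc) (hz : 0 ≤ (z : ℂ).im) : gD z = T1.mk' (i1 (stretchUp z)) := if_pos hz
  have gdown (z : Disc) (hz : (z : ℂ).im ≤ 0) : gD z = T1.mk' (i2 (stretchDown z)) := by
    rcases hz.eq_or_lt with h | h
    · rw [gup z h.ge, agree z h]
    · exact if_neg (not_le.2 h)
  let g : T2.carrier → T1.space := Sum.elim gD (fun x => T1.mk' (i3 x))
  have cg : Continuous g := cgD.sumElim (T1.continuous_mk'.comp ci3)
  have gb (b t x) (h : T2.edge b t x) : ∃ x', T1.edge b t x' ∧ g x = T1.mk' x' := by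
    rcases x with x | x
    · obtain ⟨ht, u, hu, rfl⟩ := h
      rcases (at_append _ _ _ _ _).1 hu with hu | hu
      · have hm := hu.mem hA ht
        rw [hlA] at hm
        have := rim_im_nonneg hm.1 hm.2
        refine ⟨i1 (rim (u / 2)), ⟨ht, u, (at_append _ _ _ _ _).2 (Or.inl hu), by rw [l1]⟩, ?_⟩
        change gD _ = _
        rw [l3, gup _ this, stretchUp_rim this]
      · have hm := hu.mem hB ht
        rw [hlA, hlB] at hm
        have := rim_im_nonpos (u := u) (by linarith [hm.1]) (by linarith [hm.2])
        refine ⟨i2 (rim (u / 2)), ⟨ht, u, Or.inr (by rw [hlA] at hu; exact hu), by rw [l2]⟩, ?_⟩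
        change gD _ = _
        rw [l3, gdown _ this, stretchDown_rim this]
    · exact ⟨i3 x, h, rfl⟩
  have hg (b t x y) (hx : T2.edge b t x) (hy : T2.edge b t y) : g x = g y := by
    obtain ⟨x', hx', ex⟩ := gb _ _ _ hx
    obtain ⟨y', hy', ey⟩ := gb _ _ _ hy
    rw [ex, ey]; exact Scheme.glue hx' hy'
  have left : Function.LeftInverse (T2.desc g hg) (T1.desc (fun x => T2.mk' (f x)) hf) := by
    rintro ⟨x⟩
    change g (f x) = T1.mk' x
    rcases x with x | x | x
    · change gD (squeezeUp x) = _
      rw [gup _ (squeezeUp_im x), stretchUp_squeezeUp]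
    · change gD (squeezeDown x) = _
      rw [gdown _ (squeezeDown_im x), stretchDown_squeezeDown]
    · rfl
  have right : Function.RightInverse (T2.desc g hg) (T1.desc (fun x => T2.mk' (f x)) hf) := by
    rintro ⟨x⟩
    rcases x with x | x
    · change T1.desc _ hf (gD x) = T2.mk' (j1 x)
      rcases le_total 0 (x : ℂ).im with h | h
      · rw [gup _ h]
        change T2.mk' (j1 (squeezeUp (stretchUp x))) = _
        rw [squeezeUp_stretchUp h]
      · rw [gdown _ h]
        change T2.mk' (j1 (squeezeDown (stretchDown x))) = _
        rw [squeezeDown_stretchDown h]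
    · rfl
  exact ⟨⟨⟨_, _, left, right⟩, T1.continuous_desc (T2.continuous_mk'.comp cf) hf,
    T2.continuous_desc cg hg⟩⟩

/-! ### Words without lengths -/

/-- All edges of length `l`. -/
def wt (l : ℝ) (w : Word α) : WWord α := w.map fun x => (x, l)

theorem pos_wt {l : ℝ} (hl : 0 < l) (w : Word α) : Pos (wt l w) := by
  intro p hp; simp only [wt, List.mem_map] at hp; obtain ⟨x, -, rfl⟩ := hp; exact hl

theorem len_wt (l : ℝ) (w : Word α) : len (wt l w) = w.length * l := by
  simp [wt, len, Function.comp_def]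

theorem wt_append (l : ℝ) (v w : Word α) : wt l (v ++ w) = wt l v ++ wt l w := by simp [wt]

/-- The polygon with edges of equal lengths. -/
@[reducible] def pol (w : Word α) : Scheme α := poly (wt 1 w)

theorem same_of_map_fst {v w : WWord α} (hv : Pos v) (hw : Pos w)
    (h : v.map Prod.fst = w.map Prod.fst) : Same v w := by
  induction v generalizing w with
  | nil => simp at h; subst h; exact List.Forall₂.nil
  | cons p v ih =>
    cases w with
    | nil => simp at h
    | cons q w =>
      simp only [List.map_cons, List.cons.injEq] at h
      exact List.Forall₂.cons ⟨h.1, (pos_cons.1 hv).1, (pos_cons.1 hw).1⟩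
        (ih (pos_cons.1 hv).2 (pos_cons.1 hw).2 h.2)

theorem poly_iso_pol {v : WWord α} (hv : Pos v) {w : Word α} (h : v.map Prod.fst = w) :
    (poly v).Iso (pol w) :=
  (same_of_map_fst hv (pos_wt one_pos w) (by simp [wt, h, Function.comp_def])).iso

/-- The label `a` does not occur in `w`. -/
def NotIn (a : α) (w : Word α) : Prop := ∀ ε, some (a, ε) ∉ w

@[simp] theorem notIn_nil (a : α) : NotIn a [] := by simp [NotIn]
@[simp] theorem notIn_append (a : α) (v w : Word α) : NotIn a (v ++ w) ↔ NotIn a v ∧ NotIn a w := by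
  simp only [NotIn, List.mem_append, not_or, forall_and]
@[simp] theorem notIn_cons_none (a : α) (w : Word α) : NotIn a (none :: w) ↔ NotIn a w := by
  simp [NotIn]
@[simp] theorem notIn_cons_some (a b : α) (ε : Bool) (w : Word α) :
    NotIn a (some (b, ε) :: w) ↔ a ≠ b ∧ NotIn a w := by
  simp only [NotIn, List.mem_cons, Option.some.injEq, Prod.mk.injEq, not_or]
  grind

theorem NotIn.not_at {a : α} {w : Word α} (h : NotIn a w) (l t u : ℝ) : ¬ At (wt l w) a t u := by
  induction w generalizing u with
  | nil => exact id
  | cons x w ih =>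
    rintro (⟨ε, he, -⟩ | hu)
    · exact h ε (by simp at he; simp [he])
    · exact ih (fun ε hε => h ε (List.mem_cons_of_mem _ hε)) _ hu

theorem free_pol {a : α} {w : Word α} (h : NotIn a w) : (pol w).Free a :=
  fun _ _ ⟨_, _, hu, _⟩ => h.not_at _ _ _ hu

/-- Edge lengths can be chosen freely, so `A` and `B` are given total length one, as
`poly_merge_of_len` requires. Both must be nonempty for this. -/
theorem merge (A B : Word α) (a : α) (S : Scheme α) (hA : A ≠ []) (hB : B ≠ []) (hAa : NotIn a A)
    (hBa : NotIn a B) (hS : S.Free a) :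
    ((pol (A ++ [some (a, true)])).sum ((pol (some (a, false) :: B)).sum S)).Equiv
      ((pol (A ++ B)).sum S) := by
  have la : 0 < (A.length : ℝ) := by exact_mod_cast List.length_pos_iff.2 hA
  have lb : 0 < (B.length : ℝ) := by exact_mod_cast List.length_pos_iff.2 hB
  have pa := pos_wt (inv_pos.2 la) A
  have pb := pos_wt (inv_pos.2 lb) B
  have key := poly_merge_of_len (wt (A.length : ℝ)⁻¹ A) (wt (B.length : ℝ)⁻¹ B) a S pa pb
    (by rw [len_wt, mul_inv_cancel₀ la.ne']) (by rw [len_wt, mul_inv_cancel₀ lb.ne'])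
    (hAa.not_at _) (hBa.not_at _) hS
  have one : Pos [((some (a, true) : Option (α × Bool)), (1 : ℝ))] := by simp [Pos]
  refine ((Scheme.Iso.sum ?_ (Scheme.Iso.sum ?_ (.refl S))).equiv.symm.trans key).trans
    (Scheme.Iso.sum ?_ (.refl S)).equiv
  · exact poly_iso_pol (pos_append.2 ⟨pa, one⟩) (by simp [wt, Function.comp_def])
  · exact poly_iso_pol (pos_cons.2 ⟨one_pos, pb⟩) (by simp [wt, Function.comp_def])
  · exact poly_iso_pol (pos_append.2 ⟨pa, pb⟩) (by simp [wt, Function.comp_def])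

theorem rotate (A B : Word α) : (pol (A ++ B)).Iso (pol (B ++ A)) := by
  simp only [pol, wt_append]
  exact poly_rotate _ _ (pos_wt one_pos _) (pos_wt one_pos _)

/-- The inverse word. -/
def rev (w : Word α) : Word α := (w.map flip).reverse

@[simp] theorem rev_nil : rev ([] : Word α) = [] := rfl
@[simp] theorem rev_append (v w : Word α) : rev (v ++ w) = rev w ++ rev v := by simp [rev]
@[simp] theorem rev_cons (x : Option (α × Bool)) (w : Word α) : rev (x :: w) = rev w ++ [flip x] := by
  simp [rev]
@[simp] theorem notIn_rev (a : α) (w : Word α) : NotIn a (rev w) ↔ NotIn a w := by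
  induction w with
  | nil => simp
  | cons x w ih => rcases x with - | ⟨b, ε⟩ <;> simp [ih, and_comm]

theorem reverse (w : Word α) : (pol w).Iso (pol (rev w)) := by
  have := poly_reverse (wt 1 w) (pos_wt one_pos w)
  rwa [show wrev (wt 1 w) = wt 1 (rev w) by simp [wrev, wt, rev, Function.comp_def]] at this

/-- Consecutive unlabelled edges can be joined. -/
theorem join_none (A B : Word α) : (pol (A ++ none :: none :: B)).Iso (pol (A ++ none :: B)) := by
  have pA := pos_wt one_pos A
  have pB := pos_wt one_pos B
  have h : poly (wt 1 A ++ (none, 1) :: (none, 1) :: wt 1 B) =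
      poly (wt 1 A ++ (none, 2) :: wt 1 B) := by
    have hl : len (wt 1 A ++ (none, 1) :: (none, 1) :: wt 1 B) =
        len (wt 1 A ++ (none, 2) :: wt 1 B) := by simp; ring
    have ha (a t u) : At (wt 1 A ++ (none, 1) :: (none, 1) :: wt 1 B) a t u ↔
        At (wt 1 A ++ (none, 2) :: wt 1 B) a t u := by
      simp only [at_append, At, sub_sub, reduceCtorEq, false_and, exists_false, false_or,
        add_assoc, one_add_one_eq_two]
    simp only [poly, hl, ha]
  have h2 : (poly (wt 1 A ++ (none, 2) :: wt 1 B)).Iso (pol (A ++ none :: B)) := by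
    refine poly_iso_pol (pos_append.2 ⟨pA, pos_cons.2 ⟨by norm_num, pB⟩⟩) ?_
    simp [wt, Function.comp_def]
  rw [← h] at h2
  convert! h2 using 2
  simp [wt]

end Ribbon
end

noncomputable section
namespace Ribbon
open Set Topology
variable {α β : Type}

theorem dir_dir (σ ε : Bool) (t : ℝ) : dir (σ == ε) t = dir ε (dir σ t) := by
  cases σ <;> cases ε <;> simp [dir]

theorem dir_invol (σ : Bool) (t : ℝ) : dir σ (dir σ t) = t := by
  cases σ <;> simp [dir]

/-! ### Relabelling -/

/-- Relabelling of a letter, possibly reversing the edge. -/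
def recode (f : α → β × Bool) (x : Option (α × Bool)) : Option (β × Bool) :=
  x.map fun p => ((f p.1).1, (f p.1).2 == p.2)

theorem at_recode (f : α → β × Bool) (l : ℝ) (w : Word α) (b : β) (t u : ℝ) :
    At (wt l (w.map (recode f))) b t u ↔ ∃ a, (f a).1 = b ∧ At (wt l w) a (dir (f a).2 t) u := by
  induction w generalizing u with
  | nil => simp [wt, At]
  | cons x w ih =>
    change ((∃ ε, recode f x = some (b, ε) ∧ u = l * dir ε t) ∨
      At (wt l (w.map (recode f))) b t (u - l)) ↔ ∃ a, (f a).1 = b ∧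
        ((∃ ε, x = some (a, ε) ∧ u = l * dir ε (dir (f a).2 t)) ∨ At (wt l w) a (dir (f a).2 t) (u - l))
    rw [ih]
    simp only [and_or_left, exists_or]
    refine or_congr_left ?_
    constructor
    · rintro ⟨ε, hx, rfl⟩
      rcases x with - | ⟨a, δ⟩
      · simp [recode] at hx
      · simp only [recode, Option.map_some, Option.some.injEq, Prod.mk.injEq] at hx
        exact ⟨a, hx.1, δ, rfl, by rw [← hx.2, dir_dir]⟩
    · rintro ⟨a, rfl, ε, rfl, rfl⟩
      exact ⟨_, rfl, by rw [dir_dir]⟩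

theorem not_notIn_of_at {w : Word α} {l : ℝ} {a : α} {t u : ℝ} (h : At (wt l w) a t u) : ¬ NotIn a w :=
  fun h' => h'.not_at _ _ _ h

/-- The disc stays as it is and the two gluing relations coincide: reversing all occurrences of a
letter changes `t` to `1 - t` on each of them, and injectivity on the occurring letters prevents new
identifications. -/
theorem relabel (f : α → β × Bool) (w : Word α)
    (hf : ∀ a b, ¬ NotIn a w → ¬ NotIn b w → (f a).1 = (f b).1 → a = b) :
    (pol w).Equiv (pol (w.map (recode f))) := by
  have hl : len (wt 1 (w.map (recode f))) = len (wt 1 w) := by simp [len_wt]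
  refine Scheme.equiv_of_rel (Homeomorph.refl Disc) ?_ ?_
  · rintro x y ⟨a, t, ⟨ht, u, hu, rfl⟩, -, v, hv, rfl⟩
    refine Scheme.glue (a := (f a).1) (t := dir (f a).2 t)
      ⟨dir_mem ht, u, (at_recode _ _ _ _ _ _).2 ⟨a, rfl, by rwa [dir_invol]⟩, by rw [hl]; rfl⟩
      ⟨dir_mem ht, v, (at_recode _ _ _ _ _ _).2 ⟨a, rfl, by rwa [dir_invol]⟩, by rw [hl]; rfl⟩
  · rintro x y ⟨b, t, ⟨ht, u, hu, rfl⟩, -, v, hv, rfl⟩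
    obtain ⟨a, rfl, hu'⟩ := (at_recode _ _ _ _ _ _).1 hu
    obtain ⟨a', e, hv'⟩ := (at_recode _ _ _ _ _ _).1 hv
    obtain rfl := hf _ _ (not_notIn_of_at hv') (not_notIn_of_at hu') e
    exact Scheme.glue (a := a') (t := dir (f a').2 t)
      ⟨dir_mem ht, u, hu', by rw [hl]; rfl⟩ ⟨dir_mem ht, v, hv', by rw [hl]; rfl⟩

/-! ### Subdividing an edge -/

/-- `T` arises from `S` by subdividing the edge `z` into edges `x` and `y`. -/
def IsSubdiv (z x y : α) (ε δ : Bool) (S T : Scheme α) : Prop :=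
  (∀ t p, S.edge z t p → t ∈ Icc (0 : ℝ) 1) ∧ S.Free x ∧ S.Free y ∧
  ∃ e : S.carrier ≃ₜ T.carrier, ∀ b t p, T.edge b t (e p) ↔
    (t ∈ Icc (0 : ℝ) 1 ∧ b = x ∧ S.edge z (dir ε t / 2) p) ∨
    (t ∈ Icc (0 : ℝ) 1 ∧ b = y ∧ S.edge z ((1 + dir δ t) / 2) p) ∨ (b ≠ z ∧ S.edge b t p)

theorem IsSubdiv.sum {z x y : α} {ε δ : Bool} {S T S' T' : Scheme α} (h : IsSubdiv z x y ε δ S T)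
    (h' : IsSubdiv z x y ε δ S' T') : IsSubdiv z x y ε δ (S.sum S') (T.sum T') := by
  obtain ⟨h1, h2, h3, e, he⟩ := h
  obtain ⟨k1, k2, k3, f, hf⟩ := h'
  refine ⟨?_, Scheme.free_sum h2 k2, Scheme.free_sum h3 k3, e.sumCongr f, fun b t => ?_⟩
  · rintro t (p | p) hp
    exacts [h1 _ _ hp, k1 _ _ hp]
  · rintro (p | p)
    exacts [he b t p, hf b t p]

/-- A pair glued along `z` at parameter `t` is glued along `x` when `t ≤ 1 / 2` and along `y`
otherwise. Conversely `x` and `y` arise only from `z`, because neither occurred before. -/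
theorem IsSubdiv.equiv {z x y : α} {ε δ : Bool} {S T : Scheme α} (hxy : x ≠ y)
    (h : IsSubdiv z x y ε δ S T) : S.Equiv T := by
  obtain ⟨h1, h2, h3, e, he⟩ := h
  refine Scheme.equiv_of_rel e ?_ ?_
  · rintro p q ⟨b, t, hp, hq⟩
    by_cases hb : b = z
    · subst hb
      have ht := h1 _ _ hp
      rcases le_total t (1 / 2) with h | h
      · have hm : dir ε (2 * t) ∈ Icc (0 : ℝ) 1 := dir_mem ⟨by linarith [ht.1], by linarith⟩
        have e2 : dir ε (dir ε (2 * t)) / 2 = t := by rw [dir_invol]; ring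
        exact Scheme.glue (a := x) (t := dir ε (2 * t))
          ((he _ _ _).2 (Or.inl ⟨hm, rfl, by rwa [e2]⟩)) ((he _ _ _).2 (Or.inl ⟨hm, rfl, by rwa [e2]⟩))
      · have hm : dir δ (2 * t - 1) ∈ Icc (0 : ℝ) 1 := dir_mem ⟨by linarith, by linarith [ht.2]⟩
        have e2 : (1 + dir δ (dir δ (2 * t - 1))) / 2 = t := by rw [dir_invol]; ring
        exact Scheme.glue (a := y) (t := dir δ (2 * t - 1))
          ((he _ _ _).2 (Or.inr (Or.inl ⟨hm, rfl, by rwa [e2]⟩)))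
          ((he _ _ _).2 (Or.inr (Or.inl ⟨hm, rfl, by rwa [e2]⟩)))
    · exact Scheme.glue ((he _ _ _).2 (Or.inr (Or.inr ⟨hb, hp⟩)))
        ((he _ _ _).2 (Or.inr (Or.inr ⟨hb, hq⟩)))
  · intro p q
    obtain ⟨p, rfl⟩ := e.surjective p
    obtain ⟨q, rfl⟩ := e.surjective q
    rintro ⟨b, t, hp, hq⟩
    rw [e.symm_apply_apply, e.symm_apply_apply]
    rw [he] at hp hq
    rcases hp with ⟨-, rfl, hp⟩ | ⟨-, rfl, hp⟩ | ⟨-, hp⟩ <;>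
    rcases hq with ⟨-, e1, hq⟩ | ⟨-, e1, hq⟩ | ⟨-, hq⟩
    · exact Scheme.glue hp hq
    · exact (hxy e1).elim
    · exact (h2 _ _ hq).elim
    · exact (hxy e1.symm).elim
    · exact Scheme.glue hp hq
    · exact (h3 _ _ hq).elim
    · exact (h2 _ _ (e1 ▸ hp)).elim
    · exact (h3 _ _ (e1 ▸ hp)).elim
    · exact Scheme.glue hp hq

/-- Replace the edge `z` by two edges. -/
def sbl [DecidableEq α] (z x y : α) (ε δ : Bool) : Option (α × Bool) → Word α
  | none => [none]
  | some (b, true) => if b = z then [some (x, ε), some (y, δ)] else [some (b, true)]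
  | some (b, false) => if b = z then [some (y, !δ), some (x, !ε)] else [some (b, false)]

/-- Replace the edge `z` by two edges in a word. -/
def sbw [DecidableEq α] (z x y : α) (ε δ : Bool) (w : Word α) : Word α := w.flatMap (sbl z x y ε δ)

@[simp] theorem sbw_append [DecidableEq α] (z x y : α) (ε δ : Bool) (v w : Word α) :
    sbw z x y ε δ (v ++ w) = sbw z x y ε δ v ++ sbw z x y ε δ w := by simp [sbw]
@[simp] theorem sbw_cons [DecidableEq α] (z x y : α) (ε δ : Bool) (c) (w : Word α) :
    sbw z x y ε δ (c :: w) = sbl z x y ε δ c ++ sbw z x y ε δ w := by simp [sbw]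
@[simp] theorem sbw_nil [DecidableEq α] (z x y : α) (ε δ : Bool) :
    sbw z x y ε δ [] = [] := rfl

theorem sbw_of_notIn [DecidableEq α] {z : α} (x y : α) (ε δ : Bool) {w : Word α} (h : NotIn z w) :
    sbw z x y ε δ w = w := by
  induction w with
  | nil => rfl
  | cons c w ih =>
    rcases c with - | ⟨b, - | -⟩
    · simp at h; simp [sbl, ih h]
    · simp at h; simp [sbl, ih h.2, Ne.symm h.1]
    · simp at h; simp [sbl, ih h.2, Ne.symm h.1]

/-- If the two parts of a subdivided edge get length `1 / 2` each, all positions along the boundary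
are unchanged and the identity of the disc serves as the homeomorphism. -/
theorem isSubdiv_pol [DecidableEq α] (z x y : α) (ε δ : Bool) (w : Word α) (hx : NotIn x w)
    (hy : NotIn y w) : ∃ T : Scheme α, T.Iso (pol (sbw z x y ε δ w)) ∧
      IsSubdiv z x y ε δ (pol w) T := by
  let W : Word α → WWord α := fun w =>
    w.flatMap fun c => wt (1 / (sbl z x y ε δ c).length) (sbl z x y ε δ c)
  have Wcons (c w) : W (c :: w) = wt (1 / (sbl z x y ε δ c).length) (sbl z x y ε δ c) ++ W w := by
    simp [W]
  have slen (c) : 0 < ((sbl z x y ε δ c).length : ℝ) := by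
    have : 0 < (sbl z x y ε δ c).length := by
      rcases c with - | ⟨b, - | -⟩ <;> simp only [sbl] <;> try split_ifs
      all_goals simp
    exact_mod_cast this
  have hpos (w) : Pos (W w) := by
    induction w with
    | nil => simp [W, Pos]
    | cons c w ih => rw [Wcons]; exact pos_append.2 ⟨pos_wt (one_div_pos.2 (slen c)) _, ih⟩
  have hlen (w) : len (W w) = len (wt 1 w) := by
    induction w with
    | nil => simp [W, wt]
    | cons c w ih =>
      rw [Wcons, len_append, ih, len_wt, mul_one_div_cancel (slen c).ne']
      simp [wt]
  have hfst (w) : (W w).map Prod.fst = sbw z x y ε δ w := by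
    induction w with
    | nil => simp [W]
    | cons c w ih => rw [Wcons, List.map_append, ih]; simp [wt, Function.comp_def]
  have key (w : Word α) (hx : NotIn x w) (hy : NotIn y w) (b t) (ht : t ∈ Icc (0 : ℝ) 1) (u) :
      At (W w) b t u ↔
      (b = x ∧ At (wt 1 w) z (dir ε t / 2) u) ∨ (b = y ∧ At (wt 1 w) z ((1 + dir δ t) / 2) u) ∨
      (b ≠ z ∧ At (wt 1 w) b t u) := by
    induction w generalizing u with
    | nil => simp [W, wt, At]
    | cons c w ih =>
      have c1 : wt 1 (c :: w) = (c, 1) :: wt 1 w := rfl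
      rw [Wcons, at_append, len_wt, mul_one_div_cancel (slen c).ne', c1]
      rcases c with - | ⟨e, σ⟩
      · simp only [notIn_cons_none] at hx hy
        rw [ih hx hy]
        simp [sbl, wt, At]
      · simp only [notIn_cons_some] at hx hy
        rw [ih hx.2 hy.2]
        have hex := hx.1; have hey := hy.1
        by_cases he : e = z
        · subst he
          rcases σ with - | - <;> cases ε <;> cases δ <;> simp [sbl, wt, At, dir] <;> grind
        · rcases σ with - | - <;> simp [sbl, wt, At, dir, he] <;> grind
  refine ⟨poly (W w), poly_iso_pol (hpos w) (hfst w), fun t p h => h.1, free_pol hx, free_pol hy,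
    Homeomorph.refl Disc, fun b t p => ?_⟩
  have hm (t : ℝ) (ht : t ∈ Icc (0 : ℝ) 1) : dir ε t / 2 ∈ Icc (0 : ℝ) 1 ∧
      (1 + dir δ t) / 2 ∈ Icc (0 : ℝ) 1 := by
    have h1 := dir_mem (ε := ε) ht
    have h2 := dir_mem (ε := δ) ht
    exact ⟨⟨by linarith [h1.1], by linarith [h1.2]⟩, ⟨by linarith [h2.1], by linarith [h2.2]⟩⟩
  constructor
  · rintro ⟨ht, u, hu, hp⟩
    rw [hlen] at hp
    rcases (key w hx hy b t ht u).1 hu with ⟨hb, hu⟩ | ⟨hb, hu⟩ | ⟨hb, hu⟩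
    · exact Or.inl ⟨ht, hb, (hm t ht).1, u, hu, hp⟩
    · exact Or.inr (Or.inl ⟨ht, hb, (hm t ht).2, u, hu, hp⟩)
    · exact Or.inr (Or.inr ⟨hb, ht, u, hu, hp⟩)
  · rintro (⟨ht, hb, -, u, hu, hp⟩ | ⟨ht, hb, -, u, hu, hp⟩ | ⟨hb, ht, u, hu, hp⟩)
    · exact ⟨ht, u, (key w hx hy b t ht u).2 (Or.inl ⟨hb, hu⟩), by rw [hlen]; exact hp⟩
    · exact ⟨ht, u, (key w hx hy b t ht u).2 (Or.inr (Or.inl ⟨hb, hu⟩)), by rw [hlen]; exact hp⟩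
    · exact ⟨ht, u, (key w hx hy b t ht u).2 (Or.inr (Or.inr ⟨hb, hu⟩)), by rw [hlen]; exact hp⟩

theorem subdivide [DecidableEq α] (z x y : α) (ε δ : Bool) (w : Word α) (hxy : x ≠ y)
    (hx : NotIn x w) (hy : NotIn y w) : (pol w).Equiv (pol (sbw z x y ε δ w)) := by
  obtain ⟨T, hT, h⟩ := isSubdiv_pol z x y ε δ w hx hy
  exact (h.equiv hxy).trans hT.equiv

theorem subdivide_two [DecidableEq α] (z x y : α) (ε δ : Bool) (v w : Word α) (hxy : x ≠ y)
    (hxv : NotIn x v) (hyv : NotIn y v) (hx : NotIn x w) (hy : NotIn y w) :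
    ((pol v).sum (pol w)).Equiv ((pol (sbw z x y ε δ v)).sum (pol (sbw z x y ε δ w))) := by
  obtain ⟨T, hT, h⟩ := isSubdiv_pol z x y ε δ v hxv hyv
  obtain ⟨T', hT', h'⟩ := isSubdiv_pol z x y ε δ w hx hy
  exact ((h.sum h').equiv hxy).trans (hT.sum hT').equiv

end Ribbon
end

noncomputable section
namespace Ribbon
open Set Topology
variable {α β : Type}

/-! ### Moves on words -/

/-- Replacing the polygon `v` by `w`, in the presence of further polygons `S`, does not change the
glued space. -/
def Eqv (S : Scheme α) (v w : Word α) : Prop := ((pol v).sum S).Equiv ((pol w).sum S)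

theorem Eqv.refl (S : Scheme α) (v : Word α) : Eqv S v v := Scheme.Equiv.refl _
theorem Eqv.symm {S : Scheme α} {v w : Word α} (h : Eqv S v w) : Eqv S w v := Scheme.Equiv.symm h
theorem Eqv.trans {S : Scheme α} {u v w : Word α} (h : Eqv S u v) (k : Eqv S v w) : Eqv S u w :=
  Scheme.Equiv.trans h k

theorem Eqv.of_iso {S : Scheme α} {v w : Word α} (h : (pol v).Iso (pol w)) : Eqv S v w :=
  (h.sum (.refl S)).equiv

theorem Eqv.equiv {v w : Word α} (h : Eqv Scheme.empty v w) : (pol v).Equiv (pol w) :=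
  ((Scheme.sum_empty _).symm.equiv.trans h).trans (Scheme.sum_empty _).equiv

theorem Eqv.rot (S : Scheme α) (A B : Word α) : Eqv S (A ++ B) (B ++ A) := .of_iso (rotate A B)

theorem Eqv.join (S : Scheme α) (A B : Word α) :
    Eqv S (A ++ none :: none :: B) (A ++ none :: B) := .of_iso (join_none A B)

/-- The other direction of the letter follows from `merge` by exchanging the two polygons, up to
rotation. -/
theorem merge' (A B : Word α) (a : α) (ε : Bool) (S : Scheme α) (hA : A ≠ []) (hB : B ≠ [])
    (hAa : NotIn a A) (hBa : NotIn a B) (hS : S.Free a) :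
    ((pol (A ++ [some (a, ε)])).sum ((pol (some (a, !ε) :: B)).sum S)).Equiv
      ((pol (A ++ B)).sum S) := by
  cases ε
  · refine ((Scheme.sum_left_comm _ _ _).equiv.trans ?_).trans (Eqv.rot S B A)
    refine Scheme.Equiv.trans ?_ (merge B A a S hB hA hBa hAa hS)
    refine ((rotate [some (a, true)] B).sum (Scheme.Iso.sum ?_ (.refl S))).equiv
    simpa using rotate A [some (a, false)]
  · exact merge A B a S hA hB hAa hBa hS

/-- If the word contains `p s q` and `s⁻¹`, then `p s q` can be replaced by a new letter `y` and
`s⁻¹` by `q y⁻¹ p`. -/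
theorem Eqv.substitute (S : Scheme α) (X Y Z p q : Word α) (s y : α) (ε : Bool) (hsy : s ≠ y)
    (hs : NotIn s (X ++ (Y ++ (Z ++ (p ++ q))))) (hy : NotIn y (X ++ (Y ++ (Z ++ (p ++ q)))))
    (hSs : S.Free s) (hSy : S.Free y) :
    Eqv S (X ++ some (s, !ε) :: (Y ++ (p ++ some (s, ε) :: (q ++ Z))))
      (X ++ (q ++ some (y, !ε) :: (p ++ (Y ++ some (y, ε) :: Z)))) := by
  simp only [notIn_append] at hs hy
  -- Read backwards, this cuts the polygon in two along a new edge `y` that separates `p s q` from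
  -- the rest.
  have h1 := merge' (Z ++ X ++ some (s, !ε) :: Y) (p ++ some (s, ε) :: q) y ε S (by simp) (by simp)
    (by simp [hy, hsy.symm]) (by simp [hy, hsy.symm]) hSy
  -- The two pieces are pasted together again along `s`.
  have h2 := merge' (q ++ some (y, !ε) :: p) (Y ++ some (y, ε) :: (Z ++ X)) s ε S (by simp) (by simp)
    (by simp [hs, hsy]) (by simp [hs, hsy]) hSs
  have r1 : Eqv S (X ++ some (s, !ε) :: (Y ++ (p ++ some (s, ε) :: (q ++ Z))))
      (Z ++ X ++ some (s, !ε) :: Y ++ (p ++ some (s, ε) :: q)) := by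
    simpa using Eqv.rot S (X ++ some (s, !ε) :: (Y ++ (p ++ some (s, ε) :: q))) Z
  have r2 : Eqv S (q ++ some (y, !ε) :: p ++ (Y ++ some (y, ε) :: (Z ++ X)))
      (X ++ (q ++ some (y, !ε) :: (p ++ (Y ++ some (y, ε) :: Z)))) := by
    simpa using Eqv.rot S (q ++ some (y, !ε) :: (p ++ (Y ++ some (y, ε) :: Z))) X
  refine r1.trans (h1.symm.trans (Scheme.Equiv.trans ?_ (h2.trans r2)))
  refine (Scheme.sum_left_comm _ _ _).equiv.trans (Scheme.Iso.sum ?_ (Scheme.Iso.sum ?_ (.refl S))).equiv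
  · simpa using rotate (some (y, !ε) :: (p ++ [some (s, ε)])) q
  · simpa using rotate (Z ++ X) (some (s, !ε) :: (Y ++ [some (y, ε)]))

/-- Only finitely many labels occur. -/
def Finitary (S : Scheme α) : Prop := ∃ F : Finset α, ∀ a ∉ F, S.Free a

theorem finitary_empty : Finitary (Scheme.empty : Scheme α) := ⟨∅, fun a _ => Scheme.free_empty a⟩

theorem exists_notIn (w : Word α) : ∃ F : Finset α, ∀ a ∉ F, NotIn a w := by
  classical
  induction w with
  | nil => exact ⟨∅, by simp⟩
  | cons x w ih =>
    obtain ⟨F, hF⟩ := ih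
    rcases x with - | ⟨b, ε⟩
    · exact ⟨F, by simpa using hF⟩
    · refine ⟨insert b F, fun a ha => ?_⟩
      simp only [Finset.mem_insert, not_or] at ha
      simp [ha.1, hF a ha.2]

theorem finitary_pol (w : Word α) : Finitary (pol w) := by
  obtain ⟨F, hF⟩ := exists_notIn w
  exact ⟨F, fun a ha => free_pol (hF a ha)⟩

theorem exists_fresh [Infinite α] {S : Scheme α} (hS : Finitary S) (w : Word α) :
    ∃ y, NotIn y w ∧ S.Free y := by
  classical
  obtain ⟨F, hF⟩ := hS
  obtain ⟨G, hG⟩ := exists_notIn w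
  obtain ⟨y, hy⟩ := Infinite.exists_notMem_finset (F ∪ G)
  simp only [Finset.mem_union, not_or] at hy
  exact ⟨y, hG y hy.2, hF y hy.1⟩

/-- What lies between `a` and `a⁻¹` can be rotated. -/
theorem Eqv.slide [Infinite α] {S : Scheme α} (hfin : Finitary S) (a : α) (ε : Bool)
    (X Y Z : Word α) (ha : NotIn a (X ++ (Y ++ Z))) (hS : S.Free a) :
    Eqv S (some (a, ε) :: (X ++ (Y ++ some (a, !ε) :: Z)))
      (some (a, ε) :: (Y ++ (X ++ some (a, !ε) :: Z))) := by
  have step (a y : α) (X Y : Word α) (hay : a ≠ y) (ha : NotIn a (X ++ (Y ++ Z)))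
      (hy : NotIn y (X ++ (Y ++ Z))) (hSa : S.Free a) (hSy : S.Free y) :
      Eqv S (some (a, ε) :: (X ++ (Y ++ some (a, !ε) :: Z)))
        (some (y, ε) :: (Y ++ (X ++ some (y, !ε) :: Z))) := by
    simp only [notIn_append] at ha hy
    have h := Eqv.substitute S [] Z Y [] X a y ε hay (by simp [ha]) (by simp [hy]) hSa hSy
    have r1 := Eqv.rot S (some (a, ε) :: (X ++ Y)) (some (a, !ε) :: Z)
    have r2 := Eqv.rot S (X ++ some (y, !ε) :: Z) (some (y, ε) :: Y)
    refine Eqv.trans ?_ (h.trans (Eqv.trans ?_ r2))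
    · simpa using r1
    · simpa using Eqv.refl S _
  obtain ⟨y, hy, hSy⟩ := exists_fresh hfin (some (a, true) :: (X ++ (Y ++ Z)))
  simp only [notIn_cons_some] at hy
  -- The first application exchanges `X` and `Y` but renames `a` to `y`; the second, with nothing to
  -- exchange, restores the name.
  refine (step a y X Y (Ne.symm hy.1) ha hy.2 hS hSy).trans ?_
  simp only [notIn_append] at ha hy
  simpa using step y a (Y ++ X) [] hy.1 (by simp [hy]) (by simp [ha]) hSy hS

/-- Equivalence relations on words which allow rotation of the whole word and of what lies between
a letter and its inverse. -/
structure Moves (E : Word α → Word α → Prop) (ok : α → Prop) : Prop where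
  refl : ∀ v, E v v
  symm : ∀ {v w}, E v w → E w v
  trans : ∀ {u v w}, E u v → E v w → E u w
  rot : ∀ A B, E (A ++ B) (B ++ A)
  slide : ∀ a ε X Y Z, ok a → NotIn a (X ++ (Y ++ Z)) →
    E (some (a, ε) :: (X ++ (Y ++ some (a, !ε) :: Z))) (some (a, ε) :: (Y ++ (X ++ some (a, !ε) :: Z)))

theorem moves_eqv [Infinite α] {S : Scheme α} (hfin : Finitary S) : Moves (Eqv S) S.Free :=
  ⟨Eqv.refl S, Eqv.symm, Eqv.trans, Eqv.rot S, fun a ε X Y Z h h' => Eqv.slide hfin a ε X Y Z h' h⟩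

section moves
variable {E : Word α → Word α → Prop} {ok : α → Prop} (hE : Moves E ok)
include hE

/-- A commutator can be split off. -/
theorem Moves.split_comm (a b : α) (ε δ : Bool) (P Q R S : Word α) (ha : ok a) (hb : ok b)
    (hab : a ≠ b) (hPa : NotIn a (P ++ (Q ++ (R ++ S)))) (hPb : NotIn b (P ++ (Q ++ (R ++ S)))) :
    E (some (a, ε) :: (P ++ some (b, δ) :: (Q ++ some (a, !ε) :: (R ++ some (b, !δ) :: S))))
      (some (a, ε) :: some (b, δ) :: some (a, !ε) :: some (b, !δ) :: (S ++ (R ++ (Q ++ P)))) := by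
  simp only [notIn_append] at hPa hPb
  -- Three slides clear the spaces between the four letters: `P` is pushed past `b`, then `Q P` past
  -- `a⁻¹`, then `R Q P` past `b⁻¹`.
  have h1 := hE.slide a ε P (some (b, δ) :: Q) (R ++ some (b, !δ) :: S) ha
    (by simp [hPa, hab])
  have h2 := hE.rot [some (a, ε)] (some (b, δ) :: (Q ++ (P ++ some (a, !ε) :: (R ++ some (b, !δ) :: S))))
  have h3 := hE.slide b δ (Q ++ P) (some (a, !ε) :: R) (S ++ [some (a, ε)]) hb
    (by simp [hPb, hab.symm])
  have h4 := hE.rot [some (b, δ)] (some (a, !ε) :: (R ++ (Q ++ (P ++ some (b, !δ) :: (S ++ [some (a, ε)])))))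
  have h5 := hE.slide a (!ε) (R ++ (Q ++ P)) (some (b, !δ) :: S) [some (b, δ)] ha
    (by simp [hPa, hab])
  have h6 := hE.rot (some (a, !ε) :: some (b, !δ) :: (S ++ (R ++ (Q ++ P)))) [some (a, ε), some (b, δ)]
  simp only [List.append_assoc, List.cons_append, List.nil_append, Bool.not_not] at h1 h2 h3 h4 h5 h6
  exact hE.trans h1 (hE.trans h2 (hE.trans h3 (hE.trans h4 (hE.trans h5 h6))))

/-- A commutator can be moved around. -/
theorem Moves.comm_comm (a b : α) (ε δ : Bool) (U V : Word α) (ha : ok a) (hb : ok b)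
    (hab : a ≠ b) (hPa : NotIn a (U ++ V)) (hPb : NotIn b (U ++ V)) :
    E (some (a, ε) :: some (b, δ) :: some (a, !ε) :: some (b, !δ) :: (U ++ V))
      (some (a, ε) :: some (b, δ) :: some (a, !ε) :: some (b, !δ) :: (V ++ U)) := by
  simp only [notIn_append] at hPa hPb
  -- The slides carry `V` leftwards past `b⁻¹`, `a⁻¹` and `b`, until it stands right behind `a`;
  -- then `U` is put behind `V`, and `split_comm` moves `V U` out of the commutator.
  have h1 := hE.rot [some (a, ε), some (b, δ)] (some (a, !ε) :: some (b, !δ) :: (U ++ V))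
  have h2 := hE.slide a (!ε) (some (b, !δ) :: U) V [some (b, δ)] ha (by simp [hPa, hab])
  have h3 := hE.rot (some (a, !ε) :: (V ++ some (b, !δ) :: (U ++ [some (a, ε)]))) [some (b, δ)]
  have h4 := hE.slide b δ [some (a, !ε)] V (U ++ [some (a, ε)]) hb (by simp [hPb, hab.symm])
  have h5 := hE.rot (some (b, δ) :: (V ++ some (a, !ε) :: some (b, !δ) :: U)) [some (a, ε)]
  have h6 := hE.slide a ε [some (b, δ)] V (some (b, !δ) :: U) ha (by simp [hPa, hab])
  have h7 := hE.rot (some (a, ε) :: (V ++ some (b, δ) :: [some (a, !ε)])) (some (b, !δ) :: U)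
  have h8 := hE.slide b (!δ) U (some (a, ε) :: V) [some (a, !ε)] hb (by simp [hPb, hab.symm])
  have h9 := hE.rot [some (b, !δ)] (some (a, ε) :: (V ++ (U ++ [some (b, δ), some (a, !ε)])))
  have h10 := hE.split_comm a b ε δ (V ++ U) [] [] [] ha hb hab (by simp [hPa]) (by simp [hPb])
  simp only [List.append_assoc, List.cons_append, List.nil_append,
    Bool.not_not] at h1 h2 h3 h4 h5 h6 h7 h8 h9 h10
  exact hE.trans h1 (hE.trans h2 (hE.trans h3 (hE.trans h4 (hE.trans h5 (hE.trans h6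
    (hE.trans h7 (hE.trans h8 (hE.trans h9 h10))))))))

/-- `c c⁻¹` can be moved around. -/
theorem Moves.pair_comm (c : α) (ε : Bool) (U V : Word α) (hc : ok c) (hcU : NotIn c (U ++ V)) :
    E (some (c, ε) :: some (c, !ε) :: (U ++ V)) (some (c, ε) :: some (c, !ε) :: (V ++ U)) := by
  simp only [notIn_append] at hcU
  have h1 := hE.rot [some (c, ε)] (some (c, !ε) :: (U ++ V))
  have h2 := hE.slide c (!ε) U V [] hc (by simp [hcU])
  have h3 := hE.rot (some (c, !ε) :: (V ++ U)) [some (c, ε)]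
  simp only [List.append_assoc, List.cons_append, List.nil_append, Bool.not_not] at h1 h2 h3
  exact hE.trans h1 (hE.trans h2 h3)

end moves
end Ribbon
end

noncomputable section
namespace Ribbon
open Set Topology
variable {α β : Type}

/-! ### Words with gaps -/

/-- Insert an unlabelled edge after every letter. -/
def gap (w : Word α) : Word α := w.flatMap fun x => [x, none]

@[simp] theorem gap_nil : gap ([] : Word α) = [] := rfl
@[simp] theorem gap_cons (x) (w : Word α) : gap (x :: w) = x :: none :: gap w := by simp [gap]
@[simp] theorem gap_append (v w : Word α) : gap (v ++ w) = gap v ++ gap w := by simp [gap]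

@[simp] theorem notIn_gap (a : α) (w : Word α) : NotIn a (gap w) ↔ NotIn a w := by
  induction w with
  | nil => simp
  | cons x w ih => rcases x with - | ⟨b, ε⟩ <;> simp [ih]

/-- For nonempty `X` the word `gap X` ends in an unlabelled edge, which can be divided into two. -/
theorem Eqv.insert (S : Scheme α) (A X B : Word α) (hX : X ≠ []) :
    Eqv S (A ++ (gap X ++ B)) (A ++ (gap X ++ none :: B)) := by
  obtain ⟨X, x, rfl⟩ := (List.eq_nil_or_concat X).resolve_left hX
  simpa using (Eqv.join S (A ++ (gap X ++ [x])) B).symm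

/-- Equivalence of words with gaps. -/
def GEqv (v w : Word α) : Prop := Eqv Scheme.empty (gap v) (gap w)

/-- A slide moves complete blocks `none :: gap X`. The unlabelled edge lacking in front of the
second block is split off from the end of the first one, and absorbed again after the exchange. -/
theorem moves_gEqv [Infinite α] : Moves (GEqv (α := α)) fun _ => True where
  refl _ := Eqv.refl _ _
  symm := Eqv.symm
  trans := Eqv.trans
  rot A B := by simpa [GEqv] using Eqv.rot Scheme.empty (gap A) (gap B)
  slide a ε X Y Z _ ha := by
    rcases eq_or_ne X [] with rfl | hX
    · exact Eqv.refl _ _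
    rcases eq_or_ne Y [] with rfl | hY
    · exact Eqv.refl _ _
    have h1 := Eqv.insert Scheme.empty [some (a, ε), none] X (gap Y ++ some (a, !ε) :: none :: gap Z) hX
    have h2 := Eqv.slide finitary_empty a ε (none :: gap X) (none :: gap Y) (none :: gap Z)
      (by simpa using ha) (Scheme.free_empty a)
    have h3 := (Eqv.insert Scheme.empty [some (a, ε), none] Y
      (gap X ++ some (a, !ε) :: none :: gap Z) hY).symm
    simp only [GEqv, gap_cons, gap_append, List.cons_append, List.nil_append] at h1 h2 h3 ⊢
    exact h1.trans (h2.trans h3)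

/-! ### Products of commutators and of trivial pairs -/

/-- A commutator or a trivial pair of letters. -/
inductive Item (α : Type)
  | comm (a : α) (ε : Bool) (b : α) (δ : Bool)
  | pair (c : α) (ε : Bool)

namespace Item

/-- The word of an item. -/
def word : Item α → Word α
  | comm a ε b δ => [some (a, ε), some (b, δ), some (a, !ε), some (b, !δ)]
  | pair c ε => [some (c, ε), some (c, !ε)]

/-- The labels of an item. -/
def letters : Item α → List α
  | comm a _ b _ => [a, b]
  | pair c _ => [c]

/-- Whether an item is a commutator. -/
def isComm : Item α → Bool
  | comm .. => true
  | pair .. => false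

end Item

/-- The product of a list of items. -/
def iword (L : List (Item α)) : Word α := L.flatMap Item.word
/-- The labels of a list of items. -/
def iletters (L : List (Item α)) : List α := L.flatMap Item.letters

@[simp] theorem iword_nil : iword ([] : List (Item α)) = [] := rfl
@[simp] theorem iword_cons (i : Item α) (L) : iword (i :: L) = i.word ++ iword L := by simp [iword]
@[simp] theorem iword_append (L M : List (Item α)) : iword (L ++ M) = iword L ++ iword M := by
  simp [iword]
@[simp] theorem iletters_nil : iletters ([] : List (Item α)) = [] := rfl
@[simp] theorem iletters_cons (i : Item α) (L) : iletters (i :: L) = i.letters ++ iletters L := by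
  simp [iletters]
@[simp] theorem iletters_append (L M : List (Item α)) :
    iletters (L ++ M) = iletters L ++ iletters M := by simp [iletters]

theorem Item.notIn_word (i : Item α) (a : α) : NotIn a i.word ↔ a ∉ i.letters := by
  cases i <;> simp [word, letters] <;> tauto

theorem notIn_iword (L : List (Item α)) (a : α) : NotIn a (iword L) ↔ a ∉ iletters L := by
  induction L with
  | nil => simp
  | cons i L ih => simp [ih, Item.notIn_word]

section moves
variable {E : Word α → Word α → Prop} {ok : α → Prop} (hE : Moves E ok) (hok : ∀ a, ok a)
include hE hok

theorem Moves.item_comm (i : Item α) (U V : Word α) (hi : i.letters.Nodup)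
    (h : ∀ a ∈ i.letters, NotIn a (U ++ V)) : E (i.word ++ (U ++ V)) (i.word ++ (V ++ U)) := by
  cases i with
  | comm a ε b δ =>
    exact hE.comm_comm a b ε δ U V (hok a) (hok b) (by simpa [Item.letters] using hi)
      (h a (by simp [Item.letters])) (h b (by simp [Item.letters]))
  | pair c ε => exact hE.pair_comm c ε U V (hok c) (h c (by simp [Item.letters]))

/-- Items can be carried past anything, so neighbours can be exchanged. The prefix `A` is general so
that the induction can absorb leading items into it. -/
theorem Moves.perm {L M : List (Item α)} (h : L.Perm M) : ∀ A : Word α, (iletters L).Nodup →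
    (∀ a ∈ iletters L, NotIn a A) → E (A ++ iword L) (A ++ iword M) := by
  induction h with
  | nil => exact fun A _ _ => hE.refl _
  | cons i _ ih =>
    intro A hL hA
    simp only [iletters_cons, List.nodup_append, List.mem_append] at hL hA
    have := ih (A ++ i.word) hL.2.1 fun a ha => by
      rw [notIn_append, Item.notIn_word]
      exact ⟨hA a (Or.inr ha), fun h => hL.2.2 a h a ha rfl⟩
    simpa using this
  | swap i j L =>
    intro A hL hA
    simp only [iletters_cons, List.nodup_append, List.mem_append] at hL hA
    have h1 := hE.rot (A ++ j.word) (i.word ++ iword L)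
    have h2 := hE.item_comm hok i (iword L ++ A) j.word hL.2.1.1 fun a ha => by
      simp only [notIn_append, Item.notIn_word, notIn_iword]
      exact ⟨⟨fun h => hL.2.1.2.2 a ha a h rfl, hA a (Or.inr (Or.inl ha))⟩,
        fun h => hL.2.2 a h a (Or.inl ha) rfl⟩
    have h3 := hE.rot (i.word ++ (j.word ++ iword L)) A
    simp only [List.append_assoc, iword_cons] at h1 h2 h3 ⊢
    exact hE.trans h1 (hE.trans h2 h3)
  | trans h1 h2 ih1 ih2 =>
    intro A hL hA
    have hp := h1.flatMap_right Item.letters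
    exact hE.trans (ih1 A hL hA) (ih2 A (hp.nodup_iff.1 hL) fun a ha => hA a (hp.mem_iff.2 ha))

end moves

/-- Items with standard labels. -/
def stdItems : List Bool → ℕ → List (Item ℕ)
  | [], _ => []
  | true :: s, n => .comm n true (n + 1) true :: stdItems s (n + 2)
  | false :: s, n => .pair n true :: stdItems s (n + 1)

/-- The standard word for genus `g` and `k + 1` boundary circles. -/
def stdWord (g k : ℕ) : Word ℕ := iword (stdItems (List.replicate g true ++ List.replicate k false) 0)

theorem map_recode_congr {f f' : α → β × Bool} {w : Word α} (h : ∀ a, ¬ NotIn a w → f a = f' a) :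
    w.map (recode f) = w.map (recode f') := by
  refine List.map_congr_left fun x hx => ?_
  rcases x with - | ⟨a, ε⟩
  · rfl
  · have := h a fun hn => hn ε hx
    simp [recode, this]

/-- The function `f` gives each letter its standard number and records whether it must be reversed.
The lower bound `n` keeps the numbers of the tail away from those of the head. -/
theorem exists_recode (L : List (Item α)) : (iletters L).Nodup → ∀ n : ℕ, ∃ f : α → ℕ × Bool,
    (∀ a ∈ iletters L, n ≤ (f a).1) ∧ (∀ a ∈ iletters L, ∀ b ∈ iletters L, (f a).1 = (f b).1 → a = b) ∧
    (iword L).map (recode f) = iword (stdItems (L.map Item.isComm) n) := by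
  classical
  induction L with
  | nil => exact fun _ n => ⟨fun _ => (0, true), by simp, by simp, rfl⟩
  | cons i L ih =>
    intro hL n
    simp only [iletters_cons, List.nodup_append] at hL
    cases i with
    | comm a ε b δ =>
      obtain ⟨f, h1, h2, h3⟩ := ih hL.2.1 (n + 2)
      have hab : a ≠ b := by simpa [Item.letters] using hL.1
      have haL : a ∉ iletters L := fun h => hL.2.2 a (by simp [Item.letters]) a h rfl
      have hbL : b ∉ iletters L := fun h => hL.2.2 b (by simp [Item.letters]) b h rfl
      let f' : α → ℕ × Bool := fun x => if x = a then (n, ε) else if x = b then (n + 1, δ) else f x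
      have fa : f' a = (n, ε) := by simp [f']
      have fb : f' b = (n + 1, δ) := by simp [f', hab.symm]
      have fL : ∀ x ∈ iletters L, f' x = f x := fun x hx => by
        have h1 : x ≠ a := fun h => haL (h ▸ hx)
        have h2 : x ≠ b := fun h => hbL (h ▸ hx)
        simp [f', h1, h2]
      refine ⟨f', ?_, ?_, ?_⟩
      · simp only [iletters_cons, Item.letters, List.cons_append, List.nil_append, List.mem_cons]
        rintro x (rfl | rfl | hx)
        · rw [fa]
        · rw [fb]; simp
        · rw [fL x hx]; have := h1 x hx; omega
      · simp only [iletters_cons, Item.letters, List.cons_append, List.nil_append, List.mem_cons]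
        rintro x (rfl | rfl | hx) y (rfl | rfl | hy) e
        · rfl
        · rw [fa, fb] at e; simp at e
        · rw [fa, fL y hy] at e; have := h1 y hy; simp at e; omega
        · rw [fa, fb] at e; simp at e
        · rfl
        · rw [fb, fL y hy] at e; have := h1 y hy; simp at e; omega
        · rw [fa, fL x hx] at e; have := h1 x hx; simp at e; omega
        · rw [fb, fL x hx] at e; have := h1 x hx; simp at e; omega
        · rw [fL x hx, fL y hy] at e; exact h2 x hx y hy e
      · have : (iword L).map (recode f') = (iword L).map (recode f) :=
          map_recode_congr fun x hx => fL x (by rwa [notIn_iword, not_not] at hx)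
        simp only [iword_cons, List.map_append, this, h3, List.map_cons, Item.isComm, stdItems]
        congr 1
        simp only [Item.word, List.map_cons, List.map_nil, recode, Option.map_some, fa, fb]
        cases ε <;> cases δ <;> rfl
    | pair c ε =>
      obtain ⟨f, h1, h2, h3⟩ := ih hL.2.1 (n + 1)
      have hcL : c ∉ iletters L := fun h => hL.2.2 c (by simp [Item.letters]) c h rfl
      let f' : α → ℕ × Bool := fun x => if x = c then (n, ε) else f x
      have fc : f' c = (n, ε) := by simp [f']
      have fL : ∀ x ∈ iletters L, f' x = f x := fun x hx => by
        have h1 : x ≠ c := fun h => hcL (h ▸ hx)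
        simp [f', h1]
      refine ⟨f', ?_, ?_, ?_⟩
      · simp only [iletters_cons, Item.letters, List.cons_append, List.nil_append, List.mem_cons]
        rintro x (rfl | hx)
        · rw [fc]
        · rw [fL x hx]; have := h1 x hx; omega
      · simp only [iletters_cons, Item.letters, List.cons_append, List.nil_append, List.mem_cons]
        rintro x (rfl | hx) y (rfl | hy) e
        · rfl
        · rw [fc, fL y hy] at e; have := h1 y hy; simp at e; omega
        · rw [fc, fL x hx] at e; have := h1 x hx; simp at e; omega
        · rw [fL x hx, fL y hy] at e; exact h2 x hx y hy e
      · have : (iword L).map (recode f') = (iword L).map (recode f) :=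
          map_recode_congr fun x hx => fL x (by rwa [notIn_iword, not_not] at hx)
        simp only [iword_cons, List.map_append, this, h3, List.map_cons, Item.isComm, stdItems]
        congr 1
        simp only [Item.word, List.map_cons, List.map_nil, recode, Option.map_some, fc]
        cases ε <;> rfl

theorem gap_map_recode (f : α → β × Bool) (w : Word α) :
    gap (w.map (recode f)) = (gap w).map (recode f) := by
  induction w with
  | nil => rfl
  | cons x w ih => simp [ih]; rfl

/-- A product of `g` commutators and `k` trivial pairs can be brought to standard form. -/
theorem iword_equiv_std [Infinite α] (L : List (Item α)) (hL : (iletters L).Nodup) (g k : ℕ)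
    (hg : L.countP Item.isComm = g) (hk : L.countP (fun i => !i.isComm) = k) :
    (pol (gap (iword L))).Equiv (pol (gap (stdWord g k))) := by
  have hp := (List.filter_append_perm Item.isComm L).symm
  set M := L.filter Item.isComm ++ L.filter (fun i => !i.isComm) with hM
  have h1 : GEqv (iword L) (iword M) := by
    simpa using moves_gEqv.perm (fun _ => trivial) hp [] hL (by simp)
  have hML : (iletters M).Nodup := (hp.flatMap_right Item.letters).nodup_iff.1 hL
  obtain ⟨f, -, hf, hw⟩ := exists_recode M hML 0
  have hs : M.map Item.isComm = List.replicate g true ++ List.replicate k false := by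
    rw [hM, List.map_append]
    congr 1
    · rw [List.eq_replicate_iff]
      refine ⟨by simp [← hg, List.countP_eq_length_filter], fun b hb => ?_⟩
      obtain ⟨i, hi, rfl⟩ := List.mem_map.1 hb
      exact (List.mem_filter.1 hi).2
    · rw [List.eq_replicate_iff]
      refine ⟨by simp [← hk, List.countP_eq_length_filter], fun b hb => ?_⟩
      obtain ⟨i, hi, rfl⟩ := List.mem_map.1 hb
      simpa using (List.mem_filter.1 hi).2
  rw [hs] at hw
  have h2 := relabel f (gap (iword M)) fun a b ha hb => by
    rw [notIn_gap, notIn_iword, not_not] at ha hb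
    exact hf a ha b hb
  rw [← gap_map_recode, hw] at h2
  exact (Eqv.equiv h1).trans h2

end Ribbon
end

/-! ### From the embedded surface to polygons -/

noncomputable section
namespace Ribbon
open Set Topology GenusSurface

/-! ### Shape of the planar domain -/

/-- Centre of a hole as a real number. -/
def hc (g : ℕ) (j : ℕ) : ℝ := ((2 * (j : ℝ) + 1) / g - 1) / 2

theorem holeCentre_eq (g : ℕ) (j : Fin g) : holeCentre g j = (hc g j : ℂ) := rfl

/-- Angle of the centre of a removed disc. -/
def ga (d : ℕ) (k : ℕ) : ℝ := (2 * (k : ℝ) + 1) * Real.pi / (2 * d)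

/-- Half-width of a removed disc. -/
def gw (d : ℕ) : ℝ := Real.pi / (4 * d)

theorem discCentre_eq (d : ℕ) (k : Fin d) : discCentre d k = Complex.exp (ga d k * Complex.I) := rfl

theorem mul_conj_re (z : ℂ) (d : ℕ) (k : Fin d) : (z * (starRingEnd ℂ) (discCentre d k)).re =
    z.re * Real.cos (ga d k) + z.im * Real.sin (ga d k) := by
  rw [discCentre_eq, Complex.mul_re, Complex.conj_re, Complex.conj_im, Complex.exp_ofReal_mul_I_re,
    Complex.exp_ofReal_mul_I_im]
  ring

/-- Height of the holes. -/
def bump (g : ℕ) (x : ℝ) : ℝ :=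
  -- The index `none` stands for the real axis and `some j` for the upper half of the `j`-th hole;
  -- beside the hole its square root is zero.
  (Finset.univ : Finset (Option (Fin g))).sup' Finset.univ_nonempty
    fun o => o.elim 0 fun j => Real.sqrt (holeRadius g ^ 2 - (x - hc g j) ^ 2)

/-- Height of the disc without the removed segments. -/
def lid (d : ℕ) (x : ℝ) : ℝ :=
  -- The index `none` stands for the unit circle and `some k` for the chord bounding the `k`-th
  -- removed segment.
  (Finset.univ : Finset (Option (Fin d))).inf' Finset.univ_nonempty
    fun o => o.elim (Real.sqrt (1 - x ^ 2)) fun k =>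
      (Real.cos (gw d) - x * Real.cos (ga d k)) / Real.sin (ga d k)

theorem continuous_bump (g : ℕ) : Continuous (bump g) := by
  unfold bump
  refine Continuous.finset_sup'_apply _ fun o _ => ?_
  rcases o with - | j
  · exact continuous_const
  · simp only [Option.elim_some]; fun_prop

theorem continuous_lid (d : ℕ) : Continuous (lid d) := by
  unfold lid
  refine Continuous.finset_inf'_apply _ fun o _ => ?_
  rcases o with - | j
  · simp only [Option.elim_none]; fun_prop
  · simp only [Option.elim_some]; fun_prop

theorem bump_le_iff {g : ℕ} {x y : ℝ} : bump g x ≤ y ↔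
    0 ≤ y ∧ ∀ j : Fin g, Real.sqrt (holeRadius g ^ 2 - (x - hc g j) ^ 2) ≤ y := by
  rw [bump, Finset.sup'_le_iff]
  constructor
  · intro h; exact ⟨h none (Finset.mem_univ _), fun j => h (some j) (Finset.mem_univ _)⟩
  · rintro ⟨h, h'⟩ (- | j) -; exacts [h, h' j]

theorem le_lid_iff {d : ℕ} {x y : ℝ} : y ≤ lid d x ↔ y ≤ Real.sqrt (1 - x ^ 2) ∧
    ∀ k : Fin d, y ≤ (Real.cos (gw d) - x * Real.cos (ga d k)) / Real.sin (ga d k) := by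
  rw [lid, Finset.le_inf'_iff]
  constructor
  · intro h; exact ⟨h none (Finset.mem_univ _), fun j => h (some j) (Finset.mem_univ _)⟩
  · rintro ⟨h, h'⟩ (- | j) -; exacts [h, h' j]

theorem bump_nonneg (g : ℕ) (x : ℝ) : 0 ≤ bump g x := (bump_le_iff.1 le_rfl).1
theorem sqrt_le_bump (g : ℕ) (x : ℝ) (j : Fin g) :
    Real.sqrt (holeRadius g ^ 2 - (x - hc g j) ^ 2) ≤ bump g x := (bump_le_iff.1 le_rfl).2 j
theorem lid_le (d : ℕ) (x : ℝ) : lid d x ≤ Real.sqrt (1 - x ^ 2) := (le_lid_iff.1 le_rfl).1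

theorem exists_bump (g : ℕ) (x : ℝ) : bump g x = 0 ∨
    ∃ j : Fin g, bump g x = Real.sqrt (holeRadius g ^ 2 - (x - hc g j) ^ 2) := by
  obtain ⟨o, -, ho⟩ := Finset.exists_mem_eq_sup' (s := (Finset.univ : Finset (Option (Fin g))))
    Finset.univ_nonempty fun o => o.elim 0 fun j : Fin g =>
      Real.sqrt (holeRadius g ^ 2 - (x - hc g j) ^ 2)
  rcases o with - | j
  exacts [Or.inl ho, Or.inr ⟨j, ho⟩]

theorem exists_lid (d : ℕ) (x : ℝ) : lid d x = Real.sqrt (1 - x ^ 2) ∨ ∃ k : Fin d,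
    lid d x = (Real.cos (gw d) - x * Real.cos (ga d k)) / Real.sin (ga d k) := by
  obtain ⟨o, -, ho⟩ := Finset.exists_mem_eq_inf' (s := (Finset.univ : Finset (Option (Fin d))))
    Finset.univ_nonempty fun o => o.elim (Real.sqrt (1 - x ^ 2)) fun k : Fin d =>
      (Real.cos (gw d) - x * Real.cos (ga d k)) / Real.sin (ga d k)
  rcases o with - | j
  exacts [Or.inl ho, Or.inr ⟨j, ho⟩]

/-! Elementary estimates. -/

theorem holeRadius_nonneg (g : ℕ) : 0 ≤ holeRadius g := by unfold holeRadius; positivity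

theorem gpos {g : ℕ} (j : Fin g) : (0 : ℝ) < g := by exact_mod_cast (Nat.zero_le _).trans_lt j.2

theorem jlt {g : ℕ} (j : Fin g) : (j : ℝ) + 1 ≤ g := by exact_mod_cast j.2

theorem hc_bounds {g : ℕ} (j : Fin g) : |hc g j| + holeRadius g < 1 / 2 := by
  have h := gpos j
  have h2 := jlt j
  have h3 : (0 : ℝ) ≤ (j : ℕ) := by positivity
  have e : holeRadius g = 1 / (4 * g) := rfl
  have e1 : hc g j = ((4 * (j : ℝ) + 2) - 2 * g) / (4 * g) := by unfold hc; field_simp; ring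
  have e2 : (1 / 2 : ℝ) = (2 * g) / (4 * g) := by field_simp; norm_num
  rw [e, e1, e2, abs_div, abs_of_pos (show (0 : ℝ) < 4 * g by positivity), ← add_div]
  refine div_lt_div_of_pos_right ?_ (by positivity)
  rcases abs_cases (4 * (j : ℝ) + 2 - 2 * g) with ⟨h, -⟩ | ⟨h, -⟩ <;> rw [h] <;> linarith

theorem sq_lt_of_hole {g : ℕ} (j : Fin g) {x y : ℝ}
    (h : (x - hc g j) ^ 2 + y ^ 2 ≤ holeRadius g ^ 2) : x ^ 2 + y ^ 2 < 1 / 4 := by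
  have h1 := hc_bounds j
  have h2 := holeRadius_nonneg g
  have n1 : ‖(⟨x, y⟩ : ℂ) - (hc g j : ℂ)‖ ≤ holeRadius g := by
    rw [← sq_le_sq₀ (norm_nonneg _) h2, Complex.sq_norm, Complex.normSq_apply]
    simp only [Complex.sub_re, Complex.ofReal_re, Complex.sub_im, Complex.ofReal_im]
    nlinarith
  have n2 : ‖(⟨x, y⟩ : ℂ)‖ < 1 / 2 := by
    have := norm_le_norm_add_norm_sub' (⟨x, y⟩ : ℂ) (hc g j : ℂ)
    rw [Complex.norm_real, Real.norm_eq_abs] at this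
    linarith
  have n3 := Complex.sq_norm (⟨x, y⟩ : ℂ)
  rw [Complex.normSq_apply] at n3
  simp only at n3
  nlinarith [norm_nonneg (⟨x, y⟩ : ℂ)]

theorem dpos {d : ℕ} (k : Fin d) : (0 : ℝ) < d := by exact_mod_cast (Nat.zero_le _).trans_lt k.2

theorem half_lt_cos_gw {d : ℕ} (hd : (0 : ℝ) < d) : 1 / 2 < Real.cos (gw d) := by
  rw [← Real.cos_pi_div_three]
  have hp := Real.pi_pos
  have hd1 : (1 : ℝ) ≤ d := by exact_mod_cast (show 0 < d by exact_mod_cast hd)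
  refine Real.cos_lt_cos_of_nonneg_of_le_pi (by unfold gw; positivity) (by linarith) ?_
  unfold gw
  exact div_lt_div_of_pos_left hp (by norm_num) (by linarith)

theorem gw_lt_ga {d : ℕ} (k : Fin d) : gw d < ga d k := by
  have := dpos k
  have hp := Real.pi_pos
  unfold gw ga
  rw [div_lt_div_iff₀ (by positivity) (by positivity)]
  have : (0 : ℝ) ≤ (k : ℕ) := by positivity
  nlinarith [mul_nonneg (mul_pos hp (dpos k)).le this, mul_pos hp (dpos k)]

theorem ga_lt {d : ℕ} (k : Fin d) : ga d k < Real.pi - gw d := by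
  have h := dpos k
  have hp := Real.pi_pos
  have hk : (k : ℝ) + 1 ≤ d := by exact_mod_cast k.2
  have : gw d + ga d k = Real.pi * (4 * (k : ℝ) + 3) / (4 * d) := by
    unfold gw ga; field_simp; ring
  have h2 : Real.pi * (4 * (k : ℝ) + 3) / (4 * d) < Real.pi := by
    rw [div_lt_iff₀ (by positivity)]; nlinarith
  linarith

theorem gw_pos {d : ℕ} (hd : (0 : ℝ) < d) : 0 < gw d := by
  have := Real.pi_pos
  unfold gw; positivity

theorem sin_ga_pos {d : ℕ} (k : Fin d) : 0 < Real.sin (ga d k) :=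
  Real.sin_pos_of_pos_of_lt_pi ((gw_pos (dpos k)).trans (gw_lt_ga k))
    (by linarith [ga_lt k, gw_pos (dpos k)])

theorem abs_cos_ga_lt {d : ℕ} (k : Fin d) : |Real.cos (ga d k)| < Real.cos (gw d) := by
  have h0 := gw_pos (dpos k)
  have h1 := gw_lt_ga k
  have h2 := ga_lt k
  rw [abs_lt]
  constructor
  · rw [← Real.cos_pi_sub]
    exact Real.cos_lt_cos_of_nonneg_of_le_pi (by linarith) (by linarith) (by linarith)
  · exact Real.cos_lt_cos_of_nonneg_of_le_pi (by linarith) (by linarith) h1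

theorem mul_cos_lt {d : ℕ} (k : Fin d) {x : ℝ} (hx : |x| ≤ 1) :
    x * Real.cos (ga d k) < Real.cos (gw d) := by
  refine (le_abs_self _).trans_lt ?_
  rw [abs_mul]
  exact (mul_le_of_le_one_left (abs_nonneg _) hx).trans_lt (abs_cos_ga_lt k)

/-- The holes lie in the disc of radius `1 / 2`, while every chord has distance `cos (gw d) > 1 / 2`
from the origin. Hence the domain above the real axis is a strip between two graphs which meet only
over `x = 1` and `x = -1`. -/
theorem bump_lt_lid {g d : ℕ} {x : ℝ} (hx : |x| < 1) : bump g x < lid d x := by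
  have hx2 : x ^ 2 < 1 := (sq_lt_one_iff_abs_lt_one x).2 hx
  have key : bump g x = 0 ∨ x ^ 2 + bump g x ^ 2 < 1 / 4 := by
    rcases exists_bump g x with h | ⟨j, h⟩
    · exact Or.inl h
    · rcases le_or_gt (holeRadius g ^ 2 - (x - hc g j) ^ 2) 0 with h0 | h0
      · exact Or.inl (h.trans (Real.sqrt_eq_zero_of_nonpos h0))
      · right
        apply sq_lt_of_hole j
        rw [h, Real.sq_sqrt h0.le]; linarith
  have hb := bump_nonneg g x
  rcases exists_lid d x with h | ⟨k, h⟩ <;> rw [h]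
  · apply Real.lt_sqrt_of_sq_lt
    rcases key with h | h
    · rw [h]; linarith
    · linarith
  · rw [lt_div_iff₀ (sin_ga_pos k)]
    rcases key with h | h
    · rw [h]; linarith [mul_cos_lt k hx.le]
    · have h1 := half_lt_cos_gw (dpos k)
      have h2 := Real.sin_sq_add_cos_sq (ga d k)
      generalize Real.sin (ga d k) = s at *
      generalize Real.cos (ga d k) = c at *
      by_contra! hc
      have h3 : 1 / 2 < bump g x * s + x * c := by linarith
      -- The Cauchy–Schwarz inequality for `(bump g x, x)` and the unit vector `(s, c)`.
      nlinarith [sq_nonneg (bump g x * c - x * s)]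

theorem lid_of_abs_eq_one {d : ℕ} {x : ℝ} (hx : |x| = 1) : lid d x = 0 := by
  have h1 : (1 - x ^ 2) = 0 := by rw [← sq_abs, hx]; norm_num
  apply le_antisymm
  · simpa [h1] using lid_le d x
  · rw [le_lid_iff]
    refine ⟨by positivity, fun k => div_nonneg ?_ (sin_ga_pos k).le⟩
    linarith [mul_cos_lt k hx.le]

theorem bump_of_abs_eq_one {g : ℕ} {x : ℝ} (hx : |x| = 1) : bump g x = 0 := by
  apply le_antisymm _ (bump_nonneg g x)
  rw [bump_le_iff]
  refine ⟨le_rfl, fun j => ?_⟩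
  rw [Real.sqrt_eq_zero_of_nonpos]
  by_contra! h
  have := sq_lt_of_hole j (x := x) (y := 0) (by linarith)
  rw [← sq_abs, hx] at this
  norm_num at this

theorem bump_le_lid {g d : ℕ} {x : ℝ} (hx : |x| ≤ 1) : bump g x ≤ lid d x := by
  rcases hx.lt_or_eq with h | h
  · exact (bump_lt_lid h).le
  · rw [lid_of_abs_eq_one h, bump_of_abs_eq_one h]

theorem bump_eq_zero_iff {g : ℕ} {x : ℝ} : bump g x = 0 ↔
    ∀ j : Fin g, x ≤ hc g j - holeRadius g ∨ hc g j + holeRadius g ≤ x := by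
  have hr := holeRadius_nonneg g
  rw [← (bump_nonneg g x).ge_iff_eq', bump_le_iff, and_iff_right le_rfl]
  refine forall_congr' fun j => ?_
  rw [(Real.sqrt_nonneg _).ge_iff_eq', Real.sqrt_eq_zero', sub_nonpos, sq_le_sq, abs_of_nonneg hr,
    le_abs']
  exact or_congr ⟨fun h => by linarith, fun h => by linarith⟩
    ⟨fun h => by linarith, fun h => by linarith⟩

theorem lid_zero (x : ℝ) : lid 0 x = Real.sqrt (1 - x ^ 2) := by
  rcases exists_lid 0 x with h | ⟨k, -⟩
  exacts [h, k.elim0]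

/-- The domain above the real axis. -/
theorem upper_iff {g d : ℕ} {x y t : ℝ} (hy : 0 ≤ y) :
    ((⟨x, y⟩ : ℂ), t) ∈ surface g d ↔
      |x| ≤ 1 ∧ bump g x ≤ y ∧ y ≤ lid d x ∧ t ^ 2 = profile g ⟨x, y⟩ := by
  have e1 : ‖(⟨x, y⟩ : ℂ)‖ ≤ 1 ↔ |x| ≤ 1 ∧ y ≤ Real.sqrt (1 - x ^ 2) := by
    rw [← sq_le_one_iff₀ (norm_nonneg _), Complex.sq_norm, Complex.normSq_apply]
    constructor
    · intro h
      simp only at h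
      refine ⟨(sq_le_one_iff_abs_le_one x).1 (by nlinarith), Real.le_sqrt_of_sq_le (by nlinarith)⟩
    · rintro ⟨h1, h2⟩
      have := (sq_le_one_iff_abs_le_one x).2 h1
      rw [Real.le_sqrt hy (by linarith)] at h2
      simp only; nlinarith
  have e2 : (∀ j : Fin g, holeRadius g ≤ ‖(⟨x, y⟩ : ℂ) - holeCentre g j‖) ↔ bump g x ≤ y := by
    rw [bump_le_iff, and_iff_right hy]
    refine forall_congr' fun j => ?_
    rw [← sq_le_sq₀ (holeRadius_nonneg g) (norm_nonneg _), Complex.sq_norm, Complex.normSq_apply,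
      Real.sqrt_le_left hy, holeCentre_eq]
    simp only [Complex.sub_re, Complex.ofReal_re, Complex.sub_im, Complex.ofReal_im]
    constructor <;> intro h <;> nlinarith
  have e3 : (∀ k : Fin d, ((⟨x, y⟩ : ℂ) * (starRingEnd ℂ) (discCentre d k)).re ≤
      Real.cos (Real.pi / (4 * d))) ↔
      ∀ k : Fin d, y ≤ (Real.cos (gw d) - x * Real.cos (ga d k)) / Real.sin (ga d k) := by
    refine forall_congr' fun k => ?_
    rw [mul_conj_re, le_div_iff₀ (sin_ga_pos k), gw]
    constructor <;> intro h <;> linarith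
  simp only [surface, closedSurface, holedDisc, discRegion, mem_sdiff, mem_ofPred_eq, mem_iUnion,
    not_exists, not_lt, e1, e2, e3, le_lid_iff]
  tauto

/-- The domain below the real axis. -/
theorem lower_iff {g d : ℕ} {x y t : ℝ} (hy : 0 ≤ y) :
    ((⟨x, -y⟩ : ℂ), t) ∈ surface g d ↔
      |x| ≤ 1 ∧ bump g x ≤ y ∧ y ≤ lid 0 x ∧ t ^ 2 = profile g ⟨x, -y⟩ := by
  have c : (⟨x, -y⟩ : ℂ) = (starRingEnd ℂ) ⟨x, y⟩ := rfl
  have hn (j : Fin g) : ‖(⟨x, -y⟩ : ℂ) - holeCentre g j‖ = ‖(⟨x, y⟩ : ℂ) - holeCentre g j‖ := by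
    rw [holeCentre_eq, ← Complex.norm_conj, map_sub, Complex.conj_ofReal, c, Complex.conj_conj]
  have hn' : ‖(⟨x, -y⟩ : ℂ)‖ = ‖(⟨x, y⟩ : ℂ)‖ := by rw [c, Complex.norm_conj]
  have hs : ((⟨x, -y⟩ : ℂ), t) ∈ closedSurface g ↔ ((⟨x, y⟩ : ℂ), t) ∈ closedSurface g := by
    simp only [closedSurface, holedDisc, profile, hn, hn', mem_ofPred_eq]
  have hp : profile g ⟨x, -y⟩ = profile g ⟨x, y⟩ := by simp only [profile, hn, hn']
  have h0 : ((⟨x, y⟩ : ℂ), t) ∈ surface g 0 ↔ ((⟨x, y⟩ : ℂ), t) ∈ closedSurface g := by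
    simp [surface]
  rw [hp, ← upper_iff hy, h0, ← hs, surface, mem_sdiff]
  -- The removed discs do not reach below the real axis, so there the surface looks as if `d` were
  -- `0`.
  refine and_iff_left_of_imp fun h => ?_
  have hx : |x| ≤ 1 := (Complex.abs_re_le_norm ⟨x, -y⟩).trans h.1.1
  simp only [mem_iUnion, discRegion, mem_ofPred_eq, not_exists, not_lt]
  intro k
  rw [mul_conj_re]
  have := mul_cos_lt k hx
  have := mul_nonneg hy (sin_ga_pos k).le
  rw [gw] at *
  simp only
  linarith

theorem profile_neg (g : ℕ) (x y : ℝ) : profile g ⟨x, -y⟩ = profile g ⟨x, y⟩ := by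
  have c : (⟨x, -y⟩ : ℂ) = (starRingEnd ℂ) ⟨x, y⟩ := rfl
  have hn (j : Fin g) : ‖(⟨x, -y⟩ : ℂ) - holeCentre g j‖ = ‖(⟨x, y⟩ : ℂ) - holeCentre g j‖ := by
    rw [holeCentre_eq, ← Complex.norm_conj, map_sub, Complex.conj_ofReal, c, Complex.conj_conj]
  have hn' : ‖(⟨x, -y⟩ : ℂ)‖ = ‖(⟨x, y⟩ : ℂ)‖ := by rw [c, Complex.norm_conj]
  simp only [profile, hn, hn']

theorem profile_eq (g : ℕ) (x y : ℝ) : profile g ⟨x, y⟩ =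
    (1 - (x ^ 2 + y ^ 2)) * ∏ j : Fin g, ((x - hc g j) ^ 2 + y ^ 2 - holeRadius g ^ 2) := by
  simp only [profile, Complex.sq_norm, Complex.normSq_apply, holeCentre_eq, Complex.sub_re,
    Complex.ofReal_re, Complex.sub_im, Complex.ofReal_im]
  congr 1
  · ring
  · exact Finset.prod_congr rfl fun j _ => by ring

theorem bump_sq {g : ℕ} {x y : ℝ} (h : bump g x ≤ y) (j : Fin g) :
    holeRadius g ^ 2 ≤ (x - hc g j) ^ 2 + y ^ 2 := by
  obtain ⟨h0, h1⟩ := bump_le_iff.1 h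
  have := (Real.sqrt_le_left h0).1 (h1 j)
  linarith

theorem lid_sq {d : ℕ} {x y : ℝ} (hx : |x| ≤ 1) (hy : 0 ≤ y) (h : y ≤ lid d x) :
    x ^ 2 + y ^ 2 ≤ 1 := by
  have := (sq_le_one_iff_abs_le_one x).2 hx
  have := (Real.le_sqrt hy (by linarith)).1 (h.trans (lid_le d x))
  linarith

theorem profile_nonneg {g d : ℕ} {x y : ℝ} (hx : |x| ≤ 1) (h1 : bump g x ≤ y) (h2 : y ≤ lid d x) :
    0 ≤ profile g ⟨x, y⟩ := by
  have hy := (bump_nonneg g x).trans h1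
  rw [profile_eq]
  have := lid_sq hx hy h2
  exact mul_nonneg (by linarith) (Finset.prod_nonneg fun j _ => by linarith [bump_sq h1 j])

/-- The two sheets over the strip meet along the unit circle and along the holes, but not along the
chords or the free parts of the real axis. These four kinds of arcs become the edges of the
polygons. -/
theorem profile_eq_zero_iff {g d : ℕ} {x y : ℝ} (hx : |x| ≤ 1) (h1 : bump g x ≤ y)
    (h2 : y ≤ lid d x) : profile g ⟨x, y⟩ = 0 ↔ y = lid d x ∧ lid d x = lid 0 x ∨
      y = bump g x ∧ ∃ j : Fin g, hc g j - holeRadius g ≤ x ∧ x ≤ hc g j + holeRadius g := by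
  have hy := (bump_nonneg g x).trans h1
  have hr := holeRadius_nonneg g
  have hx2 := (sq_le_one_iff_abs_le_one x).2 hx
  rw [profile_eq, mul_eq_zero, Finset.prod_eq_zero_iff]
  constructor
  · rintro (h | ⟨j, -, h⟩)
    · left
      have : y = lid 0 x := by
        rw [lid_zero, eq_comm, Real.sqrt_eq_iff_mul_self_eq (by linarith) hy]; linarith
      have h3 := lid_le d x
      rw [← lid_zero, ← this] at h3
      exact ⟨le_antisymm h2 h3, by rw [← this]; exact le_antisymm h3 h2⟩
    · right
      have h4 : y = Real.sqrt (holeRadius g ^ 2 - (x - hc g j) ^ 2) := by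
        rw [eq_comm, Real.sqrt_eq_iff_mul_self_eq (by nlinarith [sq_nonneg y]) hy]; linarith
      have h5 : |x - hc g j| ≤ holeRadius g := abs_le_of_sq_le_sq (by nlinarith [sq_nonneg y]) hr
      obtain ⟨h6, h7⟩ := abs_le.1 h5
      exact ⟨le_antisymm (h4.trans_le (sqrt_le_bump g x j)) h1, j, by linarith, by linarith⟩
  · rintro (⟨h, h'⟩ | ⟨h, j, h3, h4⟩)
    · left
      rw [h, h', lid_zero, Real.sq_sqrt (by linarith)]; ring
    · right
      -- If the lower graph has height zero over the range of hole `j`, the point is an end of that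
      -- hole; otherwise a hole attaining the maximum gives the zero factor.
      have aux : bump g x = 0 → (x - hc g j) ^ 2 + y ^ 2 - holeRadius g ^ 2 = 0 := fun h0 => by
        have := bump_sq h1 j
        rw [h, h0] at this ⊢
        nlinarith
      rcases exists_bump g x with h5 | ⟨i, h5⟩
      · exact ⟨j, Finset.mem_univ _, aux h5⟩
      · rcases le_or_gt (holeRadius g ^ 2 - (x - hc g i) ^ 2) 0 with h0 | h0
        · exact ⟨j, Finset.mem_univ _, aux (h5.trans (Real.sqrt_eq_zero_of_nonpos h0))⟩
        · exact ⟨i, Finset.mem_univ _, by rw [h, h5, Real.sq_sqrt h0.le]; ring⟩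

/-- Where the removed discs leave the unit circle alone. -/
theorem lid_eq_iff {d : ℕ} {u : ℝ} (h0 : 0 ≤ u) (h1 : u ≤ 1 / 2) :
    lid d (Real.cos (2 * Real.pi * u)) = lid 0 (Real.cos (2 * Real.pi * u)) ↔
      ∀ k : Fin d, u ≤ (4 * k + 1) / (8 * d) ∨ (4 * k + 3) / (8 * d) ≤ u := by
  have hp := Real.pi_pos
  have hs : Real.sqrt (1 - Real.cos (2 * Real.pi * u) ^ 2) = Real.sin (2 * Real.pi * u) := by
    rw [← Real.sin_sq, Real.sqrt_sq]
    exact Real.sin_nonneg_of_nonneg_of_le_pi (by positivity) (by nlinarith)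
  rw [lid_zero, ← (lid_le d _).ge_iff_eq, le_lid_iff, and_iff_right le_rfl]
  refine forall_congr' fun k => ?_
  have hd := dpos k
  have h2 := gw_pos (dpos k)
  have h3 := gw_lt_ga k
  have h4 := ga_lt k
  have hu : 0 ≤ 2 * Real.pi * u := by positivity
  have hu' : 2 * Real.pi * u ≤ Real.pi := by nlinarith
  rw [hs, le_div_iff₀ (sin_ga_pos k)]
  -- By the addition formula, lying below the chord means having angular distance at least `gw d`
  -- from the centre of the removed arc.
  have e : Real.sin (2 * Real.pi * u) * Real.sin (ga d k) ≤
      Real.cos (gw d) - Real.cos (2 * Real.pi * u) * Real.cos (ga d k) ↔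
      Real.cos |2 * Real.pi * u - ga d k| ≤ Real.cos (gw d) := by
    rw [Real.cos_abs, Real.cos_sub]
    constructor <;> intro h <;> linarith
  rw [e, Real.strictAntiOn_cos.le_iff_ge ⟨abs_nonneg _, abs_le.2 ⟨by linarith, by linarith⟩⟩
    ⟨h2.le, by linarith⟩, le_abs']
  have e1 : ga d k - gw d = 2 * Real.pi * ((4 * k + 1) / (8 * d)) := by
    unfold ga gw; field_simp; ring
  have e2 : ga d k + gw d = 2 * Real.pi * ((4 * k + 3) / (8 * d)) := by
    unfold ga gw; field_simp; ring
  have h2p : 0 < 2 * Real.pi := by positivity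
  refine or_congr (Iff.trans ?_ (mul_le_mul_iff_right₀ h2p))
    (Iff.trans ?_ (mul_le_mul_iff_right₀ h2p))
  · rw [← e1]
    constructor <;> intro h <;> linarith
  · rw [← e2]
    constructor <;> intro h <;> linarith

end Ribbon
end

noncomputable section
namespace Ribbon
open Set Topology GenusSurface
variable {α β : Type}

/-! ### Words with alternating letters -/

/-- The word with sides `a 0, b 0, a 1, b 1, …, a n`. -/
def alt (a b : ℕ → Option (α × Bool)) : ℕ → Word α
  | 0 => [a 0]
  | n + 1 => alt a b n ++ [b n, a (n + 1)]

/-- The same with break points `B`. -/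
def altW (B : ℕ → ℝ) (a b : ℕ → Option (α × Bool)) : ℕ → WWord α
  | 0 => [(a 0, B 1 - B 0)]
  | n + 1 => altW B a b n ++
      [(b n, B (2 * n + 2) - B (2 * n + 1)), (a (n + 1), B (2 * n + 3) - B (2 * n + 2))]

theorem altW_map_fst (B : ℕ → ℝ) (a b : ℕ → Option (α × Bool)) (n : ℕ) :
    (altW B a b n).map Prod.fst = alt a b n := by
  induction n with
  | zero => rfl
  | succ n ih => simp [altW, alt, ih]

theorem len_altW (B : ℕ → ℝ) (a b : ℕ → Option (α × Bool)) (n : ℕ) :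
    len (altW B a b n) = B (2 * n + 1) - B 0 := by
  induction n with
  | zero => simp [altW]
  | succ n ih => simp only [altW, len_append, ih, len_cons, len_nil]; ring_nf

theorem pos_altW (B : ℕ → ℝ) (a b : ℕ → Option (α × Bool)) (n : ℕ)
    (h : ∀ i ≤ 2 * n, B i < B (i + 1)) : Pos (altW B a b n) := by
  induction n with
  | zero => simpa [altW, Pos] using h 0 le_rfl
  | succ n ih =>
    have h1 := h (2 * n + 1) (by omega)
    have h2 := h (2 * n + 2) (by omega)
    rw [altW, pos_append]
    refine ⟨ih fun i hi => h i (by omega), ?_⟩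
    simp only [Pos, List.mem_cons, List.not_mem_nil, or_false, forall_eq_or_imp, forall_eq]
    exact ⟨by linarith, by linarith⟩

theorem at_altW (B : ℕ → ℝ) (a b : ℕ → Option (α × Bool)) (n : ℕ) (x : α) (t u : ℝ) :
    At (altW B a b n) x t u ↔
      (∃ i ≤ n, ∃ ε, a i = some (x, ε) ∧
        u + B 0 = B (2 * i) + (B (2 * i + 1) - B (2 * i)) * dir ε t) ∨
      (∃ i < n, ∃ ε, b i = some (x, ε) ∧
        u + B 0 = B (2 * i + 1) + (B (2 * i + 2) - B (2 * i + 1)) * dir ε t) := by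
  induction n with
  | zero =>
    simp only [altW, At, or_false, Nat.le_zero, exists_eq_left, Nat.not_lt_zero, false_and,
      exists_false]
    refine exists_congr fun ε => and_congr_right fun _ => ?_
    constructor <;> intro h
    · rw [h]; ring
    · have : u = _ := eq_sub_of_add_eq h
      rw [this]; ring
  | succ n ih =>
    rw [altW, at_append, ih, len_altW]
    simp only [At, or_false, Nat.le_succ_iff, Nat.lt_succ_iff_lt_or_eq, or_and_right, exists_or,
      exists_eq_left, Nat.succ_eq_add_one]
    have e1 (ε : Bool) : (u - (B (2 * n + 1) - B 0) = (B (2 * n + 2) - B (2 * n + 1)) * dir ε t) ↔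
        (u + B 0 = B (2 * n + 1) + (B (2 * n + 2) - B (2 * n + 1)) * dir ε t) := by
      constructor <;> intro h <;> linarith
    have e2 (ε : Bool) : (u - (B (2 * n + 1) - B 0) - (B (2 * n + 2) - B (2 * n + 1)) =
        (B (2 * n + 3) - B (2 * n + 2)) * dir ε t) ↔
        (u + B 0 = B (2 * (n + 1)) + (B (2 * (n + 1) + 1) - B (2 * (n + 1))) * dir ε t) := by
      rw [show 2 * (n + 1) = 2 * n + 2 by ring, show 2 * n + 2 + 1 = 2 * n + 3 by ring]
      constructor <;> intro h <;> linarith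
    simp only [e1, e2]
    have aux (A B C D : Prop) : (A ∨ B) ∨ (C ∨ D) ↔ (A ∨ D) ∨ (B ∨ C) := by tauto
    exact aux _ _ _ _

/-- Intervals between break points alternate between two kinds of arcs, starting and ending with the
same kind. The even ones are what remains when the open odd ones are taken away. -/
theorem exists_mem_even_iff {B : ℕ → ℝ} (n : ℕ) (h : ∀ i ≤ 2 * n, B i < B (i + 1)) {v : ℝ}
    (h0 : B 0 ≤ v) (h1 : v ≤ B (2 * n + 1)) :
    (∃ i ≤ n, B (2 * i) ≤ v ∧ v ≤ B (2 * i + 1)) ↔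
      ∀ k < n, v ≤ B (2 * k + 1) ∨ B (2 * k + 2) ≤ v := by
  have mono : ∀ i j, i ≤ j → j ≤ 2 * n + 1 → B i ≤ B j := by
    intro i j hij
    induction j, hij using Nat.le_induction with
    | base => exact fun _ => le_rfl
    | succ j hij ih => exact fun hj => (ih (by omega)).trans (h j (by omega)).le
  constructor
  · rintro ⟨i, hi, h2, h3⟩ k hk
    rcases le_or_gt i k with h4 | h4
    · exact Or.inl (h3.trans (mono _ _ (by omega) (by omega)))
    · exact Or.inr ((mono _ _ (by omega) (by omega)).trans h2)
  · intro hv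
    clear mono
    induction n with
    | zero => exact ⟨0, le_rfl, h0, h1⟩
    | succ n ih =>
      rcases hv n (by omega) with h2 | h2
      · obtain ⟨i, hi, h3⟩ := ih (fun i hi => h i (by omega)) h2 fun k hk => hv k (by omega)
        exact ⟨i, by omega, h3⟩
      · exact ⟨n + 1, le_rfl, h2, h1⟩

theorem exists_param {p q v : ℝ} (h : p < q) (h1 : p ≤ v) (h2 : v ≤ q) :
    ∃ t ∈ Icc (0 : ℝ) 1, v = p + (q - p) * t := by
  have : 0 < q - p := by linarith
  refine ⟨(v - p) / (q - p), ⟨div_nonneg (by linarith) this.le,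
    (div_le_one this).2 (by linarith)⟩, by field_simp; ring⟩

theorem param_mem {p q t : ℝ} (h : p < q) (ht : t ∈ Icc (0 : ℝ) 1) :
    p ≤ p + (q - p) * t ∧ p + (q - p) * t ≤ q := by
  obtain ⟨h1, h2⟩ := ht
  constructor <;> nlinarith

/-! ### Break points -/

/-- Break points on the upper half circle. -/
def topB (d : ℕ) (i : ℕ) : ℝ :=
  -- The inner values are the ends `(4 k + 1) / (8 d)` and `(4 k + 3) / (8 d)` of the removed arcs,
  -- in turns.
  if i = 0 then 0 else if i = 2 * d + 1 then 1 / 2 else (2 * i - 1) / (8 * d)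

/-- Break points on the real axis. -/
def botX (g : ℕ) (i : ℕ) : ℝ :=
  -- The inner values are the left and right ends of the holes.
  if i = 0 then -1 else if i = 2 * g + 1 then 1 else (2 * i - 1) / (4 * g) - 1 / 2

/-- Break points on the lower half circle. -/
def botB (g : ℕ) (i : ℕ) : ℝ := 1 - Real.arccos (botX g i) / (2 * Real.pi)

theorem topB_zero (d : ℕ) : topB d 0 = 0 := by simp [topB]
theorem topB_last (d : ℕ) : topB d (2 * d + 1) = 1 / 2 := by simp [topB]
theorem topB_odd {d : ℕ} (k : Fin d) : topB d (2 * k + 1) = (4 * k + 1) / (8 * d) := by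
  have := k.2
  rw [topB, if_neg (by omega), if_neg (by omega)]; push_cast; congr 1; ring
theorem topB_even {d : ℕ} (k : Fin d) : topB d (2 * k + 2) = (4 * k + 3) / (8 * d) := by
  have := k.2
  rw [topB, if_neg (by omega), if_neg (by omega)]; push_cast; congr 1; ring
theorem botX_zero (d : ℕ) : botX d 0 = -1 := by simp [botX]
theorem botX_last (d : ℕ) : botX d (2 * d + 1) = 1 := by simp [botX]
theorem botX_odd {g : ℕ} (k : Fin g) : botX g (2 * k + 1) = hc g k - holeRadius g := by
  have := k.2
  have := gpos k
  rw [botX, if_neg (by omega), if_neg (by omega), hc, holeRadius]; push_cast; field_simp; ring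
theorem botX_even {g : ℕ} (k : Fin g) : botX g (2 * k + 2) = hc g k + holeRadius g := by
  have := k.2
  have := gpos k
  rw [botX, if_neg (by omega), if_neg (by omega), hc, holeRadius]; push_cast; field_simp; ring

theorem topB_lt (d : ℕ) : ∀ i ≤ 2 * d, topB d i < topB d (i + 1) := by
  intro i hi
  unfold topB
  rcases Nat.eq_zero_or_pos d with rfl | hd
  · obtain rfl : i = 0 := by omega
    norm_num
  have hd' : (0 : ℝ) < d := by exact_mod_cast hd
  have hi' : (i : ℝ) ≤ 2 * d := by exact_mod_cast hi
  rw [if_neg (show ¬ i + 1 = 0 by omega), if_neg (show ¬ i = 2 * d + 1 by omega)]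
  split_ifs with h1 h2 h2
  · norm_num
  · subst h1; push_cast; positivity
  · rw [div_lt_div_iff₀ (by positivity) (by norm_num)]; linarith
  · exact div_lt_div_of_pos_right (by push_cast; linarith) (by positivity)

theorem botX_lt (g : ℕ) : ∀ i ≤ 2 * g, botX g i < botX g (i + 1) := by
  intro i hi
  unfold botX
  rcases Nat.eq_zero_or_pos g with rfl | hd
  · obtain rfl : i = 0 := by omega
    norm_num
  have hd' : (0 : ℝ) < g := by exact_mod_cast hd
  have hi' : (i : ℝ) ≤ 2 * g := by exact_mod_cast hi
  rw [if_neg (show ¬ i + 1 = 0 by omega), if_neg (show ¬ i = 2 * g + 1 by omega)]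
  split_ifs with h1 h2 h2
  · norm_num
  · subst h1; push_cast
    have : (0 : ℝ) < (2 * (0 + 1) - 1) / (4 * g) := by positivity
    linarith
  · have : (2 * (i : ℝ) - 1) / (4 * g) < 1 := by rw [div_lt_one (by positivity)]; linarith
    linarith
  · have : (2 * (i : ℝ) - 1) / (4 * g) < (2 * ((i + 1 : ℕ) : ℝ) - 1) / (4 * g) :=
      div_lt_div_of_pos_right (by push_cast; linarith) (by positivity)
    linarith

theorem botX_mem (g : ℕ) : ∀ i ≤ 2 * g + 1, botX g i ∈ Icc (-1 : ℝ) 1 := by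
  have mono : ∀ i j, i ≤ j → j ≤ 2 * g + 1 → botX g i ≤ botX g j := by
    intro i j hij
    induction j, hij using Nat.le_induction with
    | base => exact fun _ => le_rfl
    | succ j hij ih => exact fun hj => (ih (by omega)).trans (botX_lt g j (by omega)).le
  intro i hi
  exact ⟨(botX_zero g).symm.trans_le (mono 0 i (by omega) hi),
    (mono i _ hi le_rfl).trans_eq (botX_last g)⟩

theorem botB_zero (g : ℕ) : botB g 0 = 1 / 2 := by
  have := Real.pi_ne_zero
  rw [botB, botX_zero, Real.arccos_neg_one]; field_simp; norm_num
theorem botB_last (g : ℕ) : botB g (2 * g + 1) = 1 := by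
  rw [botB, botX_last, Real.arccos_one]; simp

theorem botB_lt (g : ℕ) : ∀ i ≤ 2 * g, botB g i < botB g (i + 1) := by
  intro i hi
  have := Real.strictAntiOn_arccos (botX_mem g i (by omega)) (botX_mem g (i + 1) (by omega))
    (botX_lt g i hi)
  have := div_lt_div_of_pos_right this (show 0 < 2 * Real.pi by have := Real.pi_pos; positivity)
  unfold botB; linarith

/-- The height of a point on the lower half circle. -/
theorem arccos_cos_lower {u : ℝ} (h0 : 1 / 2 ≤ u) (h1 : u ≤ 1) :
    u = 1 - Real.arccos (Real.cos (2 * Real.pi * u)) / (2 * Real.pi) := by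
  have hp := Real.pi_pos
  rw [← Real.cos_two_pi_sub, Real.arccos_cos (by nlinarith) (by nlinarith)]
  field_simp; ring

theorem botB_le_iff {g i : ℕ} (hi : i ≤ 2 * g + 1) {u : ℝ} (h0 : 1 / 2 ≤ u) (h1 : u ≤ 1) :
    botB g i ≤ u ↔ botX g i ≤ Real.cos (2 * Real.pi * u) := by
  have h2 : 0 < 2 * Real.pi := by have := Real.pi_pos; positivity
  rw [← Real.strictAntiOn_arccos.le_iff_ge (Real.cos_mem_Icc _) (botX_mem g i hi)]
  refine Iff.trans ?_ (div_le_div_iff_of_pos_right h2)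
  have := arccos_cos_lower h0 h1
  unfold botB
  constructor <;> intro h <;> linarith

theorem le_botB_iff {g i : ℕ} (hi : i ≤ 2 * g + 1) {u : ℝ} (h0 : 1 / 2 ≤ u) (h1 : u ≤ 1) :
    u ≤ botB g i ↔ Real.cos (2 * Real.pi * u) ≤ botX g i := by
  have h2 : 0 < 2 * Real.pi := by have := Real.pi_pos; positivity
  rw [← Real.strictAntiOn_arccos.le_iff_ge (botX_mem g i hi) (Real.cos_mem_Icc _)]
  refine Iff.trans ?_ (div_le_div_iff_of_pos_right h2)
  have := arccos_cos_lower h0 h1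
  unfold botB
  constructor <;> intro h <;> linarith

end Ribbon
end

noncomputable section
namespace Ribbon
open Set Topology GenusSurface
variable {α β : Type}

/-! ### Charts -/

theorem Disc.abs_re_le (z : Disc) : |(z : ℂ).re| ≤ 1 := (Complex.abs_re_le_norm _).trans z.norm_le

theorem hgt_nonneg (z : Disc) : 0 ≤ hgt z := Real.sqrt_nonneg _

theorem hgt_eq_zero {z : Disc} (h : hgt z = 0) : |(z : ℂ).re| = 1 := by
  rw [hgt, Real.sqrt_eq_zero'] at h
  refine le_antisymm z.abs_re_le ?_
  rw [← one_le_sq_iff_one_le_abs]; linarith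

/-- Relative height of a point of the disc, between `0` and `1`. -/
def relHgt (z : Disc) : ℝ := ((z : ℂ).im / hgt z + 1) / 2

theorem relHgt_mem (z : Disc) : relHgt z ∈ Icc (0 : ℝ) 1 := by
  have h : |(z : ℂ).im / hgt z| ≤ 1 := by
    rw [abs_div, abs_of_nonneg (hgt_nonneg z)]
    exact div_le_one_of_le₀ z.abs_im_le (hgt_nonneg z)
  obtain ⟨h1, h2⟩ := abs_le.1 h
  constructor <;> unfold relHgt <;> linarith

/-- The height at which a chart puts a point of the disc. -/
def chartY (g d : ℕ) (z : Disc) : ℝ :=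
  bump g (z : ℂ).re + (lid d (z : ℂ).re - bump g (z : ℂ).re) * relHgt z

theorem bump_le_chartY (g d : ℕ) (z : Disc) : bump g (z : ℂ).re ≤ chartY g d z := by
  have := mul_nonneg (sub_nonneg.2 (bump_le_lid (g := g) (d := d) z.abs_re_le)) (relHgt_mem z).1
  unfold chartY; linarith

theorem chartY_le_lid (g d : ℕ) (z : Disc) : chartY g d z ≤ lid d (z : ℂ).re := by
  have := mul_le_of_le_one_right (sub_nonneg.2 (bump_le_lid (g := g) (d := d) z.abs_re_le))
    (relHgt_mem z).2
  unfold chartY; linarith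

theorem chartY_nonneg (g d : ℕ) (z : Disc) : 0 ≤ chartY g d z :=
  (bump_nonneg _ _).trans (bump_le_chartY g d z)

theorem im_eq_zero_of_hgt {z : Disc} (h : hgt z = 0) : (z : ℂ).im = 0 := by
  have := z.abs_im_le
  rw [h] at this
  exact abs_nonpos_iff.1 this

/-- For `|x| < 1` the vertical segment of the disc over `x` goes affinely onto the segment from
`bump` to `lid`, which is nondegenerate. Over `x = 1` and `x = -1` both segments are points. -/
theorem chartY_inj {g d : ℕ} {z w : Disc} (h : (z : ℂ).re = (w : ℂ).re)
    (h' : chartY g d z = chartY g d w) : z = w := by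
  have hh : hgt z = hgt w := by unfold hgt; rw [h]
  refine Disc.ext' h ?_
  rcases eq_or_ne (hgt z) 0 with h0 | h0
  · rw [im_eq_zero_of_hgt h0, im_eq_zero_of_hgt (hh ▸ h0)]
  · have h1 : |(z : ℂ).re| < 1 := by
      refine lt_of_le_of_ne z.abs_re_le fun h1 => h0 ?_
      rw [hgt, ← sq_abs, h1]; norm_num
    have h2 := bump_lt_lid (g := g) (d := d) h1
    unfold chartY at h'
    rw [← h] at h'
    have h3 : relHgt z = relHgt w :=
      mul_left_cancel₀ (sub_ne_zero.2 h2.ne') (add_left_cancel h')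
    unfold relHgt at h3
    rw [← hh] at h3
    field_simp at h3
    linarith

theorem exists_chartY {g d : ℕ} {x y : ℝ} (hx : |x| ≤ 1) (h1 : bump g x ≤ y) (h2 : y ≤ lid d x) :
    ∃ z : Disc, (z : ℂ).re = x ∧ chartY g d z = y := by
  have hx2 := (sq_le_one_iff_abs_le_one x).2 hx
  have hs := Real.sq_sqrt (show 0 ≤ 1 - x ^ 2 by linarith)
  have hs0 := Real.sqrt_nonneg (1 - x ^ 2)
  have key (y' : ℝ) (hy' : |y'| ≤ Real.sqrt (1 - x ^ 2)) :
      (⟨x, y'⟩ : ℂ) ∈ Metric.closedBall (0 : ℂ) 1 := by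
    rw [mem_closedBall_zero_iff, ← sq_le_one_iff₀ (norm_nonneg _), Complex.sq_norm,
      Complex.normSq_apply]
    have := sq_le_sq' (abs_le.1 hy').1 (abs_le.1 hy').2
    simp only; nlinarith
  rcases hx.lt_or_eq with h | h
  · have hlt := bump_lt_lid (g := g) (d := d) h
    have hpos : 0 < Real.sqrt (1 - x ^ 2) :=
      Real.sqrt_pos.2 (by linarith [(sq_lt_one_iff_abs_lt_one x).2 h])
    have hl : 0 < lid d x - bump g x := by linarith
    have hq0 : 0 ≤ (y - bump g x) / (lid d x - bump g x) := div_nonneg (by linarith) hl.le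
    have hq1 : (y - bump g x) / (lid d x - bump g x) ≤ 1 := (div_le_one hl).2 (by linarith)
    refine ⟨⟨_, key ((2 * ((y - bump g x) / (lid d x - bump g x)) - 1) *
      Real.sqrt (1 - x ^ 2)) ?_⟩, rfl, ?_⟩
    · rw [abs_mul, abs_of_nonneg hs0]
      exact mul_le_of_le_one_left hs0 (abs_le.2 ⟨by linarith, by linarith⟩)
    · simp only [chartY, relHgt, hgt]
      rw [mul_div_cancel_right₀ _ hpos.ne']
      field_simp; ring
  · have e1 := bump_of_abs_eq_one (g := g) h
    have e2 := lid_of_abs_eq_one (d := d) h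
    refine ⟨⟨_, key 0 (by simp)⟩, rfl, ?_⟩
    simp only [chartY, e1, e2]
    linarith

theorem chartY_eq_lid {g d : ℕ} {z : Disc} (h : (z : ℂ).im = hgt z) :
    chartY g d z = lid d (z : ℂ).re := by
  rcases eq_or_ne (hgt z) 0 with h0 | h0
  · have := hgt_eq_zero h0
    simp [chartY, lid_of_abs_eq_one this, bump_of_abs_eq_one this]
  · rw [chartY, relHgt, h, div_self h0]; ring

theorem chartY_eq_bump {g d : ℕ} {z : Disc} (h : (z : ℂ).im = -hgt z) :
    chartY g d z = bump g (z : ℂ).re := by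
  rcases eq_or_ne (hgt z) 0 with h0 | h0
  · have := hgt_eq_zero h0
    simp [chartY, lid_of_abs_eq_one this, bump_of_abs_eq_one this]
  · rw [chartY, relHgt, h, neg_div, div_self h0]; ring

/-- The point of the upper half circle above `x`. -/
theorem exists_rim_upper {x : ℝ} (hx : |x| ≤ 1) : ∃ u, 0 ≤ u ∧ u ≤ 1 / 2 ∧
    Real.cos (2 * Real.pi * u) = x ∧ (rim u : ℂ).im = Real.sqrt (1 - x ^ 2) := by
  have hp := Real.pi_pos
  have e : 2 * Real.pi * (Real.arccos x / (2 * Real.pi)) = Real.arccos x := by field_simp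
  refine ⟨Real.arccos x / (2 * Real.pi), div_nonneg (Real.arccos_nonneg x) (by positivity), ?_, ?_, ?_⟩
  · rw [div_le_div_iff₀ (by positivity) (by norm_num)]; linarith [Real.arccos_le_pi x]
  · rw [e, Real.cos_arccos (abs_le.1 hx).1 (abs_le.1 hx).2]
  · change (circ _).im = _
    rw [circ_im, e, Real.sin_arccos]

theorem rim_re (u : ℝ) : (rim u : ℂ).re = Real.cos (2 * Real.pi * u) := circ_re u

theorem exists_upper {z : Disc} (h : (z : ℂ).im = hgt z) : ∃ u, 0 ≤ u ∧ u ≤ 1 / 2 ∧ z = rim u := by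
  obtain ⟨u, h0, h1, h2, h3⟩ := exists_rim_upper z.abs_re_le
  exact ⟨u, h0, h1, Disc.ext' (by rw [rim_re, h2]) (by rw [h3, h]; rfl)⟩

theorem exists_lower {z : Disc} (h : (z : ℂ).im = -hgt z) :
    ∃ u, 1 / 2 ≤ u ∧ u ≤ 1 ∧ z = rim u := by
  obtain ⟨u, h0, h1, h2, h3⟩ := exists_rim_upper z.abs_re_le
  have h4 : (rim u : ℂ).im = Real.sin (2 * Real.pi * u) := circ_im u
  have h5 : (rim (1 - u) : ℂ).im = Real.sin (2 * Real.pi * (1 - u)) := circ_im _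
  rw [mul_sub, mul_one] at h5
  refine ⟨1 - u, by linarith, by linarith, Disc.ext' ?_ ?_⟩
  · rw [rim_re, mul_sub, mul_one, Real.cos_two_pi_sub, h2]
  · rw [h5, Real.sin_two_pi_sub, ← h4, h3, h]; rfl

theorem rim_upper {u : ℝ} (h0 : 0 ≤ u) (h1 : u ≤ 1 / 2) : (rim u : ℂ).im = hgt (rim u) := by
  have := rim_im_nonneg (u := 2 * u) (by linarith) (by linarith)
  rw [show 2 * u / 2 = u by ring] at this
  rw [hgt_rim, abs_of_nonneg this]

theorem rim_lower {u : ℝ} (h0 : 1 / 2 ≤ u) (h1 : u ≤ 1) : (rim u : ℂ).im = -hgt (rim u) := by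
  have := rim_im_nonpos (u := 2 * u) (by linarith) (by linarith)
  rw [show 2 * u / 2 = u by ring] at this
  rw [hgt_rim, abs_of_nonpos this, neg_neg]

theorem im_eq_hgt {g d : ℕ} {z : Disc} (h : chartY g d z = lid d (z : ℂ).re) :
    (z : ℂ).im = hgt z := by
  obtain ⟨u, h0, h1, h2, h3⟩ := exists_rim_upper z.abs_re_le
  have h4 := rim_upper h0 h1
  have h5 : (z : ℂ).re = (rim u : ℂ).re := by rw [rim_re, h2]
  have : z = rim u := chartY_inj h5 (h.trans (by rw [chartY_eq_lid h4, h5]))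
  rwa [← this] at h4

theorem im_eq_neg_hgt {g d : ℕ} {z : Disc} (h : chartY g d z = bump g (z : ℂ).re) :
    (z : ℂ).im = -hgt z := by
  have h0 : 0 ≤ 1 - (z : ℂ).re ^ 2 := by nlinarith [z.sq_le]
  have hm : (⟨(z : ℂ).re, -hgt z⟩ : ℂ) ∈ Metric.closedBall (0 : ℂ) 1 := by
    rw [mem_closedBall_zero_iff, ← sq_le_one_iff₀ (norm_nonneg _), Complex.sq_norm,
      Complex.normSq_apply]
    have := Real.sq_sqrt h0
    simp only [hgt]; nlinarith
  have : z = ⟨_, hm⟩ := chartY_inj (g := g) (d := d) rfl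
    (h.trans (chartY_eq_bump (z := ⟨_, hm⟩) rfl).symm)
  exact congrArg (fun w : Disc => (w : ℂ).im) this

/-- The relative height has no limit at the points `1` and `-1`, where division by zero gives it the
value `1 / 2`. It stays bounded, however, and its factor `lid - bump` tends to zero there. -/
theorem continuous_chartY (g d : ℕ) : Continuous (chartY g d) := by
  have hre : Continuous fun z : Disc => (z : ℂ).re := by fun_prop
  have him : Continuous fun z : Disc => (z : ℂ).im := by fun_prop
  have hb := (continuous_bump g).comp hre
  have hl := ((continuous_lid d).comp hre).sub hb
  refine hb.add (continuous_iff_continuousAt.2 fun z => ?_)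
  by_cases h0 : hgt z = 0
  · have h1 := hgt_eq_zero h0
    have e : (lid d (z : ℂ).re - bump g (z : ℂ).re) = 0 := by
      rw [lid_of_abs_eq_one h1, bump_of_abs_eq_one h1, sub_zero]
    have hl' := hl.continuousAt (x := z)
    rw [ContinuousAt] at hl' ⊢
    simp only [Pi.sub_apply, Function.comp_apply, e, zero_mul] at hl' ⊢
    refine squeeze_zero (fun w => ?_) (fun w => ?_) hl'
    · exact mul_nonneg (sub_nonneg.2 (bump_le_lid w.abs_re_le)) (relHgt_mem w).1
    · exact mul_le_of_le_one_right (sub_nonneg.2 (bump_le_lid w.abs_re_le)) (relHgt_mem w).2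
  · exact hl.continuousAt.mul
      (((him.continuousAt.div continuous_hgt.continuousAt h0).add continuousAt_const).div_const 2)

theorem chartY_eq_zero_iff {g d : ℕ} {z : Disc} : chartY g d z = 0 ↔
    (z : ℂ).im = -hgt z ∧ bump g (z : ℂ).re = 0 := by
  constructor
  · intro h
    have h0 : bump g (z : ℂ).re = 0 :=
      le_antisymm ((bump_le_chartY g d z).trans_eq h) (bump_nonneg _ _)
    exact ⟨im_eq_neg_hgt (h.trans h0.symm), h0⟩
  · rintro ⟨h, h'⟩; rw [chartY_eq_bump h, h']

theorem profile_chart_iff {g d : ℕ} {z : Disc} : profile g ⟨(z : ℂ).re, chartY g d z⟩ = 0 ↔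
    (z : ℂ).im = hgt z ∧ lid d (z : ℂ).re = lid 0 (z : ℂ).re ∨
      (z : ℂ).im = -hgt z ∧ ∃ j : Fin g,
        hc g j - holeRadius g ≤ (z : ℂ).re ∧ (z : ℂ).re ≤ hc g j + holeRadius g := by
  rw [profile_eq_zero_iff z.abs_re_le (bump_le_chartY g d z) (chartY_le_lid g d z)]
  exact or_congr (and_congr_left fun _ => ⟨im_eq_hgt, chartY_eq_lid⟩)
    (and_congr_left fun _ => ⟨im_eq_neg_hgt, chartY_eq_bump⟩)

/-- A sign. -/
def sg (b : Bool) : ℝ := if b then 1 else -1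

/-- The number of removed discs on either side of the real axis. -/
def nd (d : ℕ) (τ : Bool) : ℕ := if τ then d else 0

/-- The four charts. -/
def chart (g d : ℕ) (τ σ : Bool) (z : Disc) : surface g d :=
  ⟨(⟨(z : ℂ).re, sg τ * chartY g (nd d τ) z⟩,
    sg σ * Real.sqrt (profile g ⟨(z : ℂ).re, chartY g (nd d τ) z⟩)), by
    have h0 := chartY_nonneg g (nd d τ) z
    have h1 := bump_le_chartY g (nd d τ) z
    have h2 := chartY_le_lid g (nd d τ) z
    have h3 := profile_nonneg z.abs_re_le h1 h2
    have h4 : (sg σ * Real.sqrt (profile g ⟨(z : ℂ).re, chartY g (nd d τ) z⟩)) ^ 2 =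
        profile g ⟨(z : ℂ).re, chartY g (nd d τ) z⟩ := by
      rw [mul_pow, Real.sq_sqrt h3]; cases σ <;> simp [sg]
    cases τ
    · simp only [sg, Bool.false_eq_true, if_false, neg_mul, one_mul] at *
      exact (lower_iff h0).2 ⟨z.abs_re_le, h1, h2, by rw [profile_neg]; exact h4⟩
    · simp only [sg, if_true, one_mul] at *
      exact (upper_iff h0).2 ⟨z.abs_re_le, h1, h2, h4⟩⟩

theorem continuous_chart (g d : ℕ) (τ σ : Bool) : Continuous (chart g d τ σ) := by
  refine Continuous.subtype_mk ?_ _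
  have hY := continuous_chartY g (nd d τ)
  have hre : Continuous fun z : Disc => (z : ℂ).re := by fun_prop
  refine Continuous.prodMk ?_ (continuous_const.mul (Continuous.sqrt ?_))
  · simp only [Complex.mk_eq_add_mul_I]
    fun_prop
  · simp only [profile_eq]
    fun_prop

theorem exists_chart {g d : ℕ} (p : surface g d) : ∃ τ σ z, chart g d τ σ z = p := by
  obtain ⟨⟨⟨x, y⟩, t⟩, hp⟩ := p
  have key (y' t P : ℝ) (h : t ^ 2 = P) : ∃ σ, sg σ * Real.sqrt P = t := by
    rcases le_total 0 t with h0 | h0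
    · exact ⟨true, by rw [← h, Real.sqrt_sq h0]; simp [sg]⟩
    · exact ⟨false, by rw [← h, Real.sqrt_sq_eq_abs, abs_of_nonpos h0]; simp [sg]⟩
  rcases le_total 0 y with hy | hy
  · obtain ⟨h1, h2, h3, h4⟩ := (upper_iff hy).1 hp
    obtain ⟨z, hz, hz'⟩ := exists_chartY h1 h2 h3
    obtain ⟨σ, hσ⟩ := key y t _ h4
    refine ⟨true, σ, z, Subtype.ext ?_⟩
    simp only [chart, nd, if_true, hz, hz', hσ]
    simp [sg]
  · obtain ⟨y, rfl⟩ : ∃ y', y = -y' := ⟨-y, by ring⟩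
    obtain ⟨h1, h2, h3, h4⟩ := (lower_iff (neg_nonpos.1 hy)).1 hp
    rw [profile_neg] at h4
    obtain ⟨z, hz, hz'⟩ := exists_chartY h1 h2 h3
    obtain ⟨σ, hσ⟩ := key y t _ h4
    refine ⟨false, σ, z, Subtype.ext ?_⟩
    simp only [chart, nd, Bool.false_eq_true, if_false, hz, hz', hσ]
    simp [sg]

/-- The position of a point on the boundary word. -/
def seg (B : ℕ → ℝ) (i : ℕ) (t : ℝ) : ℝ := B i + (B (i + 1) - B i) * t

/-- The boundary word of a chart. -/
def chartWord (g d o k r : ℕ) : WWord (ℕ × ℕ) :=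
  -- Label families: `o` for the surviving arcs of the unit circle, `r` for segments of the real
  -- axis, `k` for the halves of the holes. The chords are unlabelled, as they bound the surface.
  altW (topB d) (fun i => some ((o, i), true)) (fun _ => none) d ++
    altW (botB g) (fun i => some ((r, i), true)) (fun i => some ((k, i), true)) g

theorem len_chartWord (g d o k r : ℕ) : len (chartWord g d o k r) = 1 := by
  rw [chartWord, len_append, len_altW, len_altW, topB_zero, topB_last, botB_zero, botB_last]
  norm_num

theorem pos_chartWord (g d o k r : ℕ) : Pos (chartWord g d o k r) :=
  pos_append.2 ⟨pos_altW _ _ _ _ (topB_lt d), pos_altW _ _ _ _ (botB_lt g)⟩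

theorem at_chartWord {g d o k r : ℕ} {x : ℕ × ℕ} {t u : ℝ} : At (chartWord g d o k r) x t u ↔
    (∃ i ≤ d, x = (o, i) ∧ u = seg (topB d) (2 * i) t) ∨
    (∃ i ≤ g, x = (r, i) ∧ u = seg (botB g) (2 * i) t) ∨
    (∃ i < g, x = (k, i) ∧ u = seg (botB g) (2 * i + 1) t) := by
  rw [chartWord, at_append, at_altW, at_altW, len_altW, topB_zero, topB_last, botB_zero]
  simp only [Option.some.injEq, Prod.mk.injEq, reduceCtorEq, false_and, exists_false, and_false,
    or_false, add_zero, sub_zero, sub_add_cancel, seg]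
  have e (p : ℕ × ℕ) (P : Bool → Prop) : (∃ ε, (p = x ∧ true = ε) ∧ P ε) ↔ x = p ∧ P true :=
    ⟨fun ⟨ε, ⟨h, h'⟩, h''⟩ => ⟨h.symm, h' ▸ h''⟩, fun ⟨h, h'⟩ => ⟨true, ⟨h.symm, rfl⟩, h'⟩⟩
  simp only [e, dir, if_true]

theorem seg_mem {B : ℕ → ℝ} {i : ℕ} (h : B i < B (i + 1)) {t : ℝ} (ht : t ∈ Icc (0 : ℝ) 1) :
    B i ≤ seg B i t ∧ seg B i t ≤ B (i + 1) := param_mem h ht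

theorem mono_of_lt {B : ℕ → ℝ} {n : ℕ} (h : ∀ i ≤ 2 * n, B i < B (i + 1)) :
    ∀ i j, i ≤ j → j ≤ 2 * n + 1 → B i ≤ B j := by
  intro i j hij
  induction j, hij using Nat.le_induction with
  | base => exact fun _ => le_rfl
  | succ j hij ih => exact fun hj => (ih (by omega)).trans (h j (by omega)).le

theorem seg_top_mem {d i : ℕ} (hi : i ≤ 2 * d) {t : ℝ} (ht : t ∈ Icc (0 : ℝ) 1) :
    0 ≤ seg (topB d) i t ∧ seg (topB d) i t ≤ 1 / 2 := by
  obtain ⟨h1, h2⟩ := seg_mem (topB_lt d i hi) ht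
  have := mono_of_lt (topB_lt d) 0 i (by omega) (by omega)
  have := mono_of_lt (topB_lt d) (i + 1) _ (by omega) le_rfl
  rw [topB_zero] at *
  rw [topB_last] at *
  exact ⟨by linarith, by linarith⟩

theorem seg_bot_mem {g i : ℕ} (hi : i ≤ 2 * g) {t : ℝ} (ht : t ∈ Icc (0 : ℝ) 1) :
    1 / 2 ≤ seg (botB g) i t ∧ seg (botB g) i t ≤ 1 := by
  obtain ⟨h1, h2⟩ := seg_mem (botB_lt g i hi) ht
  have := mono_of_lt (botB_lt g) 0 i (by omega) (by omega)
  have := mono_of_lt (botB_lt g) (i + 1) _ (by omega) le_rfl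
  rw [botB_zero] at *
  rw [botB_last] at *
  exact ⟨by linarith, by linarith⟩

/-- The geometric condition that the circle is not cut by a chord is translated into lying on an
edge labelled `o`. -/
theorem lid_iff_seg {d : ℕ} {u : ℝ} (h0 : 0 ≤ u) (h1 : u ≤ 1 / 2) :
    lid d (Real.cos (2 * Real.pi * u)) = lid 0 (Real.cos (2 * Real.pi * u)) ↔
      ∃ i ≤ d, ∃ t ∈ Icc (0 : ℝ) 1, u = seg (topB d) (2 * i) t := by
  have e : (∃ i ≤ d, ∃ t ∈ Icc (0 : ℝ) 1, u = seg (topB d) (2 * i) t) ↔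
      ∃ i ≤ d, topB d (2 * i) ≤ u ∧ u ≤ topB d (2 * i + 1) := by
    refine exists_congr fun i => and_congr_right fun hi => ⟨?_, ?_⟩
    · rintro ⟨t, ht, rfl⟩; exact seg_mem (topB_lt d _ (by omega)) ht
    · rintro ⟨h2, h3⟩; exact exists_param (topB_lt d _ (by omega)) h2 h3
  rw [lid_eq_iff h0 h1, e, exists_mem_even_iff d (topB_lt d) (h0.trans_eq' (topB_zero d))
    (h1.trans_eq (topB_last d).symm)]
  constructor
  · intro h k hk
    rw [topB_odd ⟨k, hk⟩, topB_even ⟨k, hk⟩]; exact h ⟨k, hk⟩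
  · intro h k
    rw [← topB_odd, ← topB_even]; exact h k k.2

theorem bump_iff_seg {g : ℕ} {u : ℝ} (h0 : 1 / 2 ≤ u) (h1 : u ≤ 1) :
    bump g (Real.cos (2 * Real.pi * u)) = 0 ↔
      ∃ i ≤ g, ∃ t ∈ Icc (0 : ℝ) 1, u = seg (botB g) (2 * i) t := by
  have e : (∃ i ≤ g, ∃ t ∈ Icc (0 : ℝ) 1, u = seg (botB g) (2 * i) t) ↔
      ∃ i ≤ g, botB g (2 * i) ≤ u ∧ u ≤ botB g (2 * i + 1) := by
    refine exists_congr fun i => and_congr_right fun hi => ⟨?_, ?_⟩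
    · rintro ⟨t, ht, rfl⟩; exact seg_mem (botB_lt g _ (by omega)) ht
    · rintro ⟨h2, h3⟩; exact exists_param (botB_lt g _ (by omega)) h2 h3
  rw [bump_eq_zero_iff, e, exists_mem_even_iff g (botB_lt g) (h0.trans_eq' (botB_zero g).symm)
    (h1.trans_eq (botB_last g).symm)]
  constructor
  · intro h k hk
    rw [le_botB_iff (by omega) h0 h1, botB_le_iff (by omega) h0 h1,
      botX_odd ⟨k, hk⟩, botX_even ⟨k, hk⟩]; exact h ⟨k, hk⟩
  · intro h k
    have := k.2
    rw [← botX_odd, ← botX_even, ← le_botB_iff (by omega) h0 h1, ← botB_le_iff (by omega) h0 h1]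
    exact h k k.2

theorem hole_iff_seg {g : ℕ} {u : ℝ} (h0 : 1 / 2 ≤ u) (h1 : u ≤ 1) :
    (∃ j : Fin g, hc g j - holeRadius g ≤ Real.cos (2 * Real.pi * u) ∧
      Real.cos (2 * Real.pi * u) ≤ hc g j + holeRadius g) ↔
      ∃ i < g, ∃ t ∈ Icc (0 : ℝ) 1, u = seg (botB g) (2 * i + 1) t := by
  constructor
  · rintro ⟨j, h2, h3⟩
    have := j.2
    rw [← botX_odd, ← botB_le_iff (by omega) h0 h1] at h2
    rw [← botX_even, ← le_botB_iff (by omega) h0 h1] at h3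
    exact ⟨j, j.2, exists_param (botB_lt g (2 * j + 1) (by omega)) h2 h3⟩
  · rintro ⟨i, hi, t, ht, rfl⟩
    obtain ⟨h2, h3⟩ := seg_mem (botB_lt g (2 * i + 1) (by omega)) ht
    refine ⟨⟨i, hi⟩, ?_, ?_⟩
    · rw [← botX_odd, ← botB_le_iff (by simp only; omega) h0 h1]; exact h2
    · rw [← botX_even, ← le_botB_iff (by simp only; omega) h0 h1]; exact h3

end Ribbon
end

/-! ### The surface as four glued polygons -/

noncomputable section
namespace Ribbon
open Set Topology GenusSurface
variable {α β : Type}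

theorem profile_chart_iff_at {g d : ℕ} {z : Disc} :
    profile g ⟨(z : ℂ).re, chartY g d z⟩ = 0 ↔ ∃ u, z = rim u ∧ ∃ t ∈ Icc (0 : ℝ) 1, ∃ i,
      (i ≤ d ∧ u = seg (topB d) (2 * i) t ∨ i < g ∧ u = seg (botB g) (2 * i + 1) t) := by
  rw [profile_chart_iff]
  constructor
  · rintro (⟨h, h'⟩ | ⟨h, h'⟩)
    · obtain ⟨u, h0, h1, rfl⟩ := exists_upper h
      rw [rim_re, lid_iff_seg h0 h1] at h'
      obtain ⟨i, hi, t, ht, h2⟩ := h'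
      exact ⟨u, rfl, t, ht, i, Or.inl ⟨hi, h2⟩⟩
    · obtain ⟨u, h0, h1, rfl⟩ := exists_lower h
      rw [rim_re, hole_iff_seg h0 h1] at h'
      obtain ⟨i, hi, t, ht, h2⟩ := h'
      exact ⟨u, rfl, t, ht, i, Or.inr ⟨hi, h2⟩⟩
  · rintro ⟨u, rfl, t, ht, i, ⟨hi, rfl⟩ | ⟨hi, rfl⟩⟩
    · obtain ⟨h0, h1⟩ := seg_top_mem (d := d) (i := 2 * i) (by omega) ht
      rw [rim_re]
      exact Or.inl ⟨rim_upper h0 h1, (lid_iff_seg h0 h1).2 ⟨i, hi, t, ht, rfl⟩⟩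
    · obtain ⟨h0, h1⟩ := seg_bot_mem (g := g) (i := 2 * i + 1) (by omega) ht
      rw [rim_re]
      exact Or.inr ⟨rim_lower h0 h1, (hole_iff_seg h0 h1).2 ⟨i, hi, t, ht, rfl⟩⟩

theorem chartY_eq_zero_iff_at {g d : ℕ} {z : Disc} :
    chartY g d z = 0 ↔ ∃ u, z = rim u ∧ ∃ t ∈ Icc (0 : ℝ) 1, ∃ i ≤ g,
      u = seg (botB g) (2 * i) t := by
  rw [chartY_eq_zero_iff]
  constructor
  · rintro ⟨h, h'⟩
    obtain ⟨u, h0, h1, rfl⟩ := exists_lower h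
    rw [rim_re, bump_iff_seg h0 h1] at h'
    obtain ⟨i, hi, t, ht, h2⟩ := h'
    exact ⟨u, rfl, t, ht, i, hi, h2⟩
  · rintro ⟨u, rfl, t, ht, i, hi, rfl⟩
    obtain ⟨h0, h1⟩ := seg_bot_mem (g := g) (i := 2 * i) (by omega) ht
    rw [rim_re]
    exact ⟨rim_lower h0 h1, (bump_iff_seg h0 h1).2 ⟨i, hi, t, ht, rfl⟩⟩

/-- The boundary words of the four charts. -/
def quarterWord (g d : ℕ) (τ σ : Bool) : WWord (ℕ × ℕ) :=
  -- Arcs on the circle and on the holes join the two sheets of one half, so their labels depend on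
  -- `τ` only; segments of the real axis join the two halves of one sheet, so theirs depend on `σ`
  -- only.
  chartWord g (nd d τ) (if τ then 0 else 1) (if τ then 2 else 3) (if σ then 4 else 5)

/-- The scheme consisting of the four charts. -/
@[reducible] def quarters (g d : ℕ) : Scheme (ℕ × ℕ) :=
  (poly (quarterWord g d true true)).sum ((poly (quarterWord g d false true)).sum
    ((poly (quarterWord g d true false)).sum (poly (quarterWord g d false false))))

/-- A point of one of the charts. -/
def inQ (g d : ℕ) : Bool → Bool → Disc → (quarters g d).carrier
  | true, true, z => Sum.inl z
  | false, true, z => Sum.inr (Sum.inl z)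
  | true, false, z => Sum.inr (Sum.inr (Sum.inl z))
  | false, false, z => Sum.inr (Sum.inr (Sum.inr z))

theorem exists_inQ {g d : ℕ} (x : (quarters g d).carrier) : ∃ τ σ z, inQ g d τ σ z = x := by
  rcases x with x | x | x | x
  exacts [⟨true, true, x, rfl⟩, ⟨false, true, x, rfl⟩, ⟨true, false, x, rfl⟩, ⟨false, false, x, rfl⟩]

theorem edge_inQ {g d : ℕ} {a : ℕ × ℕ} {t : ℝ} {τ σ : Bool} {z : Disc} :
    (quarters g d).edge a t (inQ g d τ σ z) ↔ t ∈ Icc (0 : ℝ) 1 ∧ ∃ u, z = rim u ∧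
      At (quarterWord g d τ σ) a t u := by
  have : (quarters g d).edge a t (inQ g d τ σ z) ↔ (poly (quarterWord g d τ σ)).edge a t z := by
    cases τ <;> cases σ <;> exact Iff.rfl
  rw [this]
  simp only [quarterWord, len_chartWord, div_one, and_comm]

/-- The map from the charts to the surface. -/
def quarterMap (g d : ℕ) : (quarters g d).carrier → surface g d :=
  Sum.elim (chart g d true true) (Sum.elim (chart g d false true)
    (Sum.elim (chart g d true false) (chart g d false false)))

theorem quarterMap_inQ (g d : ℕ) (τ σ : Bool) (z : Disc) :
    quarterMap g d (inQ g d τ σ z) = chart g d τ σ z := by cases τ <;> cases σ <;> rfl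

theorem chart_eq_of_profile {g d : ℕ} {τ : Bool} {z : Disc}
    (h : profile g ⟨(z : ℂ).re, chartY g (nd d τ) z⟩ = 0) (σ σ' : Bool) :
    chart g d τ σ z = chart g d τ σ' z := by
  simp [chart, h]

theorem chart_eq_of_chartY {g d : ℕ} {τ τ' : Bool} {z : Disc} (h : chartY g (nd d τ) z = 0)
    (h' : chartY g (nd d τ') z = 0) (σ : Bool) : chart g d τ σ z = chart g d τ' σ z := by
  simp [chart, h, h']

theorem quarterMap_glue (g d : ℕ) (a : ℕ × ℕ) (t : ℝ) (x y : (quarters g d).carrier)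
    (hx : (quarters g d).edge a t x) (hy : (quarters g d).edge a t y) :
    quarterMap g d x = quarterMap g d y := by
  obtain ⟨τ, σ, z, rfl⟩ := exists_inQ x
  obtain ⟨τ', σ', z', rfl⟩ := exists_inQ y
  rw [quarterMap_inQ, quarterMap_inQ]
  obtain ⟨ht, u, rfl, hu⟩ := edge_inQ.1 hx
  obtain ⟨-, u', rfl, hu'⟩ := edge_inQ.1 hy
  -- The pairs `0, 1`, `2, 3` and `4, 5` of first components distinguish the kinds of edges, and
  -- within a pair they determine `τ` or `σ`.
  have hτ : ∀ {p q : Bool}, (if p then 0 else 1) = (if q then 0 else 1) → p = q := by decide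
  have hτ2 : ∀ {p q : Bool}, (if p then 2 else 3) = (if q then 2 else 3) → p = q := by decide
  have hσ : ∀ {p q : Bool}, (if p then 4 else 5) = (if q then 4 else 5) → p = q := by decide
  have h04 : ∀ {p q : Bool}, (if p then 0 else 1) ≠ (if q then 4 else 5) := by decide
  have h02 : ∀ {p q : Bool}, (if p then 0 else 1) ≠ (if q then 2 else 3) := by decide
  have h24 : ∀ {p q : Bool}, (if p then 2 else 3) ≠ (if q then 4 else 5) := by decide
  rcases at_chartWord.1 hu with ⟨i, hi, rfl, rfl⟩ | ⟨i, hi, rfl, rfl⟩ | ⟨i, hi, rfl, rfl⟩ <;>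
    rcases at_chartWord.1 hu' with ⟨j, hj, e, rfl⟩ | ⟨j, hj, e, rfl⟩ | ⟨j, hj, e, rfl⟩ <;>
    obtain ⟨e', rfl⟩ := Prod.mk.inj e
  · obtain rfl := hτ e'
    exact chart_eq_of_profile
      (profile_chart_iff_at.2 ⟨_, rfl, t, ht, i, Or.inl ⟨hi, rfl⟩⟩) _ _
  · exact (h04 e').elim
  · exact (h02 e').elim
  · exact (h04 e'.symm).elim
  · obtain rfl := hσ e'
    exact chart_eq_of_chartY (chartY_eq_zero_iff_at.2 ⟨_, rfl, t, ht, i, hi, rfl⟩)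
      (chartY_eq_zero_iff_at.2 ⟨_, rfl, t, ht, i, hi, rfl⟩) _
  · exact (h24 e'.symm).elim
  · exact (h02 e'.symm).elim
  · exact (h24 e').elim
  · obtain rfl := hτ2 e'
    exact chart_eq_of_profile
      (profile_chart_iff_at.2 ⟨_, rfl, t, ht, i, Or.inr ⟨hi, rfl⟩⟩) _ _

theorem mk_eq_of_profile {g d : ℕ} {τ : Bool} {z : Disc}
    (h : profile g ⟨(z : ℂ).re, chartY g (nd d τ) z⟩ = 0) (σ σ' : Bool) :
    (quarters g d).mk' (inQ g d τ σ z) = (quarters g d).mk' (inQ g d τ σ' z) := by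
  obtain ⟨u, rfl, t, ht, i, ⟨hi, rfl⟩ | ⟨hi, rfl⟩⟩ := profile_chart_iff_at.1 h
  · exact Scheme.glue
      (edge_inQ.2 ⟨ht, _, rfl, at_chartWord.2 (Or.inl ⟨i, hi, rfl, rfl⟩)⟩)
      (edge_inQ.2 ⟨ht, _, rfl, at_chartWord.2 (Or.inl ⟨i, hi, rfl, rfl⟩)⟩)
  · exact Scheme.glue
      (edge_inQ.2 ⟨ht, _, rfl, at_chartWord.2 (Or.inr (Or.inr ⟨i, hi, rfl, rfl⟩))⟩)
      (edge_inQ.2 ⟨ht, _, rfl, at_chartWord.2 (Or.inr (Or.inr ⟨i, hi, rfl, rfl⟩))⟩)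

theorem mk_eq_of_chartY {g d : ℕ} {τ : Bool} {z : Disc} (h : chartY g (nd d τ) z = 0)
    (τ' : Bool) (σ : Bool) :
    (quarters g d).mk' (inQ g d τ σ z) = (quarters g d).mk' (inQ g d τ' σ z) := by
  obtain ⟨u, rfl, t, ht, i, hi, rfl⟩ := chartY_eq_zero_iff_at.1 h
  exact Scheme.glue
      (edge_inQ.2 ⟨ht, _, rfl, at_chartWord.2 (Or.inr (Or.inl ⟨i, hi, rfl, rfl⟩))⟩)
      (edge_inQ.2 ⟨ht, _, rfl, at_chartWord.2 (Or.inr (Or.inl ⟨i, hi, rfl, rfl⟩))⟩)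

theorem sg_mul_eq {σ σ' : Bool} {a b : ℝ} (ha : 0 ≤ a) (hb : 0 ≤ b) (h : sg σ * a = sg σ' * b) :
    a = b ∧ (σ ≠ σ' → a = 0) := by
  cases σ <;> cases σ' <;> simp [sg] at h ⊢ <;>
    first | exact h | (constructor <;> linarith)

/-- The signs of two charts can differ at a common image only where the coordinate in question
vanishes, and there the charts are glued. The passage goes through `inQ g d τ σ' z`: the sheet is
changed before the half. -/
theorem mk_eq_of_chart {g d : ℕ} {τ τ' σ σ' : Bool} {z z' : Disc}
    (h : chart g d τ σ z = chart g d τ' σ' z') :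
    (quarters g d).mk' (inQ g d τ σ z) = (quarters g d).mk' (inQ g d τ' σ' z') := by
  have h1 := congrArg (fun p => ((p : surface g d) : ℂ × ℝ).1.re) h
  have h2 := congrArg (fun p => ((p : surface g d) : ℂ × ℝ).1.im) h
  have h3 := congrArg (fun p => ((p : surface g d) : ℂ × ℝ).2) h
  simp only [chart] at h1 h2 h3
  obtain ⟨h4, h5⟩ := sg_mul_eq (chartY_nonneg _ _ _) (chartY_nonneg _ _ _) h2
  obtain ⟨-, h7⟩ := sg_mul_eq (Real.sqrt_nonneg _) (Real.sqrt_nonneg _) h3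
  have h8 : σ ≠ σ' → profile g ⟨(z : ℂ).re, chartY g (nd d τ) z⟩ = 0 := fun hσ =>
    (Real.sqrt_eq_zero (profile_nonneg z.abs_re_le (bump_le_chartY _ _ _)
      (chartY_le_lid _ _ _))).1 (h7 hσ)
  have h9 : (quarters g d).mk' (inQ g d τ σ z) = (quarters g d).mk' (inQ g d τ σ' z) := by
    by_cases hσ : σ = σ'
    · rw [hσ]
    · exact mk_eq_of_profile (h8 hσ) _ _
  by_cases hτ : τ = τ'
  · subst hτ
    rw [← chartY_inj h1 h4]; exact h9
  · have h10 := h5 hτ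
    have h11 := h10
    rw [h4, chartY_eq_zero_iff] at h11
    obtain rfl : z = z' := by
      refine Disc.ext' h1 ?_
      rw [h11.1, (chartY_eq_zero_iff.1 h10).1]
      unfold hgt; rw [h1]
    rw [h9]
    exact mk_eq_of_chartY h10 _ _

/-- The surface is glued from its four quarters. -/
theorem surface_homeomorph (g d : ℕ) : Nonempty ((quarters g d).space ≃ₜ surface g d) := by
  have hc : Continuous (quarterMap g d) :=
    (continuous_chart _ _ _ _).sumElim ((continuous_chart _ _ _ _).sumElim
      ((continuous_chart _ _ _ _).sumElim (continuous_chart _ _ _ _)))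
  have hF := Scheme.continuous_desc _ hc (quarterMap_glue g d)
  have hb : Function.Bijective (Scheme.desc _ (quarterMap g d) (quarterMap_glue g d)) := by
    constructor
    · intro p q h
      obtain ⟨x, rfl⟩ := (Scheme.isQuotientMap_mk' _).surjective p
      obtain ⟨y, rfl⟩ := (Scheme.isQuotientMap_mk' _).surjective q
      obtain ⟨τ, σ, z, rfl⟩ := exists_inQ x
      obtain ⟨τ', σ', z', rfl⟩ := exists_inQ y
      rw [Scheme.desc_mk', Scheme.desc_mk', quarterMap_inQ, quarterMap_inQ] at h
      exact mk_eq_of_chart h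
    · intro p
      obtain ⟨τ, σ, z, rfl⟩ := exists_chart p
      exact ⟨Scheme.mk' _ (inQ g d τ σ z), by rw [Scheme.desc_mk', quarterMap_inQ]⟩
  -- A continuous bijection from a compact space to a Hausdorff space.
  exact ⟨(show Continuous (Equiv.ofBijective _ hb) from hF).homeoOfEquivCompactToT2⟩

/-- The unweighted words of the charts. -/
def quarter (g d o k r : ℕ) : Word (ℕ × ℕ) :=
  alt (fun i => some ((o, i), true)) (fun _ => none) d ++
    alt (fun i => some ((r, i), true)) (fun i => some ((k, i), true)) g

theorem chartWord_iso (g d o k r : ℕ) : (poly (chartWord g d o k r)).Iso (pol (quarter g d o k r)) :=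
  poly_iso_pol (pos_chartWord g d o k r) (by
    rw [chartWord, List.map_append, altW_map_fst, altW_map_fst]; rfl)

theorem surface_homeomorph_pol (g d : ℕ) :
    Nonempty (((pol (quarter g d 0 2 4)).sum ((pol (quarter g 0 1 3 4)).sum
      ((pol (quarter g d 0 2 5)).sum (pol (quarter g 0 1 3 5))))).space ≃ₜ surface g d) := by
  obtain ⟨e⟩ := surface_homeomorph g d
  obtain ⟨f⟩ := ((chartWord_iso g d 0 2 4).sum ((chartWord_iso g 0 1 3 4).sum
    ((chartWord_iso g d 0 2 5).sum (chartWord_iso g 0 1 3 5)))).equiv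
  exact ⟨f.symm.trans e⟩

end Ribbon
end

noncomputable section
namespace Ribbon
open Set Topology GenusSurface
variable {α β : Type}

/-! ### Joining the quarters -/

theorem finitary_sum {S T : Scheme α} (hS : Finitary S) (hT : Finitary T) : Finitary (S.sum T) := by
  classical
  obtain ⟨F, hF⟩ := hS
  obtain ⟨G, hG⟩ := hT
  refine ⟨F ∪ G, fun a ha => ?_⟩
  simp only [Finset.mem_union, not_or] at ha
  exact Scheme.free_sum (hF a ha.1) (hG a ha.2)

/-- The word of a handle. -/
def handle (r j : ℕ) : Word (ℕ × ℕ) :=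
  [some ((r, j + 1), false), some ((3, j), false), some ((2, j), true), some ((r, j + 1), true)]

/-- The product of the first handles. -/
def handles (r : ℕ) : ℕ → Word (ℕ × ℕ)
  | 0 => []
  | g + 1 => handles r g ++ handle r g

theorem notIn_handles {r g : ℕ} {a : ℕ × ℕ} (h : ∀ j < g, a ≠ (r, j + 1) ∧ a ≠ (3, j) ∧ a ≠ (2, j)) :
    NotIn a (handles r g) := by
  induction g with
  | zero => simp [handles]
  | succ g ih =>
    obtain ⟨h1, h2, h3⟩ := h g (by omega)
    simp [handles, handle, ih fun j hj => h j (by omega), h1, h2, h3]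

/-- Half of the outer boundary of a chart without its first letter. -/
def spine (r k : ℕ) : ℕ → Word (ℕ × ℕ)
  | 0 => []
  | g + 1 => spine r k g ++ [some ((k, g), true), some ((r, g + 1), true)]

theorem alt_eq_spine (r k g : ℕ) :
    alt (fun i => some ((r, i), true)) (fun i => some ((k, i), true)) g =
      some ((r, 0), true) :: spine r k g := by
  induction g with
  | zero => rfl
  | succ g ih => simp [alt, spine, ih]

theorem notIn_spine {r k g : ℕ} {a : ℕ × ℕ} (h : ∀ j < g, a ≠ (r, j + 1) ∧ a ≠ (k, j)) :
    NotIn a (spine r k g) := by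
  induction g with
  | zero => simp [spine]
  | succ g ih =>
    obtain ⟨h1, h2⟩ := h g (by omega)
    simp [spine, ih fun j hj => h j (by omega), h1, h2]

/-- Letters of the outer boundary circles. -/
def outer (n : ℕ) : Word (ℕ × ℕ) := (List.range n).map fun i => some ((0, i + 1), true)

theorem alt_eq_outer (n : ℕ) :
    alt (fun i => some (((0, i) : ℕ × ℕ), true)) (fun _ => none) (n + 1) =
      some ((0, 0), true) :: none :: (gap (outer n) ++ [some ((0, n + 1), true)]) := by
  induction n with
  | zero => rfl
  | succ n ih => rw [alt, ih]; simp [outer, List.range_succ]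

theorem notIn_outer {n : ℕ} {a : ℕ × ℕ} (h : ∀ j < n, a ≠ (0, j + 1)) : NotIn a (outer n) := by
  intro ε hε
  simp only [outer, List.mem_map, List.mem_range, Option.some.injEq, Prod.mk.injEq] at hε
  obtain ⟨i, hi, e, -⟩ := hε
  exact h i hi e.symm

section moves
variable {E : Word (ℕ × ℕ) → Word (ℕ × ℕ) → Prop} {ok : ℕ × ℕ → Prop} (hE : Moves E ok)
include hE

/-- Cyclically, everything outside the handle lies between its last letter `(r, j + 1)` and its
first letter, the inverse; a slide may therefore exchange `Y` and `X`. -/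
theorem Moves.handle_move {r j : ℕ} (hr2 : r ≠ 2) (hr3 : r ≠ 3) (X Y : Word (ℕ × ℕ))
    (hok : ok (r, j + 1)) (h : NotIn (r, j + 1) (X ++ Y)) :
    E (X ++ (handle r j ++ Y)) (handle r j ++ (X ++ Y)) := by
  simp only [notIn_append] at h
  have h1 := hE.rot (X ++ [some ((r, j + 1), false), some ((3, j), false), some ((2, j), true)])
    (some ((r, j + 1), true) :: Y)
  have h2 := hE.slide (r, j + 1) true Y X [some ((3, j), false), some ((2, j), true)] hok
    (by simp [h, hr2, hr3])
  have h3 := hE.rot (some ((r, j + 1), true) :: (X ++ Y))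
    [some ((r, j + 1), false), some ((3, j), false), some ((2, j), true)]
  simp only [List.append_assoc, List.cons_append, List.nil_append, Bool.not_true] at h1 h2 h3
  simp only [handle, List.cons_append, List.nil_append]
  exact hE.trans h1 (hE.trans h2 h3)

theorem Moves.handles_move {r : ℕ} (hr2 : r ≠ 2) (hr3 : r ≠ 3) (hok : ∀ i, ok (r, i)) (g : ℕ) :
    ∀ X Y : Word (ℕ × ℕ), (∀ i ≤ g, NotIn (r, i) (X ++ Y)) →
    E (X ++ (handles r g ++ Y)) (handles r g ++ (X ++ Y)) := by
  induction g with
  | zero => intro X Y _; exact hE.refl _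
  | succ g ih =>
    intro X Y h
    have hn : NotIn (r, g + 1) (handles r g) := notIn_handles fun j hj => by simp [hr2, hr3]; omega
    have hh := h (g + 1) le_rfl
    simp only [notIn_append] at hh
    have h1 := hE.handle_move hr2 hr3 (X ++ handles r g) Y (hok (g + 1)) (by simp [hh, hn])
    have h2 := ih (handle r g ++ X) Y fun i hi => by
      have := h i (by omega)
      simp only [notIn_append] at this
      simp [handle, this, hr2, hr3]; omega
    simp only [handles, List.append_assoc] at h1 h2 ⊢
    exact hE.trans h1 h2

/-- Nested handles can be pulled apart. -/
theorem Moves.nest_collapse {r : ℕ} (hr2 : r ≠ 2) (hr3 : r ≠ 3) (hok : ∀ i, ok (r, i)) (g : ℕ) :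
    ∀ Q : Word (ℕ × ℕ), (∀ i ≤ g, NotIn (r, i) Q) →
    E (rev (spine r 3 g) ++ (spine r 2 g ++ Q)) (handles r g ++ Q) := by
  induction g with
  | zero => intro Q _; exact hE.refl _
  | succ g ih =>
    intro Q h
    -- The two outermost letters are put at the far end while the inner nest collapses, and are then
    -- brought back through the finished handles.
    have h1 := hE.rot [some ((r, g + 1), false), some ((3, g), false)]
      (rev (spine r 3 g) ++ (spine r 2 g ++ some ((2, g), true) :: some ((r, g + 1), true) :: Q))
    have h2 := ih (some ((2, g), true) :: some ((r, g + 1), true) :: (Q ++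
      [some ((r, g + 1), false), some ((3, g), false)])) fun i hi => by
        have := h i (by omega)
        simp [this, hr2, hr3]; omega
    have h3 := hE.rot (handles r g ++ (some ((2, g), true) :: some ((r, g + 1), true) :: Q))
      [some ((r, g + 1), false), some ((3, g), false)]
    have h4 := hE.handles_move hr2 hr3 hok g [some ((r, g + 1), false), some ((3, g), false)]
      (some ((2, g), true) :: some ((r, g + 1), true) :: Q) fun i hi => by
        have := h i (by omega)
        simp [this, hr2, hr3]; omega
    simp only [handles, handle, spine, rev_append, rev_cons, rev_nil, flip, List.append_assoc,
      List.cons_append, List.nil_append] at h1 h2 h3 h4 ⊢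
    exact hE.trans h1 (hE.trans h2 (hE.trans h3 h4))

end moves

/-- The upper and the lower quarter of a sheet joined along the real axis. -/
theorem half_equiv (g n r : ℕ) (hr : 3 < r) (S : Scheme (ℕ × ℕ)) (hS : Finitary S)
    (hSr : ∀ i, S.Free (r, i)) :
    ((pol (quarter g (n + 1) 0 2 r)).sum ((pol (quarter g 0 1 3 r)).sum S)).Equiv
      ((pol (some ((0, n + 1), true) :: some ((1, 0), false) :: some ((0, 0), true) ::
        (handles r g ++ none :: gap (outer n)))).sum S) := by
  have hr0 : r ≠ 0 := by omega
  have hr1 : r ≠ 1 := by omega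
  have hr2 : r ≠ 2 := by omega
  have hr3 : r ≠ 3 := by omega
  have hE := moves_eqv hS
  have hO (i : ℕ) : NotIn (r, i) (outer n) := notIn_outer fun j _ => by simp [hr0]
  set O : Word (ℕ × ℕ) := some ((0, 0), true) :: none :: (gap (outer n) ++ [some ((0, n + 1), true)])
    with hOdef
  have e1 : quarter g (n + 1) 0 2 r = (O ++ [some ((r, 0), true)]) ++ spine r 2 g := by
    rw [quarter, alt_eq_outer, alt_eq_spine]; simp [hOdef]
  have e2 : quarter g 0 1 3 r = some ((1, 0), true) :: some ((r, 0), true) :: spine r 3 g := by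
    rw [quarter, alt_eq_spine]; simp [alt]
  have i1 : (pol (quarter g (n + 1) 0 2 r)).Iso (pol ((spine r 2 g ++ O) ++ [some ((r, 0), true)])) := by
    rw [e1]
    have := rotate (O ++ [some ((r, 0), true)]) (spine r 2 g)
    simpa using this
  have i2 : (pol (quarter g 0 1 3 r)).Iso
      (pol (some ((r, 0), false) :: some ((1, 0), false) :: rev (spine r 3 g))) := by
    rw [e2]
    refine (reverse _).trans ?_
    have := rotate (rev (spine r 3 g)) [some ((r, 0), false), some ((1, 0), false)]
    simpa [flip] using this
  -- The halves are merged along the first segment of the real axis only. The other segments remain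
  -- as letters and give one handle each.
  have m := merge' (spine r 2 g ++ O) (some ((1, 0), false) :: rev (spine r 3 g)) (r, 0) true S
    (by simp [hOdef]) (by simp)
    (by
      have : NotIn (r, 0) (spine r 2 g) := notIn_spine fun j _ => by simp [hr2]
      simp [hOdef, this, hO, hr0])
    (by
      have : NotIn (r, 0) (spine r 3 g) := notIn_spine fun j _ => by simp [hr3]
      simp [this, hr1]) (hSr 0)
  refine (i1.sum (i2.sum (.refl S))).equiv.trans (m.trans ?_)
  have h1 := hE.rot (spine r 2 g ++ (O ++ [some ((1, 0), false)])) (rev (spine r 3 g))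
  have h2 := hE.nest_collapse hr2 hr3 hSr g (O ++ [some ((1, 0), false)]) fun i _ => by
    simp [hOdef, hO, hr0, hr1]
  have h3 := hE.handles_move hr2 hr3 hSr g [some ((0, 0), true)]
    (none :: (gap (outer n) ++ [some ((0, n + 1), true), some ((1, 0), false)])) fun i _ => by
      simp [hO, hr0, hr1]
  have h4 := hE.rot (some ((0, 0), true) :: (handles r g ++ none :: gap (outer n)))
    [some ((0, n + 1), true), some ((1, 0), false)]
  simp only [hOdef, List.append_assoc, List.cons_append, List.nil_append] at h1 h2 h3 h4 ⊢
  exact hE.trans h1 (hE.trans h2 (hE.trans (hE.symm h3) h4))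

theorem free_pol_sum {a : ℕ × ℕ} {v w : Word (ℕ × ℕ)} (hv : NotIn a v) (hw : NotIn a w) :
    ((pol v).sum (pol w)).Free a := Scheme.free_sum (free_pol hv) (free_pol hw)

theorem notIn_quarter {g d o k r : ℕ} {a : ℕ × ℕ} (h0 : a.1 ≠ o) (h1 : a.1 ≠ k) (h2 : a.1 ≠ r) :
    NotIn a (quarter g d o k r) := by
  have h (l m : ℕ → Option ((ℕ × ℕ) × Bool)) (hl : ∀ i ε, l i ≠ some (a, ε))
      (hm : ∀ i ε, m i ≠ some (a, ε)) (n : ℕ) : NotIn a (alt l m n) := by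
    induction n with
    | zero => intro ε; simpa [alt] using (hl 0 ε).symm
    | succ n ih =>
      rw [alt, notIn_append]
      refine ⟨ih, fun ε => ?_⟩
      simpa using ⟨(hm n ε).symm, (hl (n + 1) ε).symm⟩
  rw [quarter, notIn_append]
  refine ⟨h _ _ ?_ ?_ _, h _ _ ?_ ?_ _⟩ <;> intro i ε <;> simp <;> rintro rfl <;> simp at *

/-- The surface as a single polygon. -/
theorem quarters_equiv (g n : ℕ) :
    ((pol (quarter g (n + 1) 0 2 4)).sum ((pol (quarter g 0 1 3 4)).sum
      ((pol (quarter g (n + 1) 0 2 5)).sum (pol (quarter g 0 1 3 5))))).Equiv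
    (pol (rev (handles 5 g) ++ (handles 4 g ++
      none :: (gap (outer n) ++ (rev (gap (outer n)) ++ [none]))))) := by
  let M (r : ℕ) : Word (ℕ × ℕ) := some ((0, n + 1), true) :: some ((1, 0), false) ::
    some ((0, 0), true) :: (handles r g ++ none :: gap (outer n))
  let R (r : ℕ) : Word (ℕ × ℕ) := handles r g ++ none :: gap (outer n)
  have hO (a : ℕ × ℕ) (h : a.1 ≠ 0) : NotIn a (outer n) := notIn_outer fun j _ => by
    rintro rfl; simp at h
  have hH (r : ℕ) (a : ℕ × ℕ) (h : a.1 ≠ r) (h2 : a.1 ≠ 2) (h3 : a.1 ≠ 3) : NotIn a (handles r g) :=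
    notIn_handles fun j _ => by
      refine ⟨?_, ?_, ?_⟩ <;> rintro rfl <;> simp at *
  have s1 : _ := half_equiv g n 4 (by norm_num)
    ((pol (quarter g (n + 1) 0 2 5)).sum (pol (quarter g 0 1 3 5)))
    (finitary_sum (finitary_pol _) (finitary_pol _)) fun i => free_pol_sum
      (notIn_quarter (by norm_num) (by norm_num) (by norm_num))
      (notIn_quarter (by norm_num) (by norm_num) (by norm_num))
  have s2 : _ := half_equiv g n 5 (by norm_num) (pol (M 4)) (finitary_pol _) fun i =>
    free_pol (by simp [M, hO, hH])
  -- The two sheets share the three consecutive letters `(0, n + 1)`, `(1, 0)⁻¹`, `(0, 0)`. Undoing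
  -- two subdivisions unites them into the single letter `(6, 1)`.
  have s3 : ((pol (M 5)).sum (pol (M 4))).Equiv
      ((pol (some ((6, 1), true) :: R 5)).sum (pol (some ((6, 1), true) :: R 4))) := by
    have hR (r : ℕ) (hr : 3 < r) (hr' : r < 6) (a : ℕ × ℕ) (ha : a = (6, 0) ∨ a = (6, 1) ∨ a = (1, 0) ∨
        a = (0, 0) ∨ a = (0, n + 1)) : NotIn a (R r) := by
      have : NotIn a (outer n) := by
        refine notIn_outer fun j hj => ?_
        rcases ha with rfl | rfl | rfl | rfl | rfl <;> simp; omega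
      have : NotIn a (handles r g) := by
        apply hH
        · rcases ha with rfl | rfl | rfl | rfl | rfl <;> simp <;> omega
        · rcases ha with rfl | rfl | rfl | rfl | rfl <;> simp
        · rcases ha with rfl | rfl | rfl | rfl | rfl <;> simp
      simp [R, *]
    have hx (r : ℕ) (hr : 3 < r) (hr' : r < 6) : sbw (6, 0) (0, n + 1) (1, 0) true false
        (some ((6, 0), true) :: some ((0, 0), true) :: R r) = M r := by
      rw [sbw_cons, sbw_cons, sbw_of_notIn _ _ _ _ (hR r hr hr' _ (by simp))]
      simp [sbl, M, R]
    have hy (r : ℕ) (hr : 3 < r) (hr' : r < 6) : sbw (6, 1) (6, 0) (0, 0) true true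
        (some ((6, 1), true) :: R r) = some ((6, 0), true) :: some ((0, 0), true) :: R r := by
      rw [sbw_cons, sbw_of_notIn _ _ _ _ (hR r hr hr' _ (by simp))]
      simp [sbl]
    have t1 := subdivide_two (6, 0) (0, n + 1) (1, 0) true false
      (some ((6, 0), true) :: some ((0, 0), true) :: R 5)
      (some ((6, 0), true) :: some ((0, 0), true) :: R 4) (by simp)
      (by simp [hR]) (by simp [hR]) (by simp [hR]) (by simp [hR])
    have t2 := subdivide_two (6, 1) (6, 0) (0, 0) true true (some ((6, 1), true) :: R 5)
      (some ((6, 1), true) :: R 4) (by simp)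
      (by simp [hR]) (by simp [hR]) (by simp [hR]) (by simp [hR])
    rw [hx 5 (by norm_num) (by norm_num), hx 4 (by norm_num) (by norm_num)] at t1
    rw [hy 5 (by norm_num) (by norm_num), hy 4 (by norm_num) (by norm_num)] at t2
    exact t1.symm.trans t2.symm
  have hq (r : ℕ) (hr : r < 6) : NotIn (6, 1) (R r) := by
    have : NotIn (6, 1) (handles r g) := hH _ _ (by simp; omega) (by simp) (by simp)
    simp [R, this, hO]
  -- The sheets are merged along this letter, one of them after reflection.
  have s4 := merge' (R 4) (rev (R 5)) (6, 1) true Scheme.empty (by simp [R]) (by simp [R])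
    (hq 4 (by norm_num)) (by simpa using hq 5 (by norm_num)) (Scheme.free_empty _)
  refine s1.trans ?_
  refine ((Scheme.sum_comm _ _).trans (Scheme.sum_assoc _ _ _)).equiv.trans (s2.trans (s3.trans ?_))
  have j1 : (pol (some ((6, 1), true) :: R 4)).Iso (pol (R 4 ++ [some ((6, 1), true)])) := by
    simpa using rotate [some ((6, 1), true)] (R 4)
  have j2 : (pol (some ((6, 1), true) :: R 5)).Iso (pol (some ((6, 1), false) :: rev (R 5))) := by
    refine (reverse _).trans ?_
    simpa [flip] using rotate (rev (R 5)) [some ((6, 1), false)]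
  refine (Scheme.sum_comm _ _).equiv.trans
    ((j1.sum (j2.trans (Scheme.sum_empty _).symm)).equiv.trans (s4.trans
      ((Scheme.sum_empty _).equiv.trans ?_)))
  have := rotate (handles 4 g ++ none :: (gap (outer n) ++ (rev (gap (outer n)) ++ [none])))
    (rev (handles 5 g))
  simp only [R, rev_append, rev_cons, List.append_assoc, List.cons_append, List.nil_append, flip] at this ⊢
  exact this.equiv

end Ribbon
end

noncomputable section
namespace Ribbon
open Set Topology GenusSurface
variable {α β : Type}

/-! ### Handles become commutators -/

theorem exists_bound (k : ℕ) (w : Word (ℕ × ℕ)) : ∃ N, ∀ n ≥ N, NotIn (k, n) w := by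
  obtain ⟨F, hF⟩ := exists_notIn w
  refine ⟨(F.image Prod.snd).sup id + 1, fun n hn => hF _ fun h => ?_⟩
  have : n ≤ (F.image Prod.snd).sup id :=
    Finset.le_sup (f := id) (Finset.mem_image.2 ⟨(k, n), h, rfl⟩)
  omega

/-- Two handles with the same core give a commutator. -/
theorem Eqv.handle_pair [DecidableEq α] [Infinite α] (p q h k s y c : α)
    (hd : [p, q, h, k, s, y, c].Nodup) (B C : Word α)
    (hB : ∀ a ∈ [p, q, h, k, s, y, c], NotIn a B) (hC : ∀ a ∈ [p, q, h, k, s, y, c], NotIn a C) :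
    Eqv Scheme.empty (some (q, false) :: some (h, false) :: some (k, true) :: some (q, true) :: (B ++
      some (p, false) :: some (k, false) :: some (h, true) :: some (p, true) :: C))
      (B ++ some (c, false) :: some (y, false) :: some (c, true) :: some (y, true) :: C) := by
  simp only [List.nodup_cons, List.mem_cons, List.not_mem_nil, or_false, not_or, List.nodup_nil,
    forall_eq_or_imp, forall_eq] at hd hB hC
  obtain ⟨⟨d1, d2, d3, d4, d5, d6⟩, ⟨d7, d8, d9, d10, d11⟩, ⟨d12, d13, d14, d15⟩,
    ⟨d16, d17, d18⟩, ⟨d19, d20⟩, d21, -⟩ := hd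
  obtain ⟨b1, b2, b3, b4, b5, b6, b7⟩ := hB
  obtain ⟨c1, c2, c3, c4, c5, c6, c7⟩ := hC
  -- The core `k⁻¹ h`, which occurs once with either direction, becomes one letter `s`.
  have h1 := subdivide s k h false true (some (q, false) :: some (s, false) :: some (q, true) :: (B ++
      some (p, false) :: some (s, true) :: some (p, true) :: C)) (Ne.symm d12)
      (by simp [*, Ne.symm d3, Ne.symm d8])
      (by simp [*, Ne.symm d2, Ne.symm d7])
  -- The conjugate `p⁻¹ s p` becomes one letter `y`, which turns `s⁻¹` into `p y⁻¹ p⁻¹`.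
  have h2 := Eqv.substitute Scheme.empty [some (q, false)] (some (q, true) :: B) C [some (p, false)]
    [some (p, true)] s y true d19 (by simp [*, Ne.symm d4, Ne.symm d9])
    (by simp [*, Ne.symm d5, Ne.symm d10]) (Scheme.free_empty _) (Scheme.free_empty _)
  -- Now `q⁻¹ p` and its inverse `p⁻¹ q` are united into `c⁻¹` and `c`, leaving `c⁻¹ y⁻¹ c B y C`.
  have h3 := subdivide c p q false true (some (c, false) :: some (y, false) :: some (c, true) :: (B ++
      some (y, true) :: C)) d1 (by simp [*]) (by simp [*])
  have h4 := (moves_eqv (α := α) finitary_empty).split_comm c y false false [] [] B C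
    (Scheme.free_empty _) (Scheme.free_empty _) (Ne.symm d21) (by simp [*]) (by simp [*])
  have h5 := Eqv.rot Scheme.empty
    (some (c, false) :: some (y, false) :: some (c, true) :: some (y, true) :: C) B
  simp only [sbw_cons, sbw_append, sbw_of_notIn _ _ _ _ b5, sbw_of_notIn _ _ _ _ c5] at h1
  simp only [sbw_cons, sbw_append, sbw_of_notIn _ _ _ _ b7, sbw_of_notIn _ _ _ _ c7] at h3
  simp only [sbl, d9, d4, if_false, if_true, List.cons_append, List.nil_append, d21,
    Bool.not_true, Bool.not_false, List.append_nil] at h1 h2 h3 h4 h5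
  have e1 := (Scheme.sum_empty _).equiv.trans (h1.symm.trans (Scheme.sum_empty _).symm.equiv)
  have e3 := (Scheme.sum_empty _).equiv.trans (h3.symm.trans (Scheme.sum_empty _).symm.equiv)
  exact Eqv.trans e1 (h2.trans (Eqv.trans e3 (h4.trans h5)))

/-- The last handles of the two sheets enclose all the others and have the same core. They are
turned into a commutator, which joins `V` for the induction; its letters have first component `8` so
as to be new. -/
theorem exists_comm_of_handles (g : ℕ) : ∀ V : Word (ℕ × ℕ), (∀ i, NotIn (2, i) V) →
    (∀ i, NotIn (3, i) V) → (∀ i, NotIn (4, i) V) → (∀ i, NotIn (5, i) V) →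
    ∃ L : List (Item (ℕ × ℕ)), (iletters L).Nodup ∧ (∀ i ∈ L, i.isComm = true) ∧ L.length = g ∧
      (∀ a ∈ iletters L, NotIn a V) ∧
      Eqv Scheme.empty (rev (handles 5 g) ++ (handles 4 g ++ V)) (iword L ++ V) := by
  induction g with
  | zero =>
    intro V _ _ _ _
    exact ⟨[], by simp, by simp, rfl, by simp, Eqv.refl _ _⟩
  | succ g ih =>
    intro V h2 h3 h4 h5
    obtain ⟨N, hN⟩ := exists_bound 8 (handles 4 g ++ (rev (handles 5 g) ++ V))
    simp only [notIn_append, notIn_rev] at hN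
    have hB (a : ℕ × ℕ) (ha : a = (4, g + 1) ∨ a = (5, g + 1) ∨ a = (2, g) ∨ a = (3, g)) :
        NotIn a (handles 4 g) ∧ NotIn a (handles 5 g) := by
      constructor <;> refine notIn_handles fun j hj => ?_ <;>
        rcases ha with rfl | rfl | rfl | rfl <;> simp <;> omega
    have hp := Eqv.handle_pair (4, g + 1) (5, g + 1) (2, g) (3, g) (8, N) (8, N + 1) (8, N + 2)
      (by simp) (rev (handles 5 g) ++ handles 4 g) V (by simp [hB, hN]) (by simp [h2, h3, h4, h5, hN])
    obtain ⟨L, l1, l2, l3, l4, l5⟩ := ih (some ((8, N + 2), false) :: some ((8, N + 1), false) ::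
      some ((8, N + 2), true) :: some ((8, N + 1), true) :: V) (by simp [h2]) (by simp [h3])
      (by simp [h4]) (by simp [h5])
    simp only [notIn_cons_some] at l4
    refine ⟨L ++ [Item.comm (8, N + 2) false (8, N + 1) false], ?_, ?_, ?_, ?_, ?_⟩
    · simp only [iletters_append, List.nodup_append, l1, true_and, iletters_cons, iletters_nil,
        Item.letters]
      refine ⟨by simp, fun a ha b hb => ?_⟩
      have := l4 a ha
      simp only [List.append_nil, List.mem_cons, List.not_mem_nil, or_false] at hb
      rcases hb with rfl | rfl
      exacts [this.1, this.2.1]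
    · intro i hi
      rcases List.mem_append.1 hi with hi | hi
      · exact l2 i hi
      · obtain rfl := List.mem_singleton.1 hi; rfl
    · simp [l3]
    · intro a ha
      simp only [iletters_append, iletters_cons, iletters_nil, Item.letters, List.append_nil,
        List.mem_append, List.mem_cons, List.not_mem_nil, or_false] at ha
      rcases ha with ha | rfl | rfl
      · exact (l4 a ha).2.2.2.2
      · exact (hN (N + 2) (by omega)).2.2
      · exact (hN (N + 1) (by omega)).2.2
    · simp only [handles, handle, rev_append, rev_cons, rev_nil, flip, List.append_assoc,
        List.cons_append, List.nil_append, iword_append, iword_cons, iword_nil, Item.word,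
        Bool.not_false] at hp l5 ⊢
      exact hp.trans l5

/-! ### Inserting gaps -/

/-- Unlabelled edges can be multiplied at will. Moving copies around a commutator and reading
`split_comm` backwards distributes them over the spaces between its letters. -/
theorem Eqv.gap_comm [Infinite α] (a b : α) (ε δ : Bool) (V : Word α) (hab : a ≠ b) (ha : NotIn a V)
    (hb : NotIn b V) : Eqv Scheme.empty ((Item.comm a ε b δ).word ++ none :: V)
      (none :: (gap (Item.comm a ε b δ).word ++ V)) := by
  have hE := moves_eqv (α := α) finitary_empty
  have h1 := hE.rot [none] (gap (Item.comm a ε b δ).word ++ V)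
  have h2 := hE.split_comm a b ε δ [none] [none] [none] (none :: (V ++ [none]))
    (Scheme.free_empty _) (Scheme.free_empty _) hab (by simp [ha]) (by simp [hb])
  have h3 := hE.comm_comm a b ε δ (none :: V) [none, none, none, none] (Scheme.free_empty _)
    (Scheme.free_empty _) hab (by simp [ha]) (by simp [hb])
  have j (n : Word α) := Eqv.join Scheme.empty [some (a, ε), some (b, δ), some (a, !ε), some (b, !δ)] n
  simp only [Item.word, gap_cons, gap_nil, List.append_assoc, List.cons_append,
    List.nil_append] at h1 h2 h3 j ⊢
  refine Eqv.symm (h1.trans (h2.trans (h3.trans ?_)))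
  exact (j _).trans ((j _).trans ((j _).trans (j _)))

/-- The unlabelled edge travels leftwards through the product and leaves gaps in every commutator
that it passes. -/
theorem Eqv.gap_comms [Infinite α] (L : List (Item α)) : (iletters L).Nodup →
    (∀ i ∈ L, i.isComm = true) → ∀ V : Word α, (∀ a ∈ iletters L, NotIn a V) →
    Eqv Scheme.empty (iword L ++ none :: V) (none :: (gap (iword L) ++ V)) := by
  induction L using List.reverseRecOn with
  | nil => exact fun _ _ V _ => Eqv.refl _ _
  | append_singleton L i ih =>
    intro h1 h2 V h3
    have hi := h2 i (by simp)
    rcases i with ⟨a, ε, b, δ⟩ | ⟨c, ε⟩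
    · simp only [iletters_append, List.nodup_append, iletters_cons, iletters_nil, Item.letters,
        List.append_nil, List.nodup_cons, List.mem_cons, List.not_mem_nil, or_false,
        List.nodup_nil, List.mem_append] at h1 h3
      have hL (x : α) (hx : x = a ∨ x = b) : NotIn x (iword L) := by
        rw [notIn_iword]; exact fun h => h1.2.2 x h x hx rfl
      have r1 := Eqv.rot Scheme.empty (iword L) ((Item.comm a ε b δ).word ++ none :: V)
      have r2 := Eqv.gap_comm a b ε δ (V ++ iword L) h1.2.1.1
        (by simp [h3, hL]) (by simp [h3, hL])
      have r3 := Eqv.rot Scheme.empty (none :: (gap (Item.comm a ε b δ).word ++ V)) (iword L)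
      have r4 := ih h1.1 (fun i hi => h2 i (by simp [hi])) (gap (Item.comm a ε b δ).word ++ V)
        fun x hx => by
          have e1 : x ≠ a := h1.2.2 x hx a (Or.inl rfl)
          have e2 : x ≠ b := h1.2.2 x hx b (Or.inr rfl)
          rw [notIn_append]
          exact ⟨by simp [Item.word, e1, e2], h3 x (Or.inl hx)⟩
      simp only [iword_append, iword_cons, iword_nil, gap_append, List.append_assoc,
        List.cons_append, List.append_nil] at r1 r2 r3 r4 ⊢
      exact r1.trans (r2.trans (r3.trans r4))
    · simp [Item.isComm] at hi

/-- Reversal puts the unlabelled edges in front of the letters; an additional one restores the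
pattern behind them. -/
theorem rev_gap (w : Word α) : rev (gap w) ++ [none] = none :: gap (rev w) := by
  induction w with
  | nil => rfl
  | cons x w ih =>
    simp only [gap_cons, rev_cons, flip, List.append_assoc, gap_append, gap_nil] at ih ⊢
    rw [← List.cons_append, ← ih]; simp

theorem pol_none_iso : (pol ([none] : Word α)).Iso (pol []) := by
  refine ⟨Homeomorph.refl _, fun a t z => ⟨?_, ?_⟩⟩
  · rintro ⟨-, u, hu, -⟩; simp [wt, At] at hu
  · rintro ⟨-, u, hu, -⟩; simp [wt, At] at hu

theorem Eqv.none_gap (S : Scheme α) (w : Word α) : Eqv S (none :: gap w) (gap w) := by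
  rcases eq_or_ne w [] with rfl | hw
  · exact .of_iso pol_none_iso
  · have h1 := Eqv.rot S [none] (gap w)
    have h2 := Eqv.insert S [] w [] hw
    simp only [List.cons_append, List.nil_append, List.append_nil] at h1 h2
    exact h1.trans h2.symm

theorem Eqv.none_gap_gap (S : Scheme α) (v w : Word α) :
    Eqv S (none :: (gap v ++ none :: gap w)) (gap (v ++ w)) := by
  refine Eqv.trans ?_ (Eqv.none_gap S _)
  rcases eq_or_ne v [] with rfl | hv
  · exact Eqv.join S [] (gap w)
  · have := Eqv.insert S [none] v (gap w) hv
    simpa using this.symm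

/-- Nested pairs can be pulled apart. -/
theorem Moves.rainbow {E : Word α → Word α → Prop} (hE : Moves E fun _ => True) (l : List α) :
    l.Nodup → ∀ A : Word α, (∀ a ∈ l, NotIn a A) →
    E (A ++ (l.map (fun a => some (a, true)) ++ rev (l.map fun a => some (a, true))))
      (A ++ iword (l.map fun a => Item.pair a true)) := by
  induction l using List.reverseRecOn with
  | nil => intro _ A _; exact hE.refl _
  | append_singleton l c ih =>
    intro hl A hA
    simp only [List.nodup_append, List.nodup_cons, List.not_mem_nil, not_false_eq_true,
      List.nodup_nil, true_and, List.mem_singleton, List.mem_append] at hl hA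
    have hc : NotIn c (l.map fun a => some (a, true)) := by
      intro ε hε
      simp only [List.mem_map, Option.some.injEq, Prod.mk.injEq] at hε
      obtain ⟨a, ha, rfl, -⟩ := hε
      exact hl.2 a ha a rfl rfl
    have h1 := hE.rot (A ++ l.map fun a => some (a, true))
      (some (c, true) :: some (c, false) :: rev (l.map fun a => some (a, true)))
    have h2 := hE.pair_comm c true (rev (l.map fun a => some (a, true)))
      (A ++ l.map fun a => some (a, true)) trivial (by simp [hc, hA])
    have h3 := ih hl.1 (some (c, true) :: some (c, false) :: A) fun a ha => by
      simp [hl.2 a ha c rfl, hA a (Or.inl ha)]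
    have h4 := hE.rot [some (c, true), some (c, false)] (A ++ iword (l.map fun a => Item.pair a true))
    simp only [List.map_append, List.map_cons, List.map_nil, rev_append, rev_cons, rev_nil, flip,
      List.append_assoc, List.cons_append, List.nil_append, Bool.not_true, iword_append, iword_cons,
      iword_nil, Item.word, List.append_nil] at h1 h2 h3 h4 ⊢
    exact hE.trans h1 (hE.trans h2 (hE.trans h3 h4))

/-- The surface is the standard polygon. -/
theorem surface_equiv_std (g n : ℕ) :
    Nonempty ((pol (gap (stdWord g n))).space ≃ₜ surface g (n + 1)) := by
  obtain ⟨e⟩ := surface_homeomorph_pol g (n + 1)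
  obtain ⟨f⟩ := quarters_equiv g n
  have hO (a : ℕ × ℕ) (h : a.1 ≠ 0) : NotIn a (outer n) := notIn_outer fun j _ => by
    rintro rfl; simp at h
  set V : Word (ℕ × ℕ) := gap (outer n) ++ (rev (gap (outer n)) ++ [none]) with hV
  -- What follows the handles is a word and its reverse, which `rainbow` resolves into one trivial
  -- pair for each of the `n` letters.
  obtain ⟨L, l1, l2, l3, l4, l5⟩ := exists_comm_of_handles g (none :: V)
    (by simp [hV, hO]) (by simp [hV, hO]) (by simp [hV, hO]) (by simp [hV, hO])
  have h1 := Eqv.gap_comms L l1 l2 V (by simpa using l4)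
  have h2 : Eqv Scheme.empty (none :: (gap (iword L) ++ V)) (gap (iword L ++ (outer n ++ rev (outer n)))) := by
    have := Eqv.none_gap_gap Scheme.empty (iword L ++ outer n) (rev (outer n))
    rw [hV, rev_gap]
    simpa using this
  set l : List (ℕ × ℕ) := (List.range n).map fun i => (0, i + 1) with hl
  have ho : outer n = l.map fun a => some (a, true) := by simp [hl, outer]
  have hln : l.Nodup := (List.nodup_range).map fun i j h => by simpa using h
  have hlL : ∀ a ∈ l, a ∉ iletters L := fun a ha h => by
    have := l4 a h
    simp only [hV, notIn_cons_none, notIn_append, notIn_gap] at this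
    apply this.1 true
    rw [ho]; exact List.mem_map.2 ⟨a, ha, rfl⟩
  have h3 : GEqv _ _ := moves_gEqv.rainbow l hln (iword L) fun a ha => by
    rw [notIn_iword]; exact hlL a ha
  have h4 := iword_equiv_std (L ++ l.map fun a => Item.pair a true) (by
    have e : iletters (l.map fun a => Item.pair a true) = l := by
      simp [iletters, List.flatMap_map, Item.letters]
    rw [iletters_append, e, List.nodup_append]
    exact ⟨l1, hln, fun a ha b hb => by rintro rfl; exact hlL a hb ha⟩) g n (by
      rw [List.countP_append, List.countP_eq_length.2 l2, l3, List.countP_eq_zero.2]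
      · rfl
      · intro i hi; obtain ⟨a, -, rfl⟩ := List.mem_map.1 hi; simp [Item.isComm]) (by
      rw [List.countP_append, List.countP_eq_zero.2, List.countP_eq_length.2]
      · simp [hl]
      · intro i hi; obtain ⟨a, -, rfl⟩ := List.mem_map.1 hi; simp [Item.isComm]
      · intro i hi; simp [l2 i hi])
  rw [iword_append] at h4
  rw [← ho] at h3
  obtain ⟨k⟩ := (Eqv.equiv (l5.trans (h1.trans (h2.trans h3)))).trans h4
  exact ⟨(k.symm.trans f.symm).trans e⟩

theorem holedSphere_eq (d : ℕ) : holedSphere d = surface 0 d := by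
  rw [holedSphere, surface, closedSurface_zero]

end Ribbon
end

/-! ### Necessity: the Euler characteristic of a covering -/

noncomputable section
namespace Ribbon
open Set Topology GenusSurface
variable {α β : Type}

/-! ### Counting maps to the circle -/

theorem convex_disc : Convex ℝ (Metric.closedBall (0 : ℂ) 1) := convex_closedBall 0 1

instance : ContractibleSpace Disc := convex_disc.contractibleSpace ⟨0, by simp⟩

instance : LocallyPathConnectedSpace Disc := convex_disc.locallyPathConnectedSpace

instance : Zero Disc := ⟨⟨0, by simp⟩⟩

/-- A space obtained from discs, indexed by `F`, by gluing the arc `a l` of each disc `x` to the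
arc `a' l` of the disc `σ l x`; the arcs are disjoint. -/
structure Ribbons (X F Λ : Type) [TopologicalSpace X] where
  Q : F → C(Disc, X)
  σ : Λ → F → F
  a : Λ → C(unitInterval, Disc)
  a' : Λ → C(unitInterval, Disc)
  surj : ∀ y, ∃ x z, Q x z = y
  glue : ∀ x l t, Q x (a l t) = Q (σ l x) (a' l t)
  eq : ∀ x z x' z', Q x z = Q x' z' → x = x' ∧ z = z' ∨
    ∃ l t, z = a l t ∧ z' = a' l t ∧ x' = σ l x ∨ z = a' l t ∧ z' = a l t ∧ x = σ l x'
  b : Λ → C(Disc, ℝ)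
  b_one : ∀ l t, b l (a l t) = 1
  b_zero : ∀ l k t, k ≠ l → b l (a k t) = 0
  b_zero' : ∀ l k t, b l (a' k t) = 0

namespace Ribbons
variable {X F Λ : Type} [TopologicalSpace X] (R : Ribbons X F Λ)

/-- The preimage of a closed set is the union of its traces on the finitely many discs, and these
are compact. -/
theorem exists_desc [T2Space X] [Finite F] {Z : Type} [TopologicalSpace Z] (h : F → C(Disc, Z))
    (hh : ∀ x l t, h x (R.a l t) = h (R.σ l x) (R.a' l t)) :
    ∃ g : C(X, Z), ∀ x z, g (R.Q x z) = h x z := by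
  choose px pz hp using R.surj
  have key (x : F) (z : Disc) : h (px (R.Q x z)) (pz (R.Q x z)) = h x z := by
    rcases R.eq _ _ _ _ (hp (R.Q x z)) with ⟨h1, h2⟩ | ⟨l, t, ⟨h1, h2, h3⟩ | ⟨h1, h2, h3⟩⟩
    · rw [h1, h2]
    · rw [h1, hh, ← h3, ← h2]
    · rw [h1, h3, ← hh, ← h2]
  refine ⟨⟨fun y => h (px y) (pz y), continuous_iff_isClosed.2 fun C hC => ?_⟩, key⟩
  have : (fun y => h (px y) (pz y)) ⁻¹' C = ⋃ x, R.Q x '' (h x ⁻¹' C) := by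
    ext y
    simp only [mem_preimage, mem_iUnion, mem_image]
    constructor
    · intro hy; exact ⟨px y, pz y, hy, hp y⟩
    · rintro ⟨x, z, hz, rfl⟩; rw [key]; exact hz
  rw [this]
  exact isClosed_iUnion_of_finite fun x =>
    (R.Q x).continuous.isClosedMap _ (hC.preimage (h x).continuous)

/-- Real functions on the discs with integral jumps across the arcs. -/
def jumps : AddSubgroup ((F → C(Disc, ℝ)) × (F → Λ → ℤ)) where
  carrier := {p | ∀ x l t, p.1 x (R.a l t) - p.1 (R.σ l x) (R.a' l t) = p.2 x l}
  zero_mem' := by intro x l t; simp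
  add_mem' := by
    intro p q hp hq x l t
    have := hp x l t; have := hq x l t
    simp only [Prod.fst_add, Pi.add_apply, ContinuousMap.add_apply, Prod.snd_add, Int.cast_add]
    linarith
  neg_mem' := by
    intro p hp x l t
    have := hp x l t
    simp only [Prod.fst_neg, Pi.neg_apply, ContinuousMap.neg_apply, Prod.snd_neg, Int.cast_neg]
    linarith

/-- The circle. -/
abbrev Circ := AddCircle (1 : ℝ)

theorem coe_int (n : ℤ) : ((n : ℝ) : Circ) = 0 := by
  rw [AddCircle.coe_eq_zero_iff]; exact ⟨n, by simp⟩

theorem exists_circleMap [T2Space X] [Finite F] (p : R.jumps) :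
    ∃ g : C(X, Circ), ∀ x z, g (R.Q x z) = ((p : (F → C(Disc, ℝ)) × (F → Λ → ℤ)).1 x z : Circ) := by
  let c : C(ℝ, Circ) := ⟨fun r => (r : Circ), (AddCircle.isCoveringMap_coe (1 : ℝ)).continuous⟩
  refine R.exists_desc (fun x => c.comp (p.1.1 x)) fun x l t => ?_
  have h := p.2 x l t
  have h2 : p.1.1 x (R.a l t) = p.1.1 (R.σ l x) (R.a' l t) + p.1.2 x l := by linarith
  change ((p.1.1 x (R.a l t) : ℝ) : Circ) = ((p.1.1 (R.σ l x) (R.a' l t) : ℝ) : Circ)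
  rw [h2, AddCircle.coe_add, coe_int, add_zero]

theorem ext_circle {g g' : C(X, Circ)} (h : ∀ x z, g (R.Q x z) = g' (R.Q x z)) : g = g' := by
  ext y
  obtain ⟨x, z, rfl⟩ := R.surj y
  exact h x z

/-- The circle-valued function of a real function with integral jumps. -/
def toCircle [T2Space X] [Finite F] : R.jumps →+ C(X, Circ) :=
  AddMonoidHom.mk' (fun p => (R.exists_circleMap p).choose) fun p q => R.ext_circle fun x z => by
    rw [(R.exists_circleMap (p + q)).choose_spec, ContinuousMap.add_apply,
      (R.exists_circleMap p).choose_spec, (R.exists_circleMap q).choose_spec]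
    simp

theorem toCircle_apply [T2Space X] [Finite F] (p : R.jumps) (x : F) (z : Disc) :
    R.toCircle p (R.Q x z) = ((p : (F → C(Disc, ℝ)) × (F → Λ → ℤ)).1 x z : Circ) :=
  (R.exists_circleMap p).choose_spec x z

/-- A map to the circle lifts to `ℝ` on each disc, since discs are simply connected. Across an arc
two lifts differ by a continuous integer-valued function, which is constant. -/
theorem toCircle_surjective [T2Space X] [Finite F] : Function.Surjective R.toCircle := by
  intro g
  have hc := AddCircle.isCoveringMap_coe (1 : ℝ)
  have lift (x : F) : ∃ φ : C(Disc, ℝ), ∀ z, (φ z : Circ) = g (R.Q x z) := by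
    obtain ⟨r, hr⟩ := QuotientAddGroup.mk_surjective (g (R.Q x 0))
    obtain ⟨φ, ⟨-, h⟩, -⟩ := hc.existsUnique_continuousMap_lifts (g.comp (R.Q x)) 0 r hr
    exact ⟨φ, fun z => congrFun h z⟩
  choose φ hφ using lift
  have jump (x : F) (l : Λ) : ∃ n : ℤ, ∀ t, φ x (R.a l t) - φ (R.σ l x) (R.a' l t) = n := by
    have h0 (t) : ((φ x (R.a l t) - φ (R.σ l x) (R.a' l t) : ℝ) : Circ) = 0 := by
      rw [AddCircle.coe_sub, hφ, hφ, R.glue, sub_self]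
    obtain ⟨n, hn⟩ := (AddCircle.coe_eq_zero_iff 1).1 (h0 0)
    refine ⟨n, fun t => ?_⟩
    rw [← mul_one (n : ℝ), ← zsmul_eq_mul, hn]
    exact hc.const_of_comp (g := fun t => φ x (R.a l t) - φ (R.σ l x) (R.a' l t)) (by fun_prop)
      (fun t t' => (h0 t).trans (h0 t').symm) t 0
  choose n hn using jump
  refine ⟨⟨(φ, n), fun x l t => hn x l t⟩, R.ext_circle fun x z => ?_⟩
  rw [toCircle_apply, hφ]

/-- The jumps modulo two. -/
def parity : R.jumps →+ (F → Λ → ZMod 2) :=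
  AddMonoidHom.mk' (fun p x l => ((p : (F → C(Disc, ℝ)) × (F → Λ → ℤ)).2 x l : ZMod 2))
    fun p q => by ext x l; simp

theorem parity_apply (p : R.jumps) (x : F) (l : Λ) :
    R.parity p x l = ((p : (F → C(Disc, ℝ)) × (F → Λ → ℤ)).2 x l : ZMod 2) := rfl

theorem exists_int (m : ZMod 2) : ∃ n : ℤ, (n : ZMod 2) = m := ⟨m.val, by simp⟩

/-- Any jumps are realised with the functions `b l`, which are one on the outgoing arc `a l` and
zero on all other arcs. -/
theorem parity_surjective [Fintype Λ] : Function.Surjective R.parity := by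
  classical
  intro c
  choose n hn using fun x l => exists_int (c x l)
  refine ⟨⟨(fun x => ∑ l, (n x l : ℝ) • R.b l, n), fun x l t => ?_⟩, ?_⟩
  · simp only [ContinuousMap.coe_sum, Finset.sum_apply, ContinuousMap.coe_smul, Pi.smul_apply,
      smul_eq_mul, R.b_zero', mul_zero, Finset.sum_const_zero, sub_zero]
    rw [Finset.sum_eq_single l (fun k _ hk => by rw [R.b_zero _ _ _ hk.symm, mul_zero]) (by simp),
      R.b_one, mul_one]
  · ext x l; rw [parity_apply]; exact hn x l

/-- The coboundary. -/
def cobdry : (F → ZMod 2) →+ (F → Λ → ZMod 2) :=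
  AddMonoidHom.mk' (fun m x l => m x - m (R.σ l x)) fun m m' => by
    ext x l; simp only [Pi.add_apply]; ring

/-- If the map is the double of one with lifts `ψ x`, then on each disc its own lift differs from `2
ψ x` by an integer `m x`, and modulo two the jumps are the coboundary of `m`. Conversely,
subtracting such integers makes all jumps even, and the lifts can be halved. -/
theorem mem_double_iff [T2Space X] [Finite F] (p : R.jumps) :
    R.toCircle p ∈ (nsmulAddMonoidHom (α := C(X, Circ)) 2).range ↔ R.parity p ∈ R.cobdry.range := by
  have hc := AddCircle.isCoveringMap_coe (1 : ℝ)
  constructor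
  · rintro ⟨h, hh⟩
    obtain ⟨p', rfl⟩ := R.toCircle_surjective h
    have h0 (x z) : ((p.1.1 x z - 2 * p'.1.1 x z : ℝ) : Circ) = 0 := by
      have := congrArg (fun g : C(X, Circ) => g (R.Q x z)) hh
      simp only [nsmulAddMonoidHom_apply, ContinuousMap.coe_nsmul, Pi.smul_apply,
        toCircle_apply] at this
      rw [AddCircle.coe_sub, ← this, two_mul, AddCircle.coe_add, two_nsmul, sub_self]
    have hm (x : F) : ∃ m : ℤ, ∀ z, p.1.1 x z - 2 * p'.1.1 x z = m := by
      obtain ⟨n, hn⟩ := (AddCircle.coe_eq_zero_iff 1).1 (h0 x 0)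
      refine ⟨n, fun t => ?_⟩
      rw [← mul_one (n : ℝ), ← zsmul_eq_mul, hn]
      exact hc.const_of_comp (g := fun z => p.1.1 x z - 2 * p'.1.1 x z) (by fun_prop)
        (fun t t' => (h0 x t).trans (h0 x t').symm) t 0
    choose m hm using hm
    refine ⟨fun x => (m x : ZMod 2), ?_⟩
    ext x l
    have e1 := p.2 x l 0
    have e2 := p'.2 x l 0
    have e3 := hm x (R.a l 0)
    have e4 := hm (R.σ l x) (R.a' l 0)
    have e5 : p.1.2 x l = m x - m (R.σ l x) + 2 * p'.1.2 x l := by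
      have : (p.1.2 x l : ℝ) = m x - m (R.σ l x) + 2 * p'.1.2 x l := by linarith
      exact_mod_cast this
    have e6 : ((2 : ℤ) : ZMod 2) = 0 := by decide
    rw [parity_apply, e5]
    push_cast at e6 ⊢
    rw [e6, zero_mul, add_zero]; rfl
  · rintro ⟨m, hm⟩
    choose n hn using fun x => exists_int (m x)
    have h2 (x l) : ∃ k, p.1.2 x l - (n x - n (R.σ l x)) = 2 * k := by
      have := congrFun (congrFun hm x) l
      change m x - m (R.σ l x) = (p.1.2 x l : ZMod 2) at this
      have h3 : ((p.1.2 x l - (n x - n (R.σ l x)) : ℤ) : ZMod 2) = 0 := by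
        push_cast; rw [hn, hn, this, sub_self]
      exact (ZMod.intCast_zmod_eq_zero_iff_dvd _ 2).1 h3
    choose k hk using h2
    refine ⟨R.toCircle ⟨(fun x => (1 / 2 : ℝ) • (p.1.1 x - ContinuousMap.const _ (n x : ℝ)), k),
      fun x l t => ?_⟩, R.ext_circle fun x z => ?_⟩
    · have e1 := p.2 x l t
      have e2 : (p.1.2 x l : ℝ) - (n x - n (R.σ l x)) = 2 * k x l := by exact_mod_cast hk x l
      simp only [ContinuousMap.coe_smul, Pi.smul_apply, ContinuousMap.coe_sub, Pi.sub_apply,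
        ContinuousMap.const_apply, smul_eq_mul]
      linarith
    · simp only [nsmulAddMonoidHom_apply, Pi.smul_apply, toCircle_apply,
        ContinuousMap.coe_smul, ContinuousMap.coe_sub, Pi.sub_apply,
        ContinuousMap.const_apply, smul_eq_mul]
      rw [two_nsmul, ← AddCircle.coe_add, ← add_mul, ← two_mul,
        show (2 * (1 / 2) : ℝ) = 1 by norm_num, one_mul, AddCircle.coe_sub, coe_int, sub_zero]

/-- A function on the discs that is invariant under all `σ l` descends to a locally constant
function on the connected space `X`. -/
theorem card_ker_cobdry [T2Space X] [Finite F] [PreconnectedSpace X] [Nonempty F] :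
    Nat.card R.cobdry.ker = 2 := by
  have hconst (m : F → ZMod 2) (hm : m ∈ R.cobdry.ker) (x x' : F) : m x = m x' := by
    have h1 (x l) : m x = m (R.σ l x) := by
      have := congrFun (congrFun hm x) l
      exact sub_eq_zero.1 this
    obtain ⟨g, hg⟩ := R.exists_desc (Z := ℕ) (fun x => ContinuousMap.const _ (m x).val)
      fun x l t => by simp [← h1 x l]
    have := PreconnectedSpace.constant ‹_› g.continuous (x := R.Q x 0) (y := R.Q x' 0)
    rw [hg, hg] at this
    exact ZMod.val_injective 2 this
  obtain ⟨x0⟩ := ‹Nonempty F›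
  have e : R.cobdry.ker ≃ ZMod 2 :=
    { toFun := fun m => m.1 x0
      invFun := fun c => ⟨fun _ => c, by
        rw [AddMonoidHom.mem_ker]; ext x l; exact sub_self c⟩
      left_inv := fun m => Subtype.ext (funext fun x => hconst m.1 m.2 x0 x)
      right_inv := fun c => rfl }
  rw [Nat.card_congr e, Nat.card_zmod]

/-- Circle-valued functions modulo doubles. -/
abbrev CircQuot (X : Type) [TopologicalSpace X] : Type :=
  C(X, Circ) ⧸ (nsmulAddMonoidHom (α := C(X, Circ)) 2).range

/-- The maps `toCircle` and `parity` identify the quotient with the cokernel of the coboundary, the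
first cohomology modulo two of the graph with vertices `F` and `Nat.card F * Fintype.card Λ` edges.
Its order follows from that of the kernel. -/
theorem card_circQuot (R : Ribbons X F Λ) [T2Space X] [Finite F] [Fintype Λ] [PreconnectedSpace X] [Nonempty F] :
    Nat.card (CircQuot X) * 2 ^ Nat.card F = 2 * 2 ^ (Nat.card F * Fintype.card Λ) := by
  let p1 : R.jumps →+ CircQuot X := (QuotientAddGroup.mk' _).comp R.toCircle
  let p2 : R.jumps →+ (F → Λ → ZMod 2) ⧸ R.cobdry.range := (QuotientAddGroup.mk' _).comp R.parity
  have s1 : Function.Surjective p1 :=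
    (QuotientAddGroup.mk'_surjective _).comp R.toCircle_surjective
  have s2 : Function.Surjective p2 :=
    (QuotientAddGroup.mk'_surjective _).comp R.parity_surjective
  have hk : p1.ker = p2.ker := by
    ext p
    rw [AddMonoidHom.mem_ker, AddMonoidHom.mem_ker]
    change (QuotientAddGroup.mk _ : CircQuot X) = 0 ↔
      (QuotientAddGroup.mk _ : (F → Λ → ZMod 2) ⧸ R.cobdry.range) = 0
    rw [QuotientAddGroup.eq_zero_iff, QuotientAddGroup.eq_zero_iff]
    exact R.mem_double_iff p
  have c1 := Nat.card_congr (QuotientAddGroup.quotientKerEquivOfSurjective p1 s1).toEquiv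
  have c2 := Nat.card_congr (QuotientAddGroup.quotientKerEquivOfSurjective p2 s2).toEquiv
  rw [hk, c2] at c1
  have c3 := AddSubgroup.card_eq_card_quotient_mul_card_addSubgroup R.cobdry.range
  have c4 := AddSubgroup.card_eq_card_quotient_mul_card_addSubgroup R.cobdry.ker
  have c5 := Nat.card_congr (QuotientAddGroup.quotientKerEquivRange R.cobdry).toEquiv
  rw [c5, card_ker_cobdry] at c4
  have := Fintype.ofFinite F
  have e1 : Nat.card (F → ZMod 2) = 2 ^ Nat.card F := by
    rw [Nat.card_fun, Nat.card_zmod]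
  have e2 : Nat.card (F → Λ → ZMod 2) = 2 ^ (Nat.card F * Fintype.card Λ) := by
    rw [Nat.card_fun, Nat.card_fun, Nat.card_zmod, ← pow_mul, mul_comm, Nat.card_eq_fintype_card (α := Λ)]
  rw [e1] at c4
  rw [e2, c1] at c3
  rw [c4, c3]; ring

end Ribbons

/-- A covering space of a disc with ribbons. -/
theorem exists_ribbons_of_covering {X Y Λ : Type} [TopologicalSpace X] [TopologicalSpace Y]
    (R : Ribbons Y Unit Λ) {f : X → Y} (hf : IsCoveringMap f) :
    Nonempty (Ribbons X (f ⁻¹' {R.Q () 0}) Λ) := by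
  have lift (z₀ : Disc) (y : X) (hy : f y = R.Q () z₀) :
      ∃ q : C(Disc, X), q z₀ = y ∧ ∀ z, f (q z) = R.Q () z := by
    obtain ⟨q, ⟨h1, h2⟩, -⟩ := hf.existsUnique_continuousMap_lifts (R.Q ()) z₀ y hy
    exact ⟨q, h1, fun z => congrFun h2 z⟩
  -- One lift of the disc for each point over its centre. Lifts agreeing at one point agree
  -- throughout, so over every point of the disc these lifts enumerate the fibre.
  choose Q hQ0 hQ using fun x : f ⁻¹' {R.Q () 0} => lift 0 x.1 x.2
  have inj (x x' : f ⁻¹' {R.Q () 0}) (z : Disc) (h : Q x z = Q x' z) : x = x' := by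
    have := hf.eq_of_comp_eq (Q x).continuous (Q x').continuous
      (funext fun z => (hQ x z).trans (hQ x' z).symm) z h
    exact Subtype.ext (by rw [← hQ0 x, ← hQ0 x', this])
  have surj (z : Disc) (y : X) (hy : f y = R.Q () z) : ∃ x, Q x z = y := by
    obtain ⟨q, h1, h2⟩ := lift z y hy
    refine ⟨⟨q 0, h2 0⟩, ?_⟩
    have := hf.eq_of_comp_eq (Q ⟨q 0, h2 0⟩).continuous q.continuous
      (funext fun z => (hQ _ z).trans (h2 z).symm) 0 (hQ0 _)
    rw [this, h1]
  -- The lift of the arc is connected, hence it runs in a single neighbouring disc.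
  have step (l : Λ) (x : f ⁻¹' {R.Q () 0}) : ∃ x', ∀ t, Q x (R.a l t) = Q x' (R.a' l t) := by
    have e (t) : f (Q x (R.a l t)) = R.Q () (R.a' l t) := by rw [hQ]; exact R.glue () l t
    obtain ⟨x', hx'⟩ := surj _ _ (e 0)
    refine ⟨x', fun t => ?_⟩
    have := hf.eq_of_comp_eq (g₁ := fun t => Q x (R.a l t)) (g₂ := fun t => Q x' (R.a' l t))
      (by fun_prop) (by fun_prop) (funext fun t => (e t).trans (hQ x' _).symm) 0 hx'.symm
    exact congrFun this t
  choose σ hσ using step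
  refine ⟨⟨Q, σ, R.a, R.a', fun y => ?_, fun x l t => hσ l x t, fun x z x' z' h => ?_, R.b, R.b_one,
    R.b_zero, R.b_zero'⟩⟩
  · obtain ⟨_, z, hz⟩ := R.surj (f y)
    obtain ⟨x, hx⟩ := surj z y hz.symm
    exact ⟨x, z, hx⟩
  · have := congrArg f h
    rw [hQ, hQ] at this
    rcases R.eq _ _ _ _ this with ⟨-, rfl⟩ | ⟨l, t, ⟨rfl, rfl, -⟩ | ⟨rfl, rfl, -⟩⟩
    · exact Or.inl ⟨inj x x' z h, rfl⟩
    · exact Or.inr ⟨l, t, Or.inl ⟨rfl, rfl, inj _ _ _ (h.symm.trans (hσ l x t))⟩⟩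
    · exact Or.inr ⟨l, t, Or.inr ⟨rfl, rfl, inj _ _ _ (h.trans (hσ l x' t))⟩⟩

end Ribbon
end

noncomputable section
namespace Ribbon
open Set Topology GenusSurface
variable {α β : Type}

/-! ### Polygons with gaps -/

theorem at_gap (w : Word α) (a : α) (t u : ℝ) : At (wt 1 (gap w)) a t u ↔
    ∃ (i : ℕ) (ε : Bool), w[i]? = some (some (a, ε)) ∧ u = 2 * i + dir ε t := by
  induction w generalizing u with
  | nil => simp [wt, At]
  | cons x w ih =>
    have : wt 1 (gap (x :: w)) = (x, 1) :: (none, 1) :: wt 1 (gap w) := by simp [wt]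
    rw [this]
    simp only [At, ih, one_mul, reduceCtorEq, false_and, exists_false, false_or]
    constructor
    · rintro (⟨ε, rfl, rfl⟩ | ⟨i, ε, h, h'⟩)
      · exact ⟨0, ε, rfl, by simp⟩
      · exact ⟨i + 1, ε, by simpa using h, by push_cast; linarith⟩
    · rintro ⟨i, ε, h, rfl⟩
      rcases i with - | i
      · exact Or.inl ⟨ε, by simpa using h, by simp⟩
      · exact Or.inr ⟨i, ε, by simpa using h, by push_cast; ring⟩

theorem len_gap (w : Word α) : len (wt 1 (gap w)) = 2 * w.length := by
  have : (gap w).length = 2 * w.length := by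
    induction w with
    | nil => rfl
    | cons x w ih => simp [ih]; ring
  rw [len_wt, this]; push_cast; ring

/-- The boundary point at parameter `s` of the `i`-th letter of a word of length `n` with gaps. -/
def gapPt (n i : ℕ) (s : ℝ) : Disc := rim ((2 * i + s) / (2 * n))

/-- The numbers `2 * i + s` lie in `[0, 2 * n - 1]`, less than the full turn `2 * n`, and for
different `i` they lie in closed unit intervals which do not touch. -/
theorem gapPt_inj {n i j : ℕ} {s s' : ℝ} (hi : i < n) (hj : j < n) (hs : s ∈ Icc (0 : ℝ) 1)
    (hs' : s' ∈ Icc (0 : ℝ) 1) (h : gapPt n i s = gapPt n j s') : i = j ∧ s = s' := by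
  obtain ⟨k, hk⟩ := (rim_eq_iff _ _).1 h
  have hn : (0 : ℝ) < n := by exact_mod_cast (Nat.zero_le _).trans_lt hi
  have hi1 : (i : ℝ) + 1 ≤ n := by exact_mod_cast hi
  have hj1 : (j : ℝ) + 1 ≤ n := by exact_mod_cast hj
  have hi0 : (0 : ℝ) ≤ i := by positivity
  have hj0 : (0 : ℝ) ≤ j := by positivity
  obtain ⟨s0, s1⟩ := hs
  obtain ⟨s0', s1'⟩ := hs'
  have e : 2 * (i : ℝ) + s = 2 * j + s' + 2 * n * k := by
    field_simp at hk; linarith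
  have k1 : (k : ℝ) < 1 := by by_contra! hc; nlinarith
  have k2 : (-1 : ℝ) < k := by by_contra! hc; nlinarith
  have k1' : k < 1 := by exact_mod_cast k1
  have k2' : -1 < k := by exact_mod_cast k2
  obtain rfl : k = 0 := by omega
  rw [Int.cast_zero, mul_zero, add_zero] at e
  have i1 : (i : ℝ) < j + 1 := by linarith
  have i2 : (j : ℝ) < i + 1 := by linarith
  have i1' : i < j + 1 := by exact_mod_cast i1
  have i2' : j < i + 1 := by exact_mod_cast i2
  obtain rfl : i = j := by omega
  exact ⟨rfl, by linarith⟩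

theorem edge_gap (w : Word α) (a : α) (t : ℝ) (z : Disc) : (pol (gap w)).edge a t z ↔
    t ∈ Icc (0 : ℝ) 1 ∧ ∃ (i : ℕ) (ε : Bool), w[i]? = some (some (a, ε)) ∧
      z = gapPt w.length i (dir ε t) := by
  change (_ ∧ _) ↔ _
  refine and_congr_right fun _ => ?_
  simp only [at_gap, len_gap]
  constructor
  · rintro ⟨u, ⟨i, ε, h, rfl⟩, rfl⟩; exact ⟨i, ε, h, rfl⟩
  · rintro ⟨i, ε, h, rfl⟩; exact ⟨_, ⟨i, ε, h, rfl⟩, rfl⟩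

theorem dir_inj {ε : Bool} {t t' : ℝ} (h : dir ε t = dir ε t') : t = t' := by
  cases ε <;> simp [dir] at h <;> linarith

/-- This is the benefit of the gaps: labelled edges have no common end points, so gluing produces no
identifications beyond the obvious pairs. -/
theorem edge_gap_unique {w : Word α} {a a' : α} {t t' : ℝ} {z : Disc}
    (h : (pol (gap w)).edge a t z) (h' : (pol (gap w)).edge a' t' z) : a = a' ∧ t = t' := by
  obtain ⟨ht, i, ε, hi, rfl⟩ := (edge_gap _ _ _ _).1 h
  obtain ⟨ht', i', ε', hi', e⟩ := (edge_gap _ _ _ _).1 h'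
  obtain ⟨rfl, e'⟩ := gapPt_inj (List.getElem?_eq_some_iff.1 hi).1 (List.getElem?_eq_some_iff.1 hi').1
    (dir_mem ht) (dir_mem ht') e
  rw [hi] at hi'
  simp only [Option.some.injEq, Prod.mk.injEq] at hi'
  obtain ⟨rfl, rfl⟩ := hi'
  exact ⟨rfl, dir_inj e'⟩

theorem Scheme.eq_or_rel_of_eqvGen {S : Scheme α}
    (hS : ∀ {a a' t t' x}, S.edge a t x → S.edge a' t' x → a = a' ∧ t = t') {x y : S.carrier}
    (h : Relation.EqvGen S.rel x y) : x = y ∨ S.rel x y := by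
  induction h with
  | rel x y h => exact Or.inr h
  | refl x => exact Or.inl rfl
  | symm x y _ ih =>
    rcases ih with rfl | ⟨a, t, h1, h2⟩
    · exact Or.inl rfl
    · exact Or.inr ⟨a, t, h2, h1⟩
  | trans x y z _ _ ih1 ih2 =>
    rcases ih1 with rfl | ⟨a, t, h3, h4⟩
    · exact ih2
    · rcases ih2 with rfl | ⟨a', t', h5, h6⟩
      · exact Or.inr ⟨a, t, h3, h4⟩
      · obtain ⟨rfl, rfl⟩ := hS h4 h5
        exact Or.inr ⟨a, t, h3, h6⟩

/-- When edges are disjoint, no further identifications arise by transitivity. -/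
theorem Scheme.mk_eq_iff {S : Scheme α}
    (hS : ∀ {a a' t t' x}, S.edge a t x → S.edge a' t' x → a = a' ∧ t = t') {x y : S.carrier} :
    S.mk' x = S.mk' y ↔ x = y ∨ S.rel x y := by
  constructor
  · exact fun h => Scheme.eq_or_rel_of_eqvGen hS (Quot.eqvGen_exact h)
  · rintro (rfl | ⟨a, t, h1, h2⟩)
    · rfl
    · exact Scheme.glue h1 h2

theorem mk_eq_iff {w : Word α} {z z' : Disc} :
    (pol (gap w)).mk' z = (pol (gap w)).mk' z' ↔ z = z' ∨ (pol (gap w)).rel z z' :=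
  Scheme.mk_eq_iff edge_gap_unique

theorem mem_iword (L : List (Item α)) (a : α) (ε : Bool) :
    some (a, ε) ∈ iword L ↔ a ∈ iletters L := by
  induction L with
  | nil => simp
  | cons i L ih =>
    simp only [iword_cons, iletters_cons, List.mem_append, ih]
    refine or_congr_left ?_
    rcases i with ⟨b, δ, c, δ'⟩ | ⟨b, δ⟩
    · cases ε <;> cases δ <;> cases δ' <;> simp [Item.word, Item.letters, or_comm]
    · cases ε <;> cases δ <;> simp [Item.word, Item.letters]

theorem none_notMem_iword (L : List (Item α)) : none ∉ iword L := by
  induction L with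
  | nil => simp
  | cons i L ih => rcases i with ⟨b, δ, c, δ'⟩ | ⟨b, δ⟩ <;> simp [Item.word, ih]

theorem nodup_iword (L : List (Item α)) (h : (iletters L).Nodup) : (iword L).Nodup := by
  induction L with
  | nil => simp
  | cons i L ih =>
    simp only [iletters_cons, List.nodup_append] at h
    rw [iword_cons, List.nodup_append]
    refine ⟨?_, ih h.2.1, ?_⟩
    · have := h.1
      rcases i with ⟨b, δ, c, δ'⟩ | ⟨b, δ⟩
      · simp only [Item.letters, List.nodup_cons, List.mem_singleton] at this
        have hbc := this.1
        simp [Item.word, hbc, Ne.symm hbc]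
      · simp [Item.word]
    · rintro x hx y hy rfl
      rcases x with - | ⟨a, ε⟩
      · exact none_notMem_iword L hy
      · rw [mem_iword] at hy
        have h1 : a ∈ iletters [i] := (mem_iword [i] a ε).1 (by simpa using hx)
        exact h.2.2 a (by simpa using h1) a hy rfl

/-- The polygon of a product of items, as a disc with ribbons. -/
theorem exists_ribbons_gap [DecidableEq α] (L : List (Item α)) (hL : (iletters L).Nodup) {Y : Type}
    [TopologicalSpace Y] (e : (pol (gap (iword L))).space ≃ₜ Y) :
    Nonempty (Ribbons Y Unit (iletters L).toFinset) := by
  set w := iword L with hw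
  have hn := nodup_iword L hL
  have ex (l : (iletters L).toFinset) (ε : Bool) : ∃ i : ℕ, w[i]? = some (some (l.1, ε)) :=
    List.mem_iff_getElem?.1 ((mem_iword L _ _).2 (List.mem_toFinset.1 l.2))
  choose I hI using ex
  have hlt (l ε) : I l ε < w.length := (List.getElem?_eq_some_iff.1 (hI l ε)).1
  have Iinj {l l' ε ε'} (h : I l ε = I l' ε') : l = l' ∧ ε = ε' := by
    have := (hI l ε).symm.trans (h ▸ hI l' ε')
    simp only [Option.some.injEq, Prod.mk.injEq] at this
    exact ⟨Subtype.ext this.1, this.2⟩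
  have huniq {i : ℕ} {l : (iletters L).toFinset} {ε : Bool} (h : w[i]? = some (some (l.1, ε))) :
      i = I l ε :=
    (List.getElem?_inj (List.getElem?_eq_some_iff.1 h).1 hn).1 (h.trans (hI l ε).symm)
  have hcont (n i : ℕ) (ε : Bool) : Continuous fun t : unitInterval => gapPt n i (dir ε t) := by
    have := continuous_rim
    unfold gapPt
    cases ε <;> simp only [dir, if_true, Bool.false_eq_true, if_false] <;> fun_prop
  let A (ε : Bool) (l : (iletters L).toFinset) : C(unitInterval, Disc) :=
    ⟨fun t => gapPt w.length (I l ε) (dir ε t), hcont _ _ _⟩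
  have hA (ε l t) : A ε l t = gapPt w.length (I l ε) (dir ε t) := rfl
  have hedge (ε l) (t : unitInterval) : (pol (gap w)).edge l.1 t (A ε l t) :=
    (edge_gap _ _ _ _).2 ⟨t.2, I l ε, ε, hI l ε, rfl⟩
  have hAinj {ε ε' l l' t t'} (h : A ε l t = A ε' l' t') : l = l' ∧ ε = ε' :=
    Iinj (gapPt_inj (hlt _ _) (hlt _ _) (dir_mem t.2) (dir_mem t'.2) h).1
  -- Urysohn's lemma, applicable since the arcs are compact and pairwise disjoint.
  have bump (l : (iletters L).toFinset) : ∃ b : C(Disc, ℝ), (∀ t, b (A true l t) = 1) ∧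
      (∀ k t, k ≠ l → b (A true k t) = 0) ∧ ∀ k t, b (A false k t) = 0 := by
    have c1 (ε k) : IsClosed (range (A ε k)) := (isCompact_range (A ε k).continuous).isClosed
    obtain ⟨b, h0, h1, -⟩ := exists_continuous_zero_one_of_isClosed
      (s := (⋃ k : {k // k ≠ l}, range (A true k.1)) ∪ ⋃ k, range (A false k)) (t := range (A true l))
      ((isClosed_iUnion_of_finite fun k => c1 _ _).union (isClosed_iUnion_of_finite fun k => c1 _ _))
      (c1 _ _) (by
        rw [Set.disjoint_left]
        rintro z (hz | hz) ⟨t, rfl⟩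
        · obtain ⟨k, t', ht⟩ := mem_iUnion.1 hz
          exact k.2 (hAinj ht).1
        · obtain ⟨k, t', ht⟩ := mem_iUnion.1 hz
          exact Bool.noConfusion (hAinj ht).2)
    exact ⟨b, fun t => h1 ⟨t, rfl⟩, fun k t hk => h0 (Or.inl (mem_iUnion.2 ⟨⟨k, hk⟩, t, rfl⟩)),
      fun k t => h0 (Or.inr (mem_iUnion.2 ⟨k, t, rfl⟩))⟩
  choose b hb1 hb2 hb3 using bump
  refine ⟨⟨fun _ => ⟨fun z => e ((pol (gap w)).mk' z), e.continuous.comp (Scheme.continuous_mk' _)⟩,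
    fun _ _ => (), A true, A false, fun y => ?_, fun _ l t => ?_, fun x z x' z' h => ?_, b, hb1,
    fun l k t hk => hb2 l k t hk, hb3⟩⟩
  · obtain ⟨z, hz⟩ := (Scheme.isQuotientMap_mk' _).surjective (e.symm y)
    exact ⟨(), z, by simp [hz]⟩
  · exact congrArg e (Scheme.glue (hedge true l t) (hedge false l t))
  · rcases mk_eq_iff.1 (e.injective h) with rfl | ⟨a, t, h1, h2⟩
    · exact Or.inl ⟨rfl, rfl⟩
    · obtain ⟨ht, i, ε, hi, rfl⟩ := (edge_gap _ _ _ _).1 h1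
      obtain ⟨-, i', ε', hi', rfl⟩ := (edge_gap _ _ _ _).1 h2
      have ha : a ∈ (iletters L).toFinset :=
        List.mem_toFinset.2 ((mem_iword L a ε).1 (List.mem_iff_getElem?.2 ⟨i, hi⟩))
      obtain rfl := huniq (l := ⟨a, ha⟩) hi
      obtain rfl := huniq (l := ⟨a, ha⟩) hi'
      cases ε <;> cases ε'
      · exact Or.inl ⟨rfl, rfl⟩
      · exact Or.inr ⟨⟨a, ha⟩, ⟨t, ht⟩, Or.inr ⟨rfl, rfl, rfl⟩⟩
      · exact Or.inr ⟨⟨a, ha⟩, ⟨t, ht⟩, Or.inl ⟨rfl, rfl, rfl⟩⟩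
      · exact Or.inl ⟨rfl, rfl⟩

theorem stdItems_letters (s : List Bool) : ∀ n, (iletters (stdItems s n)).Nodup ∧
    (∀ a ∈ iletters (stdItems s n), n ≤ a) ∧
    (iletters (stdItems s n)).length = 2 * s.count true + s.count false := by
  induction s with
  | nil => intro n; simp [stdItems]
  | cons x s ih =>
    intro n
    cases x
    · obtain ⟨h1, h2, h3⟩ := ih (n + 1)
      simp only [stdItems, iletters_cons, Item.letters, List.cons_append, List.nil_append,
        List.nodup_cons, List.mem_cons, forall_eq_or_imp, List.length_cons, h3]
      refine ⟨⟨fun h => by have := h2 n h; omega, h1⟩,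
        ⟨le_rfl, fun a ha => by have := h2 a ha; omega⟩, ?_⟩
      simp; ring
    · obtain ⟨h1, h2, h3⟩ := ih (n + 2)
      simp only [stdItems, iletters_cons, Item.letters, List.cons_append, List.nil_append,
        List.nodup_cons, List.mem_cons, forall_eq_or_imp, List.length_cons, h3]
      refine ⟨⟨?_, fun h => by have := h2 _ h; omega, h1⟩, ⟨le_rfl, by omega,
        fun a ha => by have := h2 a ha; omega⟩, ?_⟩
      · rintro (h | h)
        · omega
        · have := h2 n h; omega
      · simp; ring

/-- A commutator contributes two ribbons and a trivial pair one. -/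
theorem surface_ribbons (g n : ℕ) : ∃ (Λ : Type) (_ : Fintype Λ), Fintype.card Λ = 2 * g + n ∧
    Nonempty (Ribbons (surface g (n + 1)) Unit Λ) := by
  obtain ⟨e⟩ := surface_equiv_std g n
  obtain ⟨h1, -, h3⟩ := stdItems_letters (List.replicate g true ++ List.replicate n false) 0
  refine ⟨_, inferInstance, ?_, exists_ribbons_gap _ h1 e⟩
  rw [Fintype.card_coe, List.toFinset_card_of_nodup h1, h3]
  simp [List.count_replicate]

theorem surface_preconnected (g n : ℕ) : PreconnectedSpace (surface g (n + 1)) := by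
  obtain ⟨Λ, _, -, ⟨R⟩⟩ := surface_ribbons g n
  have : Function.Surjective (R.Q ()) := fun y => by
    obtain ⟨_, z, hz⟩ := R.surj y; exact ⟨z, hz⟩
  exact ⟨by rw [← this.range_eq]; exact isPreconnected_range (R.Q ()).continuous⟩

/-- The genus of a covering surface. -/
theorem genus_of_covering (g n : ℕ) (f : surface g (n + 1) → surface 0 (n + 1))
    (hf : IsCoveringMap f) (hc : ∀ y, (f ⁻¹' {y}).encard = (n + 1 : ℕ)) :
    2 * g + n + (n + 1) = 1 + (n + 1) * n := by
  have := surface_preconnected g n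
  obtain ⟨Λ, _, hΛ, ⟨R⟩⟩ := surface_ribbons g n
  obtain ⟨M, _, hM, ⟨T⟩⟩ := surface_ribbons 0 n
  obtain ⟨T'⟩ := exists_ribbons_of_covering T hf
  have hfib := hc (T.Q () 0)
  have hfin : (f ⁻¹' {T.Q () 0}).Finite := finite_of_encard_eq_coe hfib
  have hcard : Nat.card (f ⁻¹' {T.Q () 0}) = n + 1 := by
    rw [Nat.card_coe_set_eq, ncard, hfib]; rfl
  have : Finite (f ⁻¹' {T.Q () 0}) := hfin
  have : Nonempty (f ⁻¹' {T.Q () 0}) := by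
    by_contra h
    have := not_nonempty_iff.1 h
    rw [Nat.card_of_isEmpty] at hcard
    omega
  -- The same quotient is counted twice: with the polygon of the covering surface, and with the `n +
  -- 1` lifts of the base disc, each of which carries `n` outgoing ribbons.
  have h1 := R.card_circQuot
  have h2 := T'.card_circQuot
  rw [show Nat.card Unit = 1 from Nat.card_unique, hΛ, pow_one, one_mul, mul_comm 2] at h1
  rw [hcard, hM, Nat.eq_of_mul_eq_mul_right (by norm_num) h1, ← pow_add, ← pow_succ'] at h2
  have := Nat.pow_right_injective le_rfl h2
  rw [this]; ring

end Ribbon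
end

/-! ### Sufficiency: construction of a cyclic covering -/

noncomputable section
namespace Ribbon
open Set Topology GenusSurface
variable {α β : Type}

/-! ### Splitting off commutators and pairs -/

theorem notIn_flatMap {ι : Type} (a : α) (l : List ι) (f : ι → Word α) :
    NotIn a (l.flatMap f) ↔ ∀ i ∈ l, NotIn a (f i) := by
  simp only [NotIn, List.mem_flatMap, not_exists, not_and]
  exact ⟨fun h i hi ε => h ε i hi, fun h ε i hi => h i hi ε⟩

/-- The items have distinct labels which do not occur in `v`. -/
def Apart (v : Word α) (M : List (Item α)) : Prop :=
  (iletters M).Nodup ∧ ∀ a ∈ iletters M, NotIn a v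

/-- `v` reduces to `w`, splitting off `c` commutators and `d` pairs. -/
def Red (c d : ℕ) (v w : Word α) : Prop :=
  ∀ M, Apart v M → ∃ N, Apart w N ∧ GEqv (v ++ iword M) (w ++ iword N) ∧
    N.countP Item.isComm = M.countP Item.isComm + c ∧
    N.countP (fun i => !i.isComm) = M.countP (fun i => !i.isComm) + d

theorem Red.refl (v : Word α) : Red 0 0 v v := fun M hM => ⟨M, hM, Eqv.refl _ _, rfl, rfl⟩

theorem Red.trans {c d c' d' : ℕ} {u v w : Word α} (h : Red c d u v) (h' : Red c' d' v w) :
    Red (c + c') (d + d') u w := fun M hM => by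
  obtain ⟨N, hN, e, h1, h2⟩ := h M hM
  obtain ⟨N', hN', e', h1', h2'⟩ := h' N hN
  exact ⟨N', hN', e.trans e', by omega, by omega⟩

/-- Splitting off the commutator reverses the order of the three enclosed blocks; the commutator
then commutes with all the rest and is moved to the end of the list. -/
theorem Red.comm [Infinite α] (a b : α) (ε δ : Bool) (X P Q R S : Word α) (hab : a ≠ b)
    (ha : NotIn a (X ++ (P ++ (Q ++ (R ++ S))))) (hb : NotIn b (X ++ (P ++ (Q ++ (R ++ S))))) :
    Red 1 0 (X ++ some (a, ε) :: (P ++ some (b, δ) :: (Q ++ some (a, !ε) :: (R ++ some (b, !δ) :: S))))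
      (X ++ (R ++ (Q ++ (P ++ S)))) := by
  intro M ⟨hM, hM'⟩
  simp only [notIn_append, notIn_cons_some] at ha hb hM'
  have haM : a ∉ iletters M := fun h => (hM' a h).2.1 rfl
  have hbM : b ∉ iletters M := fun h => (hM' b h).2.2.2.1 rfl
  have haM' := (notIn_iword M a).2 haM
  have hbM' := (notIn_iword M b).2 hbM
  refine ⟨M ++ [.comm a ε b δ], ⟨?_, ?_⟩, ?_, by simp [Item.isComm], by simp [Item.isComm]⟩
  · simp only [iletters_append, iletters_cons, iletters_nil, Item.letters, List.append_nil,
      List.nodup_append, hM, List.nodup_cons, List.mem_cons, List.not_mem_nil, or_false, hab,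
      not_false_eq_true, List.nodup_nil, and_self, true_and]
    rintro x hx y (rfl | rfl) rfl
    exacts [haM hx, hbM hx]
  · simp only [iletters_append, iletters_cons, iletters_nil, Item.letters, List.append_nil,
      List.mem_append, List.mem_cons, List.not_mem_nil, or_false, notIn_append]
    rintro x (hx | rfl | rfl)
    · have := hM' x hx; tauto
    · tauto
    · tauto
  · have hE := moves_gEqv (α := α)
    have h1 := hE.rot X (some (a, ε) :: (P ++ some (b, δ) :: (Q ++ some (a, !ε) ::
      (R ++ some (b, !δ) :: (S ++ iword M)))))
    have h2 := hE.split_comm a b ε δ P Q R (S ++ (iword M ++ X)) trivial trivial hab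
      (by simp [ha, haM']) (by simp [hb, hbM'])
    have h3 := hE.comm_comm a b ε δ (S ++ iword M) (X ++ (R ++ (Q ++ P))) trivial trivial hab
      (by simp [ha, haM']) (by simp [hb, hbM'])
    have h4 := hE.rot [some (a, ε), some (b, δ), some (a, !ε), some (b, !δ)]
      (X ++ (R ++ (Q ++ (P ++ (S ++ iword M)))))
    simp only [List.append_assoc, List.cons_append, List.nil_append, iword_append, iword_cons,
      iword_nil, Item.word, List.append_nil] at h1 h2 h3 h4 ⊢
    exact hE.trans h1 (hE.trans h2 (hE.trans h3 h4))

theorem Red.pair [Infinite α] (a : α) (ε : Bool) (X Y : Word α) (ha : NotIn a (X ++ Y)) :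
    Red 0 1 (X ++ some (a, ε) :: some (a, !ε) :: Y) (X ++ Y) := by
  intro M ⟨hM, hM'⟩
  simp only [notIn_append, notIn_cons_some] at ha hM'
  have haM : a ∉ iletters M := fun h => (hM' a h).2.1 rfl
  have haM' := (notIn_iword M a).2 haM
  refine ⟨M ++ [.pair a ε], ⟨?_, ?_⟩, ?_, by simp [Item.isComm], by simp [Item.isComm]⟩
  · simp only [iletters_append, iletters_cons, iletters_nil, Item.letters, List.append_nil,
      List.nodup_append, hM, List.nodup_cons, List.mem_cons, List.not_mem_nil, or_false,
      not_false_eq_true, List.nodup_nil, and_self, true_and]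
    rintro x hx y rfl rfl
    exact haM hx
  · simp only [iletters_append, iletters_cons, iletters_nil, Item.letters, List.append_nil,
      List.mem_append, List.mem_cons, List.not_mem_nil, or_false, notIn_append]
    rintro x (hx | rfl)
    · have := hM' x hx; tauto
    · tauto
  · have hE := moves_gEqv (α := α)
    have h1 := hE.rot X (some (a, ε) :: some (a, !ε) :: (Y ++ iword M))
    have h2 := hE.pair_comm a ε (Y ++ iword M) X trivial (by simp [ha, haM'])
    have h3 := hE.rot [some (a, ε), some (a, !ε)] (X ++ (Y ++ iword M))
    simp only [List.append_assoc, List.cons_append, List.nil_append, iword_append, iword_cons,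
      iword_nil, Item.word, List.append_nil] at h1 h2 h3 ⊢
    exact hE.trans h1 (hE.trans h2 h3)

/-- `x 0, …, x n` are distinct and `x (n + 1) = x 0`. -/
structure IsCycle (n : ℕ) (x : ℕ → α) : Prop where
  last : x (n + 1) = x 0
  ne : ∀ i j, 1 ≤ i → i ≤ n → j ≤ n + 1 → i ≠ j → x i ≠ x j

/-- The letters `x k` and `y k` at the front interlock with their partners in the next block.
Splitting off their commutator pulls `x (k + 1)` and `y (k + 1)` to the front, so the shape persists
with `k + 1` for `k`; the material passed over is collected in `U`. -/
theorem Red.double_aux [Infinite α] {n : ℕ} {x y : ℕ → α} (hx : IsCycle n x) (hy : IsCycle n y)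
    (hxy : ∀ i j, x i ≠ y j) (W : ℕ → Word α) (hxW : ∀ i j, NotIn (x i) (W j))
    (hyW : ∀ i j, NotIn (y i) (W j)) (m : ℕ) : ∀ (k : ℕ) (U : Word α), 1 ≤ k → k + m = n + 1 →
    (∀ i, NotIn (x i) U) → (∀ i, NotIn (y i) U) →
    Red m 0 (some (x 0, true) :: some (x k, false) :: some (y k, true) :: some (y 0, false) ::
      (U ++ (List.range' k m).flatMap fun i => some (x i, true) :: some (x (i + 1), false) ::
        some (y (i + 1), true) :: some (y i, false) :: W i))
      (some (x 0, true) :: some (x 0, false) :: some (y 0, true) :: some (y 0, false) ::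
        (U ++ (List.range' k m).flatMap W)) := by
  induction m with
  | zero =>
    intro k U _ hk _ _
    obtain rfl : k = n + 1 := by omega
    rw [hx.last, hy.last]
    exact Red.refl _
  | succ m ih =>
    intro k U hk hkm hxU hyU
    have h := ih (k + 1) (U ++ W k) (by omega) (by omega) (fun i => by simp [hxU, hxW])
      (fun i => by simp [hyU, hyW])
    have h0 := Red.comm (x k) (y k) false true [some (x 0, true)] [] (some (y 0, false) :: U)
      [some (x (k + 1), false), some (y (k + 1), true)]
      (W k ++ (List.range' (k + 1) m).flatMap fun i => some (x i, true) :: some (x (i + 1), false) ::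
        some (y (i + 1), true) :: some (y i, false) :: W i) (hxy k k) (by
          have e0 := hx.ne k 0 hk (by omega) (by omega) (by omega)
          have e1 := hx.ne k (k + 1) hk (by omega) (by omega) (by omega)
          simp only [notIn_append, notIn_cons_some, notIn_nil, notIn_flatMap, e0, e1, hxy, hxU, hxW,
            List.mem_range'_1, ne_eq, not_false_eq_true, and_true, true_and]
          intro i hi
          exact ⟨hx.ne k i hk (by omega) (by omega) (by omega),
            hx.ne k (i + 1) hk (by omega) (by omega) (by omega)⟩) (by
          have e0 := hy.ne k 0 hk (by omega) (by omega) (by omega)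
          have e1 := hy.ne k (k + 1) hk (by omega) (by omega) (by omega)
          simp only [notIn_append, notIn_cons_some, notIn_nil, notIn_flatMap, e0, e1, (hxy _ _).symm,
            hyU, hyW, List.mem_range'_1, ne_eq, not_false_eq_true, and_true, true_and]
          intro i hi
          exact ⟨hy.ne k (i + 1) hk (by omega) (by omega) (by omega),
            hy.ne k i hk (by omega) (by omega) (by omega)⟩)
    simp only [List.range'_succ, List.flatMap_cons, List.append_assoc, List.cons_append,
      List.nil_append, Bool.not_true, Bool.not_false] at h h0 ⊢
    have := h0.trans h
    rwa [Nat.add_comm 1 m] at this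

/-- When the cycle closes, the front is `x 0 (x 0)⁻¹ y 0 (y 0)⁻¹`, which accounts for the two pairs.
-/
theorem Red.double [Infinite α] {n : ℕ} {x y : ℕ → α} (hx : IsCycle n x) (hy : IsCycle n y)
    (hxy : ∀ i j, x i ≠ y j) (W : ℕ → Word α) (hxW : ∀ i j, NotIn (x i) (W j))
    (hyW : ∀ i j, NotIn (y i) (W j)) :
    Red n 2 ((List.range (n + 1)).flatMap fun i => some (x i, true) :: some (x (i + 1), false) ::
        some (y (i + 1), true) :: some (y i, false) :: W i)
      ((List.range (n + 1)).flatMap W) := by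
  have h := Red.double_aux hx hy hxy W hxW hyW n 1 (W 0) le_rfl (by omega) (fun i => hxW i 0)
    (fun i => hyW i 0)
  have hN (a : α) (ha : ∀ j, NotIn a (W j)) : NotIn a (W 0 ++ (List.range' 1 n).flatMap W) := by
    simp [notIn_flatMap, ha]
  have h1 := Red.pair (x 0) true [] (some (y 0, true) :: some (y 0, false) ::
    (W 0 ++ (List.range' 1 n).flatMap W)) (by
      have := hN _ (hxW 0)
      simpa [hxy] using this)
  have h2 := Red.pair (y 0) true [] (W 0 ++ (List.range' 1 n).flatMap W) (hN _ (hyW 0))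
  have := h.trans (h1.trans h2)
  rw [List.range_eq_range', List.range'_succ]
  simpa using this

/-- Without a second cycle, the consecutive letters `x k` and `x (k + 1)` interlock and give a
commutator. Two letters are used at a time, so their number must be even. -/
theorem Red.single_aux [Infinite α] {n : ℕ} {x : ℕ → α} (hx : IsCycle n x) (m : ℕ) :
    ∀ k : ℕ, 1 ≤ k → k + 2 * m = n + 1 →
    Red m 0 (some (x k, true) :: some (x 0, false) ::
      ((List.range' k (2 * m)).flatMap fun i => [some (x (i + 1), true), some (x i, false)]))
      [some (x 0, true), some (x 0, false)] := by
  induction m with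
  | zero =>
    intro k _ hk
    obtain rfl : k = n + 1 := by omega
    rw [hx.last]
    exact Red.refl _
  | succ m ih =>
    intro k hk hkm
    have h := ih (k + 2) (by omega) (by omega)
    have h0 := Red.comm (x k) (x (k + 1)) true true [] [some (x 0, false)] [] [some (x (k + 2), true)]
      ((List.range' (k + 2) (2 * m)).flatMap fun i => [some (x (i + 1), true), some (x i, false)])
      (hx.ne k (k + 1) hk (by omega) (by omega) (by omega)) (by
        have e0 := hx.ne k 0 hk (by omega) (by omega) (by omega)
        have e1 := hx.ne k (k + 2) hk (by omega) (by omega) (by omega)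
        simp only [notIn_append, notIn_cons_some, notIn_nil, notIn_flatMap, e0, e1,
          List.mem_range'_1, ne_eq, not_false_eq_true, and_true, true_and]
        intro i hi
        exact ⟨hx.ne k (i + 1) hk (by omega) (by omega) (by omega),
          hx.ne k i hk (by omega) (by omega) (by omega)⟩) (by
        have e0 := hx.ne (k + 1) 0 (by omega) (by omega) (by omega) (by omega)
        have e1 := hx.ne (k + 1) (k + 2) (by omega) (by omega) (by omega) (by omega)
        simp only [notIn_append, notIn_cons_some, notIn_nil, notIn_flatMap, e0, e1,
          List.mem_range'_1, ne_eq, not_false_eq_true, and_true, true_and]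
        intro i hi
        exact ⟨hx.ne (k + 1) (i + 1) (by omega) (by omega) (by omega) (by omega),
          hx.ne (k + 1) i (by omega) (by omega) (by omega) (by omega)⟩)
    have := h0.trans h
    rw [show 2 * (m + 1) = 2 * m + 1 + 1 by ring, List.range'_succ, List.range'_succ]
    simp only [List.flatMap_cons, List.cons_append, List.nil_append, Bool.not_true] at this ⊢
    rwa [Nat.add_comm 1 m] at this

theorem Red.single [Infinite α] {m : ℕ} {x : ℕ → α} (hx : IsCycle (2 * m) x) :
    Red m 1 ((List.range (2 * m + 1)).flatMap fun i => [some (x (i + 1), true), some (x i, false)])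
      [] := by
  have h := Red.single_aux hx m 1 le_rfl (by omega)
  have := h.trans (Red.pair (x 0) true [] [] (by simp))
  rw [List.range_eq_range', List.range'_succ]
  simpa using this

/-! ### Merging a chain of polygons -/

/-- The polygons `(e i)⁻¹ (U i) (e (i + 1))` for `k ≤ i < k + m`. -/
def chain (e : ℕ → α) (U : ℕ → Word α) : ℕ → ℕ → Scheme α
  | _, 0 => Scheme.empty
  | k, m + 1 => (pol (gap (some (e k, false) :: (U k ++ [some (e (k + 1), true)])))).sum
      (chain e U (k + 1) m)

/-- Merging leaves an unlabelled edge at either end of the vanished edge. Each of them is absorbed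
by a gap. -/
theorem merge_gap (A B : Word α) (a : α) (S : Scheme α) (hA : NotIn a A) (hB : NotIn a B)
    (hS : S.Free a) :
    ((pol (gap (A ++ [some (a, true)]))).sum ((pol (gap (some (a, false) :: B))).sum S)).Equiv
      ((pol (gap (A ++ B))).sum S) := by
  have h1 := merge' (none :: gap A) (none :: gap B) a true S (by simp) (by simp) (by simpa using hA)
    (by simpa using hB) hS
  have h2 := (rotate (gap A ++ [some (a, true)]) [none]).sum
    (Scheme.Iso.refl ((pol (gap (some (a, false) :: B))).sum S))
  have h3 := Eqv.none_gap_gap S A B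
  simp only [gap_append, gap_cons, gap_nil, List.append_assoc, List.cons_append, List.nil_append,
    Bool.not_true] at h1 h2 h3 ⊢
  exact h2.equiv.trans (h1.trans h3)

theorem free_chain (e : ℕ → α) (U : ℕ → Word α) (a : α) (m : ℕ) : ∀ k,
    (∀ i, k ≤ i → i ≤ k + m → a ≠ e i) → (∀ i, NotIn a (U i)) → (chain e U k m).Free a := by
  induction m with
  | zero => exact fun k _ _ => Scheme.free_empty a
  | succ m ih =>
    intro k h hU
    refine Scheme.free_sum (free_pol ?_) (ih (k + 1) (fun i h1 h2 => h i (by omega) (by omega)) hU)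
    simp [h k le_rfl (by omega), h (k + 1) (by omega) (by omega), hU]

/-- Each `e k` with `1 ≤ k ≤ n` occurs only at the place where two successive polygons meet, so they
can be merged one after another. The label `e 0` remains, at both ends. -/
theorem merge_chain_aux {n : ℕ} {e : ℕ → α} (he : IsCycle n e) (U : ℕ → Word α)
    (hU : ∀ i j, NotIn (e i) (U j)) (m : ℕ) : ∀ (k : ℕ) (A : Word α), 1 ≤ k → k + m = n + 1 →
    (∀ i, NotIn (e i) A) →
    ((pol (gap (some (e 0, false) :: (A ++ [some (e k, true)])))).sum (chain e U k m)).Equiv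
      (pol (gap (some (e 0, false) :: (A ++ ((List.range' k m).flatMap U ++ [some (e 0, true)]))))) := by
  induction m with
  | zero =>
    intro k A _ hk _
    obtain rfl : k = n + 1 := by omega
    rw [he.last]
    exact (Scheme.sum_empty _).equiv
  | succ m ih =>
    intro k A hk hkm hA
    have h := ih (k + 1) (A ++ U k) (by omega) (by omega) fun i => by simp [hA, hU]
    have h0 := merge_gap (some (e 0, false) :: A) (U k ++ [some (e (k + 1), true)]) (e k)
      (chain e U (k + 1) m) (by
        simp [hA, he.ne k 0 hk (by omega) (by omega) (by omega)]) (by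
        simp [hU, he.ne k (k + 1) hk (by omega) (by omega) (by omega)])
      (free_chain e U _ m _ (fun i h1 h2 => he.ne k i hk (by omega) (by omega) (by omega)) (hU k))
    simp only [List.range'_succ, List.flatMap_cons, List.append_assoc, List.cons_append] at h h0 ⊢
    exact h0.trans h

theorem merge_chain {n : ℕ} {e : ℕ → α} (he : IsCycle n e) (U : ℕ → Word α)
    (hU : ∀ i j, NotIn (e i) (U j)) : (chain e U 0 (n + 1)).Equiv
      (pol (gap (some (e 0, false) :: ((List.range (n + 1)).flatMap U ++ [some (e 0, true)])))) := by
  have := merge_chain_aux he U hU n 1 (U 0) le_rfl (by omega) fun i => hU i 0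
  rw [List.range_eq_range', List.range'_succ, chain]
  simpa using this

end Ribbon
end

noncomputable section
namespace Ribbon
open Set Topology GenusSurface
variable {α β : Type}

/-! ### Cyclic coverings -/

/-- A family of polygons. -/
@[reducible] def fam {ι : Type} [TopologicalSpace ι] (v : ι → Word α) : Scheme α :=
  ⟨ι × Disc, fun a t x => (pol (v x.1)).edge a t x.2⟩

section sheets
variable {G : Type} [AddCommGroup G] [TopologicalSpace G]

/-- The `i`-th lift of a word, where the letter `a` with exponent `ε` is shifted by `s a ε`. -/
def lift (s : α → Bool → G) (i : G) (w : Word α) : Word (α × G) :=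
  w.map (Option.map fun p => ((p.1, i + s p.1 p.2), p.2))

/-- The covering scheme. -/
@[reducible] def sheets (s : α → Bool → G) (w : Word α) : Scheme (α × G) := fam fun i => gap (lift s i w)

variable (s : α → Bool → G) (w : Word α)

theorem edge_sheets (b : α × G) (t : ℝ) (x : G × Disc) : (sheets s w).edge b t x ↔
    t ∈ Icc (0 : ℝ) 1 ∧ ∃ (k : ℕ) (ε : Bool), w[k]? = some (some (b.1, ε)) ∧
      b.2 = x.1 + s b.1 ε ∧ x.2 = gapPt w.length k (dir ε t) := by
  change (pol (gap (lift s x.1 w))).edge b t x.2 ↔ _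
  rw [edge_gap]
  refine and_congr_right fun _ => exists_congr fun k => exists_congr fun ε => ?_
  rw [← and_assoc, show (lift s x.1 w).length = w.length by simp [lift]]
  refine and_congr_left fun _ => ?_
  obtain ⟨a, j⟩ := b
  simp only [lift, List.getElem?_map, Option.map_eq_some_iff, Prod.mk.injEq, Prod.exists]
  constructor
  · rintro ⟨y, h, a', ε', rfl, ⟨rfl, rfl⟩, rfl⟩
    exact ⟨h, rfl⟩
  · rintro ⟨h, rfl⟩
    exact ⟨_, h, a, ε, rfl, ⟨rfl, rfl⟩, rfl⟩

theorem edge_sheets_unique {b b' : α × G} {t t' : ℝ} {x : G × Disc} (h : (sheets s w).edge b t x)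
    (h' : (sheets s w).edge b' t' x) : b = b' ∧ t = t' :=
  edge_gap_unique (w := lift s x.1 w) h h'

theorem edge_of_sheets {b : α × G} {t : ℝ} {x : G × Disc} (h : (sheets s w).edge b t x) :
    (pol (gap w)).edge b.1 t x.2 := by
  obtain ⟨ht, k, ε, h1, -, h2⟩ := (edge_sheets _ _ _ _ _).1 h
  exact (edge_gap _ _ _ _).2 ⟨ht, k, ε, h1, h2⟩

/-- The covering projection. -/
def proj : (sheets s w).space → (pol (gap w)).space :=
  Scheme.desc _ (fun x => (pol (gap w)).mk' x.2) fun _ _ _ _ hx hy =>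
    Scheme.glue (edge_of_sheets s w hx) (edge_of_sheets s w hy)

theorem edge_sheets_add (c : G) {b : α × G} {t : ℝ} {x : G × Disc} (h : (sheets s w).edge b t x) :
    (sheets s w).edge (b.1, c + b.2) t (c + x.1, x.2) := by
  obtain ⟨ht, k, ε, h1, h2, h3⟩ := (edge_sheets _ _ _ _ _).1 h
  exact (edge_sheets _ _ _ _ _).2 ⟨ht, k, ε, h1, by simp [h2, add_assoc], h3⟩

instance : AddAction G (sheets s w).space where
  vadd c := Scheme.desc _ (fun x => (sheets s w).mk' (c + x.1, x.2)) fun _ _ _ _ hx hy =>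
    Scheme.glue (edge_sheets_add s w c hx) (edge_sheets_add s w c hy)
  zero_vadd := by
    rintro ⟨i, z⟩
    exact congrArg (fun j => (sheets s w).mk' (j, z)) (zero_add i)
  add_vadd c c' := by
    rintro ⟨i, z⟩
    exact congrArg (fun j => (sheets s w).mk' (j, z)) (add_assoc c c' i)

/-- The translations act freely. Disjoint arcs mean that a point of the base disc lies on one
occurrence of one letter at most, so glued points over the same `z` carry the same shift and lie in
the same sheet. -/
instance : IsCancelVAdd G (sheets s w).space where
  right_cancel' c c' := by
    rintro ⟨i, z⟩ (h : (sheets s w).mk' (c + i, z) = (sheets s w).mk' (c' + i, z))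
    rcases (Scheme.mk_eq_iff (edge_sheets_unique s w)).1 h with h | ⟨b, t, h1, h2⟩
    · exact add_right_cancel (congrArg Prod.fst h)
    · obtain ⟨ht, k, ε, a1, a2, a3⟩ := (edge_sheets _ _ _ _ _).1 h1
      obtain ⟨-, k', ε', b1, b2, b3⟩ := (edge_sheets _ _ _ _ _).1 h2
      obtain ⟨rfl, -⟩ := gapPt_inj (List.getElem?_eq_some_iff.1 a1).1
        (List.getElem?_eq_some_iff.1 b1).1 (dir_mem ht) (dir_mem ht) (a3.symm.trans b3)
      rw [a1] at b1
      simp only [Option.some.injEq, Prod.mk.injEq, true_and] at b1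
      subst b1
      exact add_right_cancel (add_right_cancel (a2.symm.trans b2))

theorem isQuotientMap_proj : IsQuotientMap (proj s w) := by
  have h1 : Continuous (proj s w) :=
    Scheme.continuous_desc _ ((Scheme.continuous_mk' _).comp continuous_snd) _
  have h2 : IsQuotientMap (proj s w ∘ (sheets s w).mk') :=
    (Scheme.isQuotientMap_mk' (pol (gap w))).comp
      (isOpenMap_snd.isQuotientMap continuous_snd Prod.snd_surjective)
  exact h2.of_comp (Scheme.continuous_mk' _) h1

/-- Points over the same point of the disc differ by a translation. Crossing an arc from an
occurrence `ε` to an occurrence `ε'` changes the sheet by `s a ε - s a ε'`, again a translation. -/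
theorem proj_eq_iff {x y : (sheets s w).space} :
    proj s w x = proj s w y ↔ x ∈ AddAction.orbit G y := by
  constructor
  · obtain ⟨i, z⟩ := x
    obtain ⟨j, z'⟩ := y
    intro h
    rcases mk_eq_iff.1 h with rfl | ⟨a, t, h1, h2⟩
    · exact ⟨i - j, congrArg (fun k => (sheets s w).mk' (k, z)) (sub_add_cancel i j)⟩
    · obtain ⟨ht, k, ε, a1, a2⟩ := (edge_gap _ _ _ _).1 h1
      obtain ⟨-, k', ε', b1, b2⟩ := (edge_gap _ _ _ _).1 h2
      refine ⟨i + s a ε - s a ε' - j, ?_⟩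
      refine (congrArg (fun k => (sheets s w).mk' (k, z')) (sub_add_cancel _ j)).trans ?_
      exact Scheme.glue (a := (a, i + s a ε))
        ((edge_sheets _ _ _ _ _).2 ⟨ht, k', ε', b1, by simp, b2⟩)
        ((edge_sheets _ _ _ _ _).2 ⟨ht, k, ε, a1, rfl, a2⟩)
  · rintro ⟨c, rfl⟩
    obtain ⟨i, z⟩ := y
    rfl

variable [DiscreteTopology G]

instance : ContinuousConstVAdd G (sheets s w).space where
  continuous_const_vadd c := Scheme.continuous_desc _
    ((Scheme.continuous_mk' _).comp (by
      have : Continuous fun i : G => c + i := continuous_of_discreteTopology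
      fun_prop)) _

/-- The projection is the quotient by a free action of a finite group on a Hausdorff space, hence a
covering whose fibres are copies of the group. -/
theorem covering_sheets [Finite G] [T2Space (sheets s w).space] :
    IsCoveringMap (proj s w) ∧ ∀ y, (proj s w ⁻¹' {y}).encard = Nat.card G := by
  have : CompactSpace (sheets s w).carrier := inferInstanceAs (CompactSpace (G × Disc))
  have h := (isQuotientMap_proj s w).isAddQuotientCoveringMap_of_properlyDiscontinuousVAdd (G := G)
    (proj_eq_iff s w)
  refine ⟨h.isCoveringMap, fun y => ?_⟩
  obtain ⟨x, hx⟩ := h.surjective y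
  rw [encard, ENat.card_congr (h.fiberEquivAddGroup ⟨x, hx⟩), ENat.card_eq_coe_natCard]

end sheets

theorem notIn_lift {G : Type} [AddCommGroup G] (s : α → Bool → G) (i j : G) {a : α} {w : Word α}
    (h : NotIn a w) : NotIn (a, j) (lift s i w) := by
  intro ε hε
  simp only [lift, List.mem_map, Option.map_eq_some_iff, Prod.mk.injEq, Prod.exists] at hε
  obtain ⟨x, hx, a', ε', rfl, ⟨rfl, -⟩, -⟩ := hε
  exact h _ hx

/-! ### Families of polygons as chains -/

theorem fam_reindex {ι κ : Type} [TopologicalSpace ι] [DiscreteTopology ι] [TopologicalSpace κ]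
    [DiscreteTopology κ] (f : κ ≃ ι) (v : ι → Word α) : (fam (v ∘ f)).Iso (fam v) :=
  ⟨(Homeomorph.mk f continuous_of_discreteTopology continuous_of_discreteTopology).prodCongr
    (.refl Disc), fun _ _ _ => Iff.rfl⟩

theorem fam_succ (n : ℕ) (v : Fin (n + 1) → Word α) :
    (fam v).Iso ((pol (v 0)).sum (fam fun i : Fin n => v i.succ)) := by
  let f : Disc ⊕ (Fin n × Disc) ≃ Fin (n + 1) × Disc :=
    { toFun := Sum.elim (fun z => (0, z)) fun p => (p.1.succ, p.2)
      invFun := fun p => Fin.cases (motive := fun _ => Disc ⊕ (Fin n × Disc)) (.inl p.2)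
        (fun i => .inr (i, p.2)) p.1
      left_inv := by rintro (z | ⟨i, z⟩) <;> rfl
      right_inv := by rintro ⟨i, z⟩; induction i using Fin.cases <;> rfl }
  have hf : Continuous f := by
    refine continuous_sum_dom.2 ⟨?_, ?_⟩
    · change Continuous fun z : Disc => ((0 : Fin (n + 1)), z)
      fun_prop
    · have : Continuous fun i : Fin n => i.succ := continuous_of_discreteTopology
      change Continuous fun p : Fin n × Disc => (p.1.succ, p.2)
      fun_prop
  refine Scheme.Iso.symm ⟨hf.homeoOfEquivCompactToT2, fun a t => ?_⟩
  rintro (z | ⟨i, z⟩) <;> exact Iff.rfl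

theorem fam_iso_chain (e : ℕ → α) (U : ℕ → Word α) (m : ℕ) : ∀ k,
    (fam fun i : Fin m => gap (some (e (k + i), false) :: (U (k + i) ++
      [some (e (k + i + 1), true)]))).Iso (chain e U k m) := by
  induction m with
  | zero =>
    intro k
    have h : IsEmpty (Fin 0 × Disc) := inferInstance
    change (fam _).Iso Scheme.empty
    exact ⟨Homeomorph.empty, fun a t x => (h.false x).elim⟩
  | succ m ih =>
    intro k
    refine (fam_succ m _).trans ?_
    have := ih (k + 1)
    refine Scheme.Iso.sum (by simpa using Scheme.Iso.refl _) ?_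
    have hi (i : Fin m) : k + 1 + (i : ℕ) = k + (i.succ : ℕ) := by simp; ring
    simpa only [hi] using this

end Ribbon
end

noncomputable section
namespace Ribbon
open Set Topology GenusSurface
variable {α β : Type}

/-! ### The cyclic covering of the sphere with holes -/

/-- Trivial pairs, with an additional one if `p`. -/
def basePairs (p : Bool) : ℕ → List (Item ℕ)
  | 0 => if p then [.pair 2 true] else []
  | m + 1 => .pair (2 * m + 1) true :: .pair (2 * m + 4) true :: basePairs p m

/-- Positive occurrences of even letters and negative ones of odd letters are shifted. -/
def shift (G : Type) [AddCommGroup G] [One G] (a : ℕ) (ε : Bool) : G :=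
  -- Thus the positive arc of an even letter in sheet `i` is glued to the negative one in sheet `i +
  -- 1`, that of an odd letter to the one in sheet `i - 1`.
  if (a % 2 == 0) = ε then 1 else 0

@[simp] theorem Item.isComm_pair (c : α) (ε : Bool) : (Item.pair c ε).isComm = false := rfl

/-- The bounds reflect the numbering: each step takes one odd letter and one even letter from `4`
on, so that their shifts cancel. The letter `2` is kept for the additional pair and `0` for joining
the sheets. -/
theorem basePairs_spec (p : Bool) (m : ℕ) : (iletters (basePairs p m)).Nodup ∧
    (∀ a ∈ iletters (basePairs p m), 0 < a ∧ (a % 2 = 1 → a < 2 * m) ∧ (a % 2 = 0 → a < 2 * m + 4)) ∧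
    (basePairs p m).countP Item.isComm = 0 ∧
    (basePairs p m).countP (fun i => !i.isComm) = 2 * m + p.toNat := by
  induction m with
  | zero => cases p <;> simp [basePairs, Item.letters]
  | succ m ih =>
    obtain ⟨h1, h2, h3, h4⟩ := ih
    simp only [basePairs, iletters_cons, Item.letters, List.cons_append, List.nil_append,
      List.nodup_cons, List.mem_cons, forall_eq_or_imp]
    refine ⟨⟨?_, fun h => ?_, h1⟩, ⟨by omega, by omega, fun a ha => ?_⟩, ?_, ?_⟩
    · rintro (h | h)
      · omega
      · have := h2 _ h; omega
    · have := h2 _ h; omega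
    · have := h2 a ha; omega
    · simp [h3]
    · simp [h4]; ring

/-- The lifts of one letter form a cycle because `n + 1` vanishes in `ZMod (n + 1)`. -/
theorem isCycle_cast (n a : ℕ) : IsCycle n fun i => ((a, (i : ZMod (n + 1))) : ℕ × ZMod (n + 1)) := by
  refine ⟨?_, fun i j h1 h2 h3 hij h => ?_⟩
  · have : ((n + 1 : ℕ) : ZMod (n + 1)) = 0 := ZMod.natCast_self _
    simp only [this, Nat.cast_zero]
  · have := (ZMod.natCast_eq_natCast_iff' i j (n + 1)).1 (Prod.mk.inj h).2
    rw [Nat.mod_eq_of_lt (by omega)] at this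
    rcases Nat.lt_or_ge j (n + 1) with hj | hj
    · rw [Nat.mod_eq_of_lt hj] at this; exact hij this
    · obtain rfl : j = n + 1 := by omega
      rw [Nat.mod_self] at this; omega

/-- The lifts of the trivial pairs reduce to commutators and trivial pairs. -/
theorem red_lift (p : Bool) (n q : ℕ) (hq : p = true → n = 2 * q) (m : ℕ) :
    Red (m * n + p.toNat * q) (2 * m + p.toNat) ((List.range (n + 1)).flatMap fun i : ℕ =>
      lift (shift (ZMod (n + 1))) (i : ZMod (n + 1)) (iword (basePairs p m))) [] := by
  induction m with
  | zero =>
    cases p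
    · have : (List.range (n + 1)).flatMap (fun i : ℕ =>
        lift (shift (ZMod (n + 1))) (i : ZMod (n + 1)) (iword (basePairs false 0))) = [] := by
        simp [basePairs, lift]
      rw [this]
      simpa using Red.refl []
    · obtain rfl := hq rfl
      -- The additional letter alone gives `q` commutators and a pair. This needs an odd number `2 *
      -- q + 1` of sheets.
      have := Red.single (isCycle_cast (2 * q) 2)
      simpa [basePairs, lift, Item.word, shift] using this
  | succ m ih =>
    obtain ⟨-, h2, -⟩ := basePairs_spec p m
    have hN (a : ℕ) (ha : a ∉ iletters (basePairs p m)) (i j : ℕ) :=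
      notIn_lift (shift (ZMod (n + 1))) (j : ZMod (n + 1)) (i : ZMod (n + 1))
        ((notIn_iword (basePairs p m) a).2 ha)
    -- With opposite shifts the lifts of an odd and an even letter follow the pattern `x i, (x (i +
    -- 1))⁻¹, y (i + 1), (y i)⁻¹` of `Red.double`, giving `n` commutators and two pairs.
    have h := Red.double (isCycle_cast n (2 * m + 1)) (isCycle_cast n (2 * m + 4))
      (fun i j h => by have := (Prod.mk.inj h).1; omega)
      (fun i : ℕ => lift (shift (ZMod (n + 1))) (i : ZMod (n + 1)) (iword (basePairs p m)))
      (hN _ fun h => by have := h2 _ h; omega) (hN _ fun h => by have := h2 _ h; omega)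
    have h' := h.trans ih
    have e1 : (2 * m + 1) % 2 = 1 := by omega
    have e2 : (2 * m + 4) % 2 = 0 := by omega
    have e : ∀ i : ℕ, lift (shift (ZMod (n + 1))) (i : ZMod (n + 1)) (iword (basePairs p (m + 1))) =
        some ((2 * m + 1, (i : ZMod (n + 1))), true) ::
        some ((2 * m + 1, ((i + 1 : ℕ) : ZMod (n + 1))), false) ::
        some ((2 * m + 4, ((i + 1 : ℕ) : ZMod (n + 1))), true) ::
        some ((2 * m + 4, (i : ZMod (n + 1))), false) ::
        lift (shift (ZMod (n + 1))) (i : ZMod (n + 1)) (iword (basePairs p m)) := by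
      intro i
      simp [basePairs, lift, Item.word, shift, e1, e2]
    simp only [e]
    convert h' using 1 <;> ring

/-- The base of the covering. -/
def baseWord (p : Bool) (m : ℕ) : Word ℕ :=
  some (0, false) :: (iword (basePairs p m) ++ [some (0, true)])

theorem baseWord_equiv (p : Bool) (m : ℕ) :
    (pol (gap (baseWord p m))).Equiv (pol (gap (stdWord 0 (2 * m + p.toNat + 1)))) := by
  obtain ⟨h1, h2, h3, h4⟩ := basePairs_spec p m
  refine Scheme.Equiv.trans ?_ (iword_equiv_std (basePairs p m ++ [.pair 0 true]) ?_ _ _ ?_ ?_)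
  · have := (rotate (gap [some (0, false)]) (gap (iword (basePairs p m) ++ [some (0, true)]))).equiv
    simpa [baseWord, Item.word] using this
  · simp only [iletters_append, iletters_cons, iletters_nil, Item.letters, List.append_nil,
      List.nodup_append, h1, List.nodup_cons, List.not_mem_nil, not_false_eq_true, List.nodup_nil,
      List.mem_singleton, true_and, and_self]
    rintro a ha b rfl rfl
    exact absurd (h2 _ ha).1 (lt_irrefl _)
  · simp [h3]
  · simp [h4]

/-- The letter `0` begins and ends the base word, so its lifts string the `n + 1` sheets into a
cyclic chain, which merges into one polygon with a single pair of lifts of `0` left. `red_lift`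
supplies the commutators and the other `n - 1` pairs. -/
theorem sheets_equiv (p : Bool) (m n q : ℕ) (hn : n = 2 * m + p.toNat + 1) (hq : p = true → n = 2 * q) :
    (sheets (shift (ZMod (n + 1))) (baseWord p m)).Equiv
      (pol (gap (stdWord (m * n + p.toNat * q) n))) := by
  set e : ℕ → ℕ × ZMod (n + 1) := fun i => (0, i) with he
  set U : ℕ → Word (ℕ × ZMod (n + 1)) := fun i =>
    lift (shift (ZMod (n + 1))) (i : ZMod (n + 1)) (iword (basePairs p m)) with hU
  obtain ⟨-, h2, -⟩ := basePairs_spec p m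
  have hUN (a : ℕ × ZMod (n + 1)) (ha : a.1 = 0) (j : ℕ) : NotIn a (U j) := by
    obtain ⟨a, i⟩ := a
    refine notIn_lift _ _ _ ((notIn_iword _ _).2 fun h => ?_)
    have := (h2 _ h).1
    simp at ha; omega
  let f : Fin (n + 1) ≃ ZMod (n + 1) := Equiv.ofBijective (fun i => ((i : ℕ) : ZMod (n + 1))) <| by
    rw [Fintype.bijective_iff_injective_and_card]
    refine ⟨fun i j h => Fin.ext ?_, by simp⟩
    have := (ZMod.natCast_eq_natCast_iff' i j (n + 1)).1 h
    rwa [Nat.mod_eq_of_lt i.2, Nat.mod_eq_of_lt j.2] at this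
  have s1 := (fam_reindex f fun i => gap (lift (shift (ZMod (n + 1))) i (baseWord p m))).symm
  have s2 := fam_iso_chain e U (n + 1) 0
  have hw (i : Fin (n + 1)) : gap (lift (shift (ZMod (n + 1))) (f i) (baseWord p m)) =
      gap (some (e (0 + i), false) :: (U (0 + i) ++ [some (e (0 + i + 1), true)])) := by
    simp [baseWord, lift, shift, f, e, U]
  have s3 : (sheets (shift (ZMod (n + 1))) (baseWord p m)).Iso (chain e U 0 (n + 1)) := by
    refine s1.trans ?_
    rw [← funext hw] at s2
    exact s2
  have s4 := merge_chain (isCycle_cast n 0) U fun i j => hUN _ rfl j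
  set D := (List.range (n + 1)).flatMap U with hD
  have s5 := (rotate (gap [some (e 0, false)]) (gap (D ++ [some (e 0, true)]))).equiv
  obtain ⟨N, ⟨hN, -⟩, s6, c1, c2⟩ := red_lift p n q hq m [.pair (e 0) true] ⟨by simp [Item.letters], by
    intro a ha
    obtain rfl : a = e 0 := by simpa [Item.letters] using ha
    exact (notIn_flatMap _ _ _).2 fun i _ => hUN _ rfl i⟩
  have s7 := iword_equiv_std N hN (m * n + p.toNat * q) n (by simpa using c1) (by
    rw [c2]; simp; omega)
  have s8 := Eqv.equiv s6
  simp only [iword_cons, iword_nil, Item.word,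
    gap_append, gap_cons, gap_nil, List.append_assoc, List.cons_append, List.nil_append,
    List.append_nil, Bool.not_true] at s4 s5 s7 s8
  exact s3.equiv.trans (s4.trans (s5.trans (s8.trans s7)))

theorem exists_covering_of_pos (p : Bool) (m n q : ℕ) (hn : n = 2 * m + p.toNat + 1)
    (hq : p = true → n = 2 * q) :
    ∃ f : surface (m * n + p.toNat * q) (n + 1) → surface 0 (n + 1), IsFoldCovering (n + 1) f := by
  obtain ⟨e1⟩ := sheets_equiv p m n q hn hq
  obtain ⟨e2⟩ := surface_equiv_std (m * n + p.toNat * q) n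
  obtain ⟨e3⟩ := baseWord_equiv p m
  rw [← hn] at e3
  obtain ⟨e4⟩ := surface_equiv_std 0 n
  let e := e1.trans e2
  let e' := e3.trans e4
  have : T2Space (sheets (shift (ZMod (n + 1))) (baseWord p m)).space := e.symm.t2Space
  obtain ⟨h1, h2⟩ := covering_sheets (shift (ZMod (n + 1))) (baseWord p m)
  refine ⟨e' ∘ proj _ _ ∘ e.symm, ?_, fun y => ?_⟩
  · exact (h1.comp_homeomorph e.symm).homeomorph_comp e'
  · have : e' ∘ proj (shift (ZMod (n + 1))) (baseWord p m) ∘ e.symm ⁻¹' {y} =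
        e '' (proj (shift (ZMod (n + 1))) (baseWord p m) ⁻¹' {e'.symm y}) := by
      ext x
      rw [e.image_eq_preimage_symm]
      exact e'.toEquiv.eq_symm_apply.symm
    rw [this, e.injective.encard_image, h2, Nat.card_zmod]

/-- The cyclic covering. -/
theorem exists_covering (g n : ℕ) (h : 2 * g = n * (n - 1)) :
    ∃ f : surface g (n + 1) → surface 0 (n + 1), IsFoldCovering (n + 1) f := by
  rcases n with - | n
  -- With a single sheet the identity is the covering.
  · obtain rfl : g = 0 := by omega
    refine ⟨id, fun x => IsEvenlyCovered.to_isEvenlyCovered_preimage (I := Unit) ⟨inferInstance, univ,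
      mem_univ _, isOpen_univ, isOpen_univ, (Homeomorph.prodPUnit _).symm, fun _ => rfl⟩,
      fun y => by simp⟩
  · rw [Nat.add_sub_cancel] at h
    obtain ⟨m, rfl | rfl⟩ := n.even_or_odd'
    · obtain rfl : g = m * (2 * m + 1) + false.toNat * 0 := by simp; linarith
      exact exists_covering_of_pos false m (2 * m + 1) 0 (by simp) (by simp)
    · obtain rfl : g = m * (2 * m + 1 + 1) + true.toNat * (m + 1) := by simp; linarith
      exact exists_covering_of_pos true m (2 * m + 1 + 1) (m + 1) (by simp) (by intro _; ring)

end Ribbon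
end

/-! ### Conclusion -/

/-- The genus equation over the rationals. -/
theorem Ribbon.genus_eq_iff (g n : ℕ) :
    (g : ℚ) = (((n + 1 : ℕ) : ℚ) - 1) * (((n + 1 : ℕ) : ℚ) - 2) / 2 ↔ 2 * g + n = n * n := by
  have : (g : ℚ) = (((n + 1 : ℕ) : ℚ) - 1) * (((n + 1 : ℕ) : ℚ) - 2) / 2 ↔
      ((2 * g + n : ℕ) : ℚ) = ((n * n : ℕ) : ℚ) := by
    push_cast
    constructor <;> intro h <;> linarith
  rw [this, Nat.cast_inj]

theorem proposition3p4 (g d : ℕ) (hd : 1 ≤ d) :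
    (∃ f : GenusSurface.surface g d → GenusSurface.holedSphere d,
        GenusSurface.IsFoldCovering d f) ↔
      (g : ℚ) = ((d : ℚ) - 1) * ((d : ℚ) - 2) / 2 := by
  obtain ⟨n, rfl⟩ := Nat.exists_eq_add_of_le' hd
  -- With `d = n + 1` the equation reads `2 * g + n = n * n`, free of subtraction, and the holed
  -- sphere is the surface of genus zero.
  rw [Ribbon.genus_eq_iff, Ribbon.holedSphere_eq]
  constructor
  · rintro ⟨f, hf, hc⟩
    have := Ribbon.genus_of_covering g n f hf hc
    nlinarith
  · intro h
    refine Ribbon.exists_covering g n ?_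
    rw [Nat.mul_sub, mul_one]
    omega
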